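/- **Setting.** Let $X=\mathbb Z\varpi_1\oplus\mathbb Z\varpi_2$ be the weight lattice of type $C_2$ ($Sp_4$), with positive roots $\alpha_1=2\varpi_1-\varpi_2$, $\alpha_2=-2\varpi_1+2\varpi_2$, $\alpha_{12}=2\alpha_1+\alpha_2$, $\alpha_{21}=\alpha_1+\alpha_2$ and coroots $\alpha_1^\vee,\alpha_2^\vee$, $\alpha_{12}^\vee=\alpha_1^\vee+\alpha_2^\vee$, $\alpha_{21}^\vee=\alpha_1^\vee+2\alpha_2^\vee$. The affine reflection of $M\delta+\beta^\vee$ is $x\mapsto x-(\langle x,\beta^\vee\rangle-M)\beta$. Let $y_m$ be the product of the first $m$ letters of $y_\infty=(s_0s_2s_1s_2)(s_0s_2s_1s_2)\cdots$, where $s_0$ is the reflection of $\delta-\alpha_{21}^\vee$, let $N(y_m)$ be its inversion set, and let $t_k=y_ky_{k-1}^{-1}$, so that $N(y_m)$ consists of the positive affine coroots of $t_1,\dots,t_m$. On $X$ take the Bruhat order $\le$ generated by $s_{M\delta+\beta^\vee}(x)<x$ for $\beta>0$ and $\langle x,\beta^\vee\rangle>M\ge 0$ or $\langle x,\beta^\vee\rangle<M<0$.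 For $\zeta$ dominant, $\Gamma_\zeta$ is the graph on $\{x\le\zeta\}$ with edge set $E(\zeta)$: there is an edge $\mu\to\nu$ if $\mu<\nu$ and $\nu-\mu$ is a multiple of a root. Let $\ell_m(\mu,\zeta)$ be the number of arrows into $\mu$ after reversing the arrows of $\Gamma_\zeta$ with label in $N(y_m)$. An edge $\mu\to t_{k+1}\mu$ of $\Gamma_\zeta$ is *swappable* if $\ell_k(\mu,\zeta)=\ell_k(t_{k+1}\mu,\zeta)-1$; let $E^S(\zeta)$, $E^N(\zeta)$ be the sets of swappable and of non-swappable edges of the form $\mu\to t_{k+1}\mu$, and let $\mathcal N_m(\mu,\zeta)$ be the number of $k\le m$ with $(\mu\to t_k\mu)\in E^N(\zeta)$. The *elevation* $\Omega(e)$ of $e=(\mu\to\mu-k\alpha)\in E(\zeta)$ is the least $j\ge0$ such that either $(\mu\to\mu-(k-j)\alpha)\in E^S(\zeta-j\varpi_2)$, or $j=k$, $\zeta-j\varpi_2$ is dominant and $\mu\le\zeta-j\varpi_2$. Let $\widehat{\mathcal D}_m(\mu,\zeta)$ be the largest $s$ for which there are a positive root $\alpha$ and $n\ge0$, with $n=0$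 or $(\mu\to\mu-n\alpha)\in E^S(\zeta)$, such that $(\mu\to\mu-(n+i)\alpha)\in E^N(\zeta+i\varpi_2)$ with label in $N(y_m)$ for $1\le i\le s$; and $\mathcal D_m(\mu,\zeta,a)=\min(a,\widehat{\mathcal D}_m(\mu,\zeta-a\varpi_2))$. Let $\mathcal B(\lambda)$ be the irreducible normal crystal of highest weight $\lambda=(\lambda_1,\lambda_2)$; its elements are given by their adapted strings $T=(a,b,c,d)$, i.e. $T=f_2^af_1^bf_2^cf_1^dv_\lambda$. Let $\Phi:\mathcal B(\lambda)\to\mathcal B(\lambda+2\varpi_1)$, $(a,b,c,d)\mapsto(a,b+1,c+1,d+1)$, and let $\mathcal P(\lambda)=\mathcal B(\lambda)\setminus\Phi(\mathcal B(\lambda-2\varpi_1))$ if $\lambda_1\ge2$, $\mathcal P(\lambda)=\mathcal B(\lambda)$ if $\lambda_1\le1$. On $\mathcal P(\lambda)$ let $\Psi(a,b,c,d)=(a,b+1,c+1,d)$ if $d\in\{0,\lambda_1\}$ and $(a,b,c+1,d+1)$ otherwise, and let $\bar\Psi:\mathcal P(\lambda)\to\mathcal P(\lambda+\varpi_2)$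 be $\Psi$ on the elements with $\mathrm{wt}(T)_1\le0$ and $s_1\Psi s_1$ on the others. With $\kappa=1$ if $\lambda_1\ne0$ and $\kappa=2$ if $\lambda_1=0$, let $\mathcal A(\lambda)=\mathcal P(\lambda)\setminus\bar\Psi^{\kappa}(\mathcal P(\lambda-\kappa\varpi_2))$ (and $\mathcal A(\lambda)=\mathcal P(\lambda)$ if $\lambda_2<\kappa$). Then $\mathcal B(\lambda)$ is the disjoint union of the copies $\Phi^p\bar\Psi^a\mathcal A(\lambda-2p\varpi_1-a\varpi_2)$ of atoms, with $0\le 2p\le\lambda_1$, $0\le a\le\lambda_2$ and $a$ even if $2p=\lambda_1$. For $T$ in the $(p,a)$-th copy write $p=\mathrm{pat}(T)$, $a=\mathrm{at}(T)$. With $\mu=\mathrm{wt}(T)$ and $\zeta=\lambda-2p\varpi_1$ put $$\sigma_m(T)=\ell_m(\mu,\zeta-a\varpi_2)-\mathcal N_m(\mu,\zeta-a\varpi_2)+\mathcal D_m(\mu,\zeta,a)+a+2p,\qquad r_m(T)=-\sigma_m(T)+\langle\lambda,\rho^\vee\rangle\in\tfrac12\mathbb Z,$$ where $\langle\lambda,\rho^\vee\rangle=\tfrac32\lambda_1+2\lambda_2$.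 A function $r$ on $\mathcal B(\lambda)$ is a *recharge for $\eta_m$* if $\tilde h^{\eta_m}_{\mu,\lambda}(q^{1/2})=\sum_{T\in\mathcal B(\lambda)_\mu}q^{r(T)}$ for all $\mu\le\lambda$. Here $\tilde h^{\eta_m}_{\mu,\lambda}$ is the renormalized Kazhdan–Lusztig polynomial for the chamber of cocharacters on which, among the positive affine coroots, exactly those in $N(y_m)$ are negative. In terms of the Hecke algebra, $\tilde h^{\eta_m}_{\mu,\lambda}(q^{1/2})=(T_{s'_m}\cdots T_{s'_1}C_\lambda)(y_m^{-1}\mu)$, where $s'_1,s'_2,\dots$ are the letters of $y_\infty$; $C_\lambda(\mu)=q^{\langle\mu^+,\rho^\vee\rangle-\ell_0(\mu,\lambda)}K_{\mu^+,\lambda}(q)$ for $\mu\le\lambda$ and $0$ otherwise, with $\mu^+$ the dominant weight in the finite Weyl group orbit of $\mu$ and $K$ the Kostka–Foulkes polynomials; and $T_s$ acts on functions on $X$ by $(T_sg)(x)=q\,g(sx)$ if $x<sx$, $(T_sg)(x)=g(sx)+(1-q)g(x)$ if $sx<x$, and $(T_sg)(x)=g(x)$ if $sx=x$. **Proposition.**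 Let $\lambda$ be dominant, $m\ge0$ and $t=t_{m+1}$. 1. Let $T\in\mathcal B(\lambda)$ have weight $t\mu$ with $\mu<t\mu$ (and hence $\mu<t\mu\le\lambda$). Let $p=\mathrm{pat}(T)$, $a=\mathrm{at}(T)$, so that $T\in\mathcal A(\lambda-2p\varpi_1-a\varpi_2)\subset\mathcal P(\lambda-2p\varpi_1)\subset\mathcal B(\lambda)$. Then $e=(\mu\to t\mu)$ is an edge in $E(\lambda-2p\varpi_1-a\varpi_2)$, its elevation $\Omega(e)$ is well defined, and there is exactly one element $\psi_{t\mu}(T)$ of weight $\mu$ in the atom $\mathcal A(\lambda-2p\varpi_1-(a+\Omega(e))\varpi_2)\subset\mathcal P(\lambda-2p\varpi_1)\subset\mathcal B(\lambda)$. It satisfies $$\sigma_{m+1}(T)=\sigma_{m+1}(\psi_{t\mu}(T))-1.$$ 2. The collection $\psi=\{\psi_\nu\}$ is a swapping function between $\eta_{m+1}$ and $\eta_m$: for every $\nu\leq\lambda$ with $t\nu<\nu$ the map $\psi_\nu:\mathcal B(\lambda)_\nu\to\mathcal B(\lambda)_{t\nu}$ is injective and $r_{m+1}(\psi_\nu(T))=r_{m+1}(T)-1$.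 3. The function $r_m$ is obtained from $r_{m+1}$ by swapping along $\psi$: $r_m(T)=r_{m+1}(\psi(T))$ and $r_m(\psi(T))=r_{m+1}(T)$ for every $T$ in the domain of $\psi$, and $r_m(U)=r_{m+1}(U)$ for all $U\in\mathcal B(\lambda)$ which are neither in the domain nor in the image of $\psi$. 4. In particular, if $r_{m+1}$ is a recharge for $\eta_{m+1}$, then $r_m$ is a recharge for $\eta_m$. -/

import Mathlib

open scoped Classical

/-! # The root system of type `C₂` and its affine reflections -/

/-- The weight lattice `X`; the pair `(x, y)` is the weight `x ϖ₁ + y ϖ₂`. -/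
abbrev Weight : Type := ℤ × ℤ

/-- Names of the four positive roots `α₁`, `α₂`, `α₁₂ = 2α₁ + α₂`, `α₂₁ = α₁ + α₂`. -/
inductive PosRoot : Type
  | a1 | a2 | a12 | a21

namespace PosRoot

/-- The positive root as an element of the weight lattice. -/
def root : PosRoot → Weight
  | a1 => (2, -1)
  | a2 => (-2, 2)
  | a12 => (2, 0)
  | a21 => (0, 1)

/-- The pairing `⟨x, β^∨⟩` with the coroot of `β`, where
`α₁₂^∨ = α₁^∨ + α₂^∨` and `α₂₁^∨ = α₁^∨ + 2 α₂^∨`. -/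
def pairing (x : Weight) : PosRoot → ℤ
  | a1 => x.1
  | a2 => x.2
  | a12 => x.1 + x.2
  | a21 => x.1 + 2 * x.2

end PosRoot

/-- Dominance of a weight: membership in `X₊`. -/
def Dominant (lam : Weight) : Prop := 0 ≤ lam.1 ∧ 0 ≤ lam.2

/-- The fundamental weight `ϖ₁`. -/
def fw1 : Weight := (1, 0)

/-- The fundamental weight `ϖ₂`. -/
def fw2 : Weight := (0, 1)

/-- The pairing `⟨x, ρ^∨⟩`, where `ρ^∨ = (3/2) α₁^∨ + 2 α₂^∨`. -/
def rhoPairing (x : Weight) : ℚ := 3 / 2 * (x.1 : ℚ) + 2 * (x.2 : ℚ)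

/-- The affine reflection attached to the affine coroot `M δ + β^∨`. -/
def affReflFun (β : PosRoot) (M : ℤ) (x : Weight) : Weight :=
  x - (β.pairing x - M) • β.root

theorem affReflFun_involutive (β : PosRoot) (M : ℤ) :
    Function.Involutive (affReflFun β M) := by
  intro x
  cases β <;> ext <;> simp [affReflFun, PosRoot.pairing, PosRoot.root] <;> ring

/-- The affine reflection attached to `M δ + β^∨`, as a permutation of the weight lattice. -/
def affRefl (β : PosRoot) (M : ℤ) : Equiv.Perm Weight :=
  (affReflFun_involutive β M).toPerm

/-- The affine simple reflection `s₀`, attached to `δ - α₂₁^∨`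
(equivalently to its negative `-δ + α₂₁^∨`). -/
def simple0 : Equiv.Perm Weight := affRefl PosRoot.a21 (-1)

/-- The simple reflection `s₁`. -/
def simple1 : Equiv.Perm Weight := affRefl PosRoot.a1 0

/-- The simple reflection `s₂`. -/
def simple2 : Equiv.Perm Weight := affRefl PosRoot.a2 0

/-- The `k`-th letter (`k ≥ 1`) of the infinite reduced word
`y_∞ = (s₀ s₂ s₁ s₂)(s₀ s₂ s₁ s₂)⋯`. -/
def letter (k : ℕ) : Equiv.Perm Weight :=
  if k % 4 = 1 then simple0 else if k % 4 = 3 then simple1 else simple2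

/-- `y_m`, the product of the first `m` letters of `y_∞`. -/
def yElt : ℕ → Equiv.Perm Weight
  | 0 => 1
  | m + 1 => yElt m * letter (m + 1)

/-- The reflection `t_k = y_k y_{k-1}⁻¹`, for `k ≥ 1`. Its positive affine coroot is the `k`-th one
in the list `δ - α₂₁^∨ < δ - α₁₂^∨ < 2δ - α₂₁^∨ < δ - α₂^∨ < 3δ - α₂₁^∨ < 2δ - α₁₂^∨ < ⋯`
of the elements of `N(y_∞)`, and `N(y_m)` consists of the first `m` coroots of this list. -/
def tRefl (k : ℕ) : Equiv.Perm Weight := yElt k * (yElt (k - 1))⁻¹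

/-! # Bruhat order and twisted Bruhat graphs -/

/-- `BruhatStep μ ν`: the weight `μ` is the image of `ν` under the affine reflection attached to some
`M δ + β^∨`, with `β` a positive root, and this reflection lowers `ν`: `⟨ν, β^∨⟩ > M` if `M ≥ 0`,
and `⟨ν, β^∨⟩ < M` if `M < 0`. -/
def BruhatStep (μ ν : Weight) : Prop :=
  ∃ (β : PosRoot) (M : ℤ), μ = affRefl β M ν ∧
    (0 ≤ M → M < β.pairing ν) ∧ (M < 0 → β.pairing ν < M)

/-- The Bruhat order on the weight lattice, generated by the reflection relations. -/
def BruhatLE : Weight → Weight → Prop := Relation.ReflTransGen BruhatStep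

/-- The strict Bruhat order. -/
def BruhatLT (μ ν : Weight) : Prop := BruhatLE μ ν ∧ μ ≠ ν

/-- `IsEdge lam μ ν`: there is an edge `μ → ν` in the Bruhat graph `Γ_lam`, i.e. it lies
in `E(lam)`. -/
def IsEdge (lam μ ν : Weight) : Prop :=
  Dominant lam ∧ BruhatLT μ ν ∧ BruhatLE ν lam ∧
    ∃ (β : PosRoot) (k : ℤ), ν - μ = k • β.root

/-- For distinct weights joined by an edge: the label of the edge lies in `N(y_m)`, i.e. the
reflection exchanging the two weights is one of `t_1, …, t_m`. -/
def LabelIn (m : ℕ) (μ ν : Weight) : Prop :=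
  ∃ k : ℕ, 1 ≤ k ∧ k ≤ m ∧ ν = tRefl k μ

/-- `IsTwistedEdge m lam ν μ`: there is an arrow `ν → μ` in the `y_m`-twisted Bruhat graph, which is
obtained from `Γ_lam` by inverting all the arrows with label in `N(y_m)`. -/
def IsTwistedEdge (m : ℕ) (lam ν μ : Weight) : Prop :=
  (IsEdge lam ν μ ∧ ¬ LabelIn m ν μ) ∨ (IsEdge lam μ ν ∧ LabelIn m μ ν)

/-- `ℓ_m(μ, lam)`: the number of arrows pointing to `μ` in the `y_m`-twisted Bruhat graph
of `lam`. -/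
noncomputable def ellTw (m : ℕ) (μ lam : Weight) : ℕ :=
  Set.ncard {ν : Weight | IsTwistedEdge m lam ν μ}

/-- The edge `μ → ν` lies in `E^S(lam)`: it is of the form `μ → t_{m+1} μ` and is swappable. -/
def IsSwappable (lam μ ν : Weight) : Prop :=
  ∃ m : ℕ, ν = tRefl (m + 1) μ ∧ IsEdge lam μ ν ∧
    (ellTw m μ lam : ℤ) = (ellTw m ν lam : ℤ) - 1

/-- The edge `μ → ν` lies in `E^N(lam)`: it is of the form `μ → t_{m+1} μ` and is not swappable. -/
def IsNonSwappable (lam μ ν : Weight) : Prop :=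
  ∃ m : ℕ, ν = tRefl (m + 1) μ ∧ IsEdge lam μ ν ∧
    (ellTw m μ lam : ℤ) ≠ (ellTw m ν lam : ℤ) - 1

/-- `𝒩_m(μ, lam)`: the number of non-swappable edges `μ → t_k μ` in `Γ_lam` with `k ≤ m`. -/
noncomputable def nonSwapCount (m : ℕ) (μ lam : Weight) : ℕ :=
  Set.ncard {k : ℕ | 1 ≤ k ∧ k ≤ m ∧ IsNonSwappable lam μ (tRefl k μ)}

/-- The integers `j ≥ 0` such that, writing the edge as `μ → ν = μ - kα`, the shortened edge
`μ → μ - (k - j)α` lies in `E^S(lam - j ϖ₂)`. The degenerate case `j = k`, in which the shortened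
edge is the point `μ`, is admitted as soon as `μ` is a vertex of `Γ_{lam - j ϖ₂}`. -/
def elevationSet (lam μ ν : Weight) : Set ℕ :=
  {j : ℕ | ∃ (α : PosRoot) (k : ℤ), ν = μ - k • α.root ∧
    ((k = (j : ℤ) ∧ Dominant (lam - j • fw2) ∧ BruhatLE μ (lam - j • fw2)) ∨
      IsSwappable (lam - j • fw2) μ (μ - (k - (j : ℤ)) • α.root))}

/-- The elevation `Ω(e)` of the edge `e = (μ → ν)` in `E(lam)`. -/
noncomputable def elevation (lam μ ν : Weight) : ℕ := sInf (elevationSet lam μ ν)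

/-- The edges `e_i = (μ → μ - (n + i)α)`, `1 ≤ i ≤ len`, form a staircase of non-swappable edges
over `(μ, lam)`. -/
def IsStaircase (μ lam : Weight) (α : PosRoot) (n len : ℕ) : Prop :=
  (∀ i : ℕ, 1 ≤ i → i ≤ len →
    IsNonSwappable (lam + i • fw2) μ (μ - (n + i) • α.root)) ∧
  (n = 0 ∨ IsSwappable lam μ (μ - n • α.root))

/-- The length of the longest staircase of non-swappable edges over `(μ, lam)` all of whose edges
have label in `N(y_m)`. -/
noncomputable def staircaseMax (m : ℕ) (μ lam : Weight) : ℕ :=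
  sSup {len : ℕ | ∃ (α : PosRoot) (n : ℕ), IsStaircase μ lam α n len ∧
    ∀ i : ℕ, 1 ≤ i → i ≤ len → LabelIn m μ (μ - (n + i) • α.root)}

/-- The truncated quantity `𝒟_m(μ, lam, k)`. -/
noncomputable def staircaseTrunc (m : ℕ) (μ lam : Weight) (k : ℕ) : ℕ :=
  min k (staircaseMax m μ (lam - k • fw2))

/-! # The crystals of type `C₂` in terms of adapted strings -/

/-- A quadruple `(a, b, c, d)`. For the reduced word `s₂ s₁ s₂ s₁` it stands for the crystal element
`f₂^a f₁^b f₂^c f₁^d v`, with `v` the highest weight element. -/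
@[ext]
structure AString : Type where
  a : ℤ
  b : ℤ
  c : ℤ
  d : ℤ

instance : Nonempty AString := ⟨⟨0, 0, 0, 0⟩⟩

/-- The irreducible normal crystal `ℬ(lam)`, realized through Littelmann's adapted strings for the
reduced word `s₂ s₁ s₂ s₁`. -/
def crystal (lam : Weight) : Set AString :=
  {T | 0 ≤ T.a ∧ 0 ≤ T.d ∧ T.d ≤ T.c ∧ T.c ≤ T.b ∧ T.d ≤ lam.1 ∧ T.c ≤ lam.2 + T.d ∧
    T.b ≤ lam.1 - 2 * T.d + 2 * T.c ∧ T.a ≤ lam.2 + T.d - 2 * T.c + T.b}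

/-- The weight of the element of `ℬ(lam)` with string `T`, namely
`lam - a α₂ - b α₁ - c α₂ - d α₁`. -/
def wt (lam : Weight) (T : AString) : Weight :=
  lam - T.a • PosRoot.a2.root - T.b • PosRoot.a1.root -
    T.c • PosRoot.a2.root - T.d • PosRoot.a1.root

/-- Littelmann's bijection from the strings for `s₁ s₂ s₁ s₂` to the strings for `s₂ s₁ s₂ s₁`. -/
def theta12 (T : AString) : AString where
  a := max T.d (max (T.c - T.b) (T.b - T.a))
  b := max T.c (max (T.a - 2 * T.b + 2 * T.c) (T.a + 2 * T.d))
  c := min T.b (min (2 * T.b - T.c + T.d) (T.a + T.d))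
  d := min T.a (min (2 * T.b - T.c) (T.c - 2 * T.d))

/-- Littelmann's bijection from the strings for `s₂ s₁ s₂ s₁` to the strings for `s₁ s₂ s₁ s₂`. -/
def theta21 (T : AString) : AString where
  a := max T.d (max (2 * T.c - T.b) (T.b - 2 * T.a))
  b := max T.c (max (T.a + T.d) (T.a + 2 * T.c - T.b))
  c := min T.b (min (2 * T.b - 2 * T.c + T.d) (T.d + 2 * T.a))
  d := min T.a (min (T.c - T.d) (T.b - T.c))

/-- `ε₁(T)`: the first entry of the string of `T` for `s₁ s₂ s₁ s₂`. -/
def eps1 (T : AString) : ℤ := (theta21 T).a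

/-- `φ₁(T) = ε₁(T) + ⟨wt(T), α₁^∨⟩`. -/
def phi1 (lam : Weight) (T : AString) : ℤ := eps1 T + PosRoot.a1.pairing (wt lam T)

/-- The action of `s₁` on `ℬ(lam)`, reversing the `f₁`-strings: in terms of the strings for
`s₁ s₂ s₁ s₂` it replaces the first entry `ε₁(T)` by `φ₁(T)`. -/
def crystalS1 (lam : Weight) (T : AString) : AString :=
  theta12 { theta21 T with a := phi1 lam T }

/-! # Preatoms and atoms -/

/-- The embedding of crystals `Φ : ℬ(lam) → ℬ(lam + 2ϖ₁)`. -/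
def Phi (T : AString) : AString := ⟨T.a, T.b + 1, T.c + 1, T.d + 1⟩

/-- The principal preatom `𝒫(lam) ⊆ ℬ(lam)`. -/
def preatom (lam : Weight) : Set AString :=
  if 2 ≤ lam.1 then crystal lam \ (Phi '' crystal (lam - 2 • fw1)) else crystal lam

/-- The map `Ψ : 𝒫(lam) → 𝒫(lam + ϖ₂)`. -/
noncomputable def Psi (lam : Weight) (T : AString) : AString :=
  if T.d = 0 ∨ T.d = lam.1 then ⟨T.a, T.b + 1, T.c + 1, T.d⟩
  else ⟨T.a, T.b, T.c + 1, T.d + 1⟩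

/-- The map `Ψ̄ : 𝒫(lam) → 𝒫(lam + ϖ₂)`, which is `Ψ` made symmetric under `s₁`. -/
noncomputable def PsiBar (lam : Weight) (T : AString) : AString :=
  if (wt lam T).1 ≤ 0 then Psi lam T
  else crystalS1 (lam + fw2) (Psi lam (crystalS1 lam T))

/-- The iterate `Ψ̄^n : 𝒫(lam) → 𝒫(lam + n ϖ₂)`. -/
noncomputable def PsiBarPow (lam : Weight) : ℕ → AString → AString
  | 0, T => T
  | n + 1, T => PsiBar (lam + n • fw2) (PsiBarPow lam n T)

/-- The number of times `Ψ̄` is applied between consecutive atoms of a preatom of highest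
weight `lam`. -/
def atomStep (lam : Weight) : ℕ := if lam.1 = 0 then 2 else 1

/-- The atom `𝒜(lam) ⊆ 𝒫(lam)`: the complement of the image of `Ψ̄` if `lam₁ ≠ 0`, and of the image
of `Ψ̄²` if `lam₁ = 0`. (It is the whole of `𝒫(lam)` if there is no smaller preatom to embed.) -/
def atom (lam : Weight) : Set AString :=
  if (atomStep lam : ℤ) ≤ lam.2 then
    preatom lam \ (PsiBarPow (lam - atomStep lam • fw2) (atomStep lam) ''
      preatom (lam - atomStep lam • fw2))
  else preatom lam

/-- `atomIn lam p a` is the copy of the atom `𝒜(lam - 2pϖ₁ - aϖ₂)` in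
`𝒫(lam - 2pϖ₁) ⊆ ℬ(lam)`, in the atomic decomposition of `ℬ(lam)`. It is empty unless there is such an
atom, that is `2p ≤ lam₁`, `a ≤ lam₂`, and `a` is even when `lam₁ = 2p`. -/
def atomIn (lam : Weight) (p a : ℕ) : Set AString :=
  {T | 2 * (p : ℤ) ≤ lam.1 ∧ (a : ℤ) ≤ lam.2 ∧ atomStep (lam - (2 * p) • fw1) ∣ a ∧
    ∃ U ∈ atom (lam - (2 * p) • fw1 - a • fw2),
      T = Phi^[p] (PsiBarPow (lam - (2 * p) • fw1 - a • fw2) a U)}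

/-- The preatomic number `pat(T)` of `T ∈ ℬ(lam)`. -/
noncomputable def patNum (lam : Weight) (T : AString) : ℕ :=
  sInf {p : ℕ | ∃ a : ℕ, T ∈ atomIn lam p a}

/-- The atomic number `at(T)` of `T ∈ ℬ(lam)`: the integer `a` such that
`T ∈ 𝒜(lam - 2pϖ₁ - aϖ₂) ⊆ 𝒫(lam - 2pϖ₁)` with `p = pat(T)`. -/
noncomputable def atNum (lam : Weight) (T : AString) : ℕ :=
  sInf {a : ℕ | T ∈ atomIn lam (patNum lam T) a}

/-- The highest weight `lam - 2 pat(T) ϖ₁` of the preatom of `T ∈ ℬ(lam)`. -/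
noncomputable def preatomWt (lam : Weight) (T : AString) : Weight :=
  lam - (2 * patNum lam T) • fw1

/-- The highest weight `lam - 2 pat(T) ϖ₁ - at(T) ϖ₂` of the atom of `T ∈ ℬ(lam)`. -/
noncomputable def atomWt (lam : Weight) (T : AString) : Weight :=
  preatomWt lam T - atNum lam T • fw2

/-! # The statistics, the swapping maps and recharges -/

/-- The statistic `σ_m` on `ℬ(lam)`. -/
noncomputable def sigmaStat (m : ℕ) (lam : Weight) (T : AString) : ℤ :=
  (ellTw m (wt lam T) (atomWt lam T) : ℤ) - (nonSwapCount m (wt lam T) (atomWt lam T) : ℤ) +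
    (staircaseTrunc m (wt lam T) (preatomWt lam T) (atNum lam T) : ℤ) +
    (atNum lam T : ℤ) + 2 * (patNum lam T : ℤ)

/-- The statistic `r_m = -σ_m + ⟨lam, ρ^∨⟩` on `ℬ(lam)`; its values are half-integers. -/
noncomputable def rStat (m : ℕ) (lam : Weight) (T : AString) : ℚ :=
  -(sigmaStat m lam T : ℚ) + rhoPairing lam

/-- The elevation of the edge `t_{m+1} ν → ν` in the Bruhat graph of the atom of `T`,
where `ν = wt(T)`. -/
noncomputable def edgeElevation (m : ℕ) (lam : Weight) (T : AString) : ℕ :=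
  elevation (atomWt lam T) (tRefl (m + 1) (wt lam T)) (wt lam T)

/-- `IsPsiValue m lam T T'`: the element `T'` has weight `t_{m+1}(wt(T))` and lies in the atom whose
highest weight is that of the atom of `T` lowered by `Ω(e) ϖ₂`, within the same preatom. -/
def IsPsiValue (m : ℕ) (lam : Weight) (T T' : AString) : Prop :=
  T' ∈ atomIn lam (patNum lam T) (atNum lam T + edgeElevation m lam T) ∧
    wt lam T' = tRefl (m + 1) (wt lam T)

/-- The maps `ψ_{tμ} : ℬ(lam)_{tμ} → ℬ(lam)_μ`, for `t = t_{m+1}` and `μ < tμ ≤ lam`, put together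
into one map. -/
noncomputable def psiMap (m : ℕ) (lam : Weight) (T : AString) : AString :=
  Classical.epsilon (IsPsiValue m lam T)

/-- The elements of `ℬ(lam)` whose weight `ν` satisfies `t ν < ν`. -/
def upperPart (lam : Weight) (t : Equiv.Perm Weight) : Set AString :=
  {T | T ∈ crystal lam ∧ BruhatLT (t (wt lam T)) (wt lam T)}

/-- `ψ` is a swapping function for the statistic `r` across the wall of the reflection `t`: it consists
of injective maps `ℬ(lam)_ν → ℬ(lam)_{tν}`, for all `ν` with `tν < ν ≤ lam`, which lower `r`
by one. -/
def IsSwappingFunction (lam : Weight) (t : Equiv.Perm Weight) (r : AString → ℚ)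
    (ψ : AString → AString) : Prop :=
  (∀ T ∈ upperPart lam t,
    ψ T ∈ crystal lam ∧ wt lam (ψ T) = t (wt lam T) ∧ r (ψ T) = r T - 1) ∧
  (∀ T ∈ upperPart lam t, ∀ U ∈ upperPart lam t,
    wt lam T = wt lam U → ψ T = ψ U → T = U)

/-- The statistic `r'` is obtained from `r` by swapping the values on `T` and `ψ(T)`, for all `T` in
the domain of `ψ`. -/
def IsSwapOf (lam : Weight) (t : Equiv.Perm Weight) (ψ : AString → AString)
    (r r' : AString → ℚ) : Prop :=
  (∀ T ∈ upperPart lam t, r' T = r (ψ T)) ∧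
  (∀ T ∈ upperPart lam t, r' (ψ T) = r T) ∧
  (∀ U ∈ crystal lam, U ∉ upperPart lam t → U ∉ ψ '' upperPart lam t → r' U = r U)

/-! # Renormalized Kazhdan–Lusztig polynomials -/

/-- The ring of integral polynomials in rational powers of `q`; it contains `ℤ[q^{1/2}, q^{-1/2}]`. -/
abbrev QRing : Type := AddMonoidAlgebra ℤ ℚ

/-- The monomial `q^x`. -/
noncomputable def qpow (x : ℚ) : QRing := AddMonoidAlgebra.single x 1

/-- The `q`-analogue of Kostant's partition function of type `C₂`. -/
noncomputable def qKostant (γ : Weight) : QRing :=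
  ∑ᶠ n : ℕ × ℕ × ℕ × ℕ,
    if n.1 • PosRoot.a1.root + n.2.1 • PosRoot.a2.root + n.2.2.1 • PosRoot.a12.root +
        n.2.2.2 • PosRoot.a21.root = γ
    then qpow ((n.1 + n.2.1 + n.2.2.1 + n.2.2.2 : ℕ) : ℚ) else 0

/-- The elements of the finite Weyl group with their signs. -/
def weylSigned : List (Equiv.Perm Weight × ℤ) :=
  [(1, 1), (simple1, -1), (simple2, -1), (simple1 * simple2, 1), (simple2 * simple1, 1),
    (simple1 * simple2 * simple1, -1), (simple2 * simple1 * simple2, -1),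
    (simple1 * simple2 * simple1 * simple2, 1)]

/-- The Kostka–Foulkes polynomial `K_{μ,lam}(q) = ∑_w sgn(w) P_q(w(lam + ρ) - (μ + ρ))`, where
`ρ = ϖ₁ + ϖ₂`. -/
noncomputable def kostkaFoulkes (μ lam : Weight) : QRing :=
  (weylSigned.map fun w =>
    w.2 • qKostant (w.1 (lam + fw1 + fw2) - (μ + fw1 + fw2))).sum

/-- The dominant weight in the orbit of `μ` under the finite Weyl group. -/
def domRep (μ : Weight) : Weight :=
  (max |μ.1 + μ.2| |μ.2| - min |μ.1 + μ.2| |μ.2|, min |μ.1 + μ.2| |μ.2|)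

/-- The renormalized Kazhdan–Lusztig polynomials in the KL chamber. Up to the shift by the length
`ℓ(μ) = ℓ_0(μ, lam)` they are the graded ranks of the stalks of the intersection cohomology sheaf, which
are given by the Kostka–Foulkes polynomials and only depend on the orbit of `μ` under the finite Weyl
group. In particular `K_{μ,lam}(q) = h̃_{μ,lam}(q^{1/2}) q^{ℓ(μ)/2}` for dominant `μ`. -/
noncomputable def klChamberPoly (lam μ : Weight) : QRing :=
  if BruhatLE μ lam then
    qpow (rhoPairing (domRep μ) - (ellTw 0 μ lam : ℚ)) * kostkaFoulkes (domRep μ) lam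
  else 0

/-- The action of the generator of the affine Hecke algebra attached to a simple reflection `s` on the
functions on the weight lattice, i.e. on its spherical module. The weights index the Iwahori orbits on
the affine Grassmannian, and a function is given by its sums over the orbits; `q` is the inverse of the
number of elements of the residue field. -/
noncomputable def heckeOp (s : Equiv.Perm Weight) (g : Weight → QRing) (x : Weight) : QRing :=
  if BruhatLT x (s x) then qpow 1 * g (s x)
  else if BruhatLT (s x) x then g (s x) + (1 - qpow 1) * g x
  else g x

/-- The action of `T_{y_m⁻¹} = T_{s'_m} ⋯ T_{s'_1}` on the Kazhdan–Lusztig element of `lam`. -/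
noncomputable def twistedKL (lam : Weight) : ℕ → Weight → QRing
  | 0 => klChamberPoly lam
  | m + 1 => heckeOp (letter (m + 1)) (twistedKL lam m)

/-- The renormalized `η_m`-Kazhdan–Lusztig polynomial `h̃^{η_m}_{μ,lam}(q^{1/2})`: the coefficient at `μ`
of the Kazhdan–Lusztig element of `lam`, taken with respect to the Iwahori subgroup twisted by `y_m`,
which is the one of the chamber of `η_m`. -/
noncomputable def etaKL (m : ℕ) (μ lam : Weight) : QRing :=
  twistedKL lam m ((yElt m)⁻¹ μ)

/-- The function `r` on `ℬ(lam)` is a recharge for `η_m`. -/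
def IsRecharge (m : ℕ) (lam : Weight) (r : AString → ℚ) : Prop :=
  ∀ μ : Weight, BruhatLE μ lam →
    etaKL m μ lam = ∑ᶠ T ∈ {T : AString | T ∈ crystal lam ∧ wt lam T = μ}, qpow (r T)

/-! The weights below a dominant weight are the points of its coset of the root lattice in an
octagon (`bruhatLE_iff_inHull`). In the orthogonal coordinates `(e, o) = (x₁ + x₂, x₂)` the
reflections in the long directions `a12`, `a2` act on one coordinate each, and every ingredient of
`σ_m` becomes a piecewise linear function of the weight, the highest weight and the number of levels
of `N(y_m)` in each direction.

The outcome is `atomStat_eq`: up to `2p`, `σ_m` is `twistedLength` minus `defect`. The first term is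
the length computed as if the octagon were the whole plane, and it changes by exactly one across the
wall of `t_{m+1}` (`twistedLength_tRefl`). The second collects the levels cut off by the octagon,
the non-swappable edges, the staircase term and `-a`. The heart of the matter is that the defect at
the upper end of an edge, in the atom of index `a`, equals the defect at the lower end in the atom
of index `a + Ω`, whether the levels are counted for `m` or for `m + 1` (`defect_a12`, `defect_a2`,
`defect_a21`, resting on `excess_add_excess` and `excess_shortened`). Hence passing from `m + 1` to
`m` exchanges the two values of the statistic, which differ by one (`reflElevation_spec`).

On the crystal side an atom has exactly one element of each weight of its octagon
(`existsUnique_mem_atom`), so the index `a + Ω` and the weight determine `ψ`. It is injective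
because `a + Ω` is strictly increasing in `a` (`add_reflElevation_strictMono`). At a lower end
outside the image of `ψ` the defect grows by one together with the length, so the statistic is
unchanged; this is the converse `exists_elevation_or`.

Finally, the Hecke operators give a wall-crossing relation for the Kazhdan–Lusztig polynomials
(`etaKL_succ`), and any swapping function gives the same relation for the generating functions of
the two statistics. As `q` is invertible, the relation can be solved for the polynomials of `η_m`.
-/

/-! ### Affine reflections and the Bruhat order. -/

theorem affRefl_apply (β : PosRoot) (M : ℤ) (x : Weight) :
    affRefl β M x = x - (β.pairing x - M) • β.root := rfl

theorem affRefl_affRefl (β : PosRoot) (M : ℤ) (x : Weight) :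
    affRefl β M (affRefl β M x) = x := affReflFun_involutive β M x

theorem pairing_sub_smul_root (β : PosRoot) (k : ℤ) (x : Weight) :
    β.pairing (x - k • β.root) = β.pairing x - 2 * k := by
  cases β <;> simp [PosRoot.pairing, PosRoot.root] <;> ring

theorem pairing_affRefl (β : PosRoot) (M : ℤ) (x : Weight) :
    β.pairing (affRefl β M x) = 2 * M - β.pairing x := by
  rw [affRefl_apply, pairing_sub_smul_root]; ring

theorem smul_root_eq_zero {β : PosRoot} {k : ℤ} (h : k • β.root = 0) : k = 0 := by
  cases β <;> simpa [PosRoot.root, Prod.ext_iff] using h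

theorem smul_root_injective {α β : PosRoot} {k l : ℤ} (hk : k ≠ 0)
    (h : k • α.root = l • β.root) : α = β ∧ k = l := by
  cases α <;> cases β <;> simp [PosRoot.root, Prod.ext_iff] at h ⊢ <;> omega

/-- The number of reflections of the real line with integral centre that move `k` closer to the
antidominant chamber. -/
def foldLength (k : ℤ) : ℤ := max k (-k - 1)

/-- The number of affine reflections lowering a weight. -/
def weightLength (x : Weight) : ℤ :=
  foldLength (PosRoot.a1.pairing x) + foldLength (PosRoot.a2.pairing x) +
    foldLength (PosRoot.a12.pairing x) + foldLength (PosRoot.a21.pairing x)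

/-- A length that grows along every step makes the generated order antisymmetric; it excludes that
one reflection both raises and lowers a weight. -/
theorem BruhatStep.weightLength_lt {μ ν : Weight} (h : BruhatStep μ ν) :
    weightLength μ < weightLength ν := by
  obtain ⟨β, M, rfl, h1, h2⟩ := h
  obtain ⟨x, y⟩ := ν
  cases β <;>
    simp [weightLength, foldLength, affRefl_apply, PosRoot.pairing, PosRoot.root] at h1 h2 ⊢ <;>
    omega

theorem BruhatLE.weightLength_lt_or_eq {μ ν : Weight} (h : BruhatLE μ ν) :
    weightLength μ < weightLength ν ∨ μ = ν := by
  induction h with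
  | refl => exact Or.inr rfl
  | tail _ h ih =>
    have := BruhatStep.weightLength_lt h
    rcases ih with ih | rfl
    · exact Or.inl (ih.trans this)
    · exact Or.inl this

theorem BruhatLT.weightLength_lt {μ ν : Weight} (h : BruhatLT μ ν) :
    weightLength μ < weightLength ν :=
  (BruhatLE.weightLength_lt_or_eq h.1).resolve_right h.2

theorem BruhatStep.bruhatLT {μ ν : Weight} (h : BruhatStep μ ν) : BruhatLT μ ν :=
  ⟨Relation.ReflTransGen.single h, fun e => by
    have := BruhatStep.weightLength_lt h; rw [e] at this; exact lt_irrefl _ this⟩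

/-- The reflection `affRefl β M` lowers the weights whose pairing with `β` is on the positive
side of the wall. -/
theorem bruhatLT_affRefl_iff (β : PosRoot) (M : ℤ) (x : Weight) :
    BruhatLT (affRefl β M x) x ↔ (0 ≤ M ∧ M < β.pairing x) ∨ (M < 0 ∧ β.pairing x < M) := by
  constructor
  · intro h
    by_contra hc
    rcases eq_or_ne (β.pairing x) M with he | he
    · exact h.2 (by rw [affRefl_apply, he]; simp)
    -- Off the wall, if `x` is not on the side where the reflection lowers, then its mirror image
    -- is, so the same reflection raises `x`, against the length.
    · have hs : BruhatStep x (affRefl β M x) := by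
        refine ⟨β, M, (affRefl_affRefl β M x).symm, ?_, ?_⟩ <;> rw [pairing_affRefl] <;> omega
      exact lt_asymm (BruhatLT.weightLength_lt h) (BruhatStep.weightLength_lt hs)
  · intro h
    exact BruhatStep.bruhatLT ⟨β, M, rfl, by omega, by omega⟩

theorem bruhatLT_sub_smul_root_iff (β : PosRoot) (k : ℤ) (x : Weight) :
    BruhatLT (x - k • β.root) x ↔ (0 < k ∧ k ≤ β.pairing x) ∨ (k < 0 ∧ β.pairing x < k) := by
  have h := bruhatLT_affRefl_iff β (β.pairing x - k) x
  rw [affRefl_apply, sub_sub_cancel] at h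
  rw [h]; omega

theorem bruhatLT_self_sub_smul_root_iff (β : PosRoot) (k : ℤ) (x : Weight) :
    BruhatLT x (x - k • β.root) ↔
      (0 < k ∧ β.pairing x < k) ∨ (k < 0 ∧ k ≤ β.pairing x) := by
  have h := bruhatLT_sub_smul_root_iff β (-k) (x - k • β.root)
  rw [pairing_sub_smul_root, neg_smul, sub_neg_eq_add, sub_add_cancel] at h
  rw [h]; omega

/-! ### The interval below a dominant weight as a convex hull. -/

/-- The weight `x` lies in the convex hull of the finite Weyl group orbit of `lam` and in its coset
of the root lattice. -/
structure InHull (lam x : Weight) : Prop where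
  parity : (x.1 - lam.1) % 2 = 0
  le₁ : x.1 + x.2 ≤ lam.1 + lam.2
  ge₁ : -(lam.1 + lam.2) ≤ x.1 + x.2
  le₂ : x.2 ≤ lam.1 + lam.2
  ge₂ : -(lam.1 + lam.2) ≤ x.2
  le_sum : x.1 + 2 * x.2 ≤ lam.1 + 2 * lam.2
  ge_sum : -(lam.1 + 2 * lam.2) ≤ x.1 + 2 * x.2
  le_diff : x.1 ≤ lam.1 + 2 * lam.2
  ge_diff : -(lam.1 + 2 * lam.2) ≤ x.1

/-- A lowering reflection sends `ν` into the segment between `ν` and its image under the finite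
reflection in `β`, and the hull is convex and invariant under the finite Weyl group. -/
theorem InHull.of_step {lam μ ν : Weight} (h : BruhatStep μ ν) (hν : InHull lam ν) :
    InHull lam μ := by
  obtain ⟨β, M, rfl, h1, h2⟩ := h
  obtain ⟨x, y⟩ := ν
  obtain ⟨l, n⟩ := lam
  obtain ⟨c0, c1, c2, c3, c4, c5, c6, c7, c8⟩ := hν
  cases β <;> simp [PosRoot.pairing] at h1 h2 c0 c1 c2 c3 c4 c5 c6 c7 c8 <;> constructor <;>
    simp [affRefl_apply, PosRoot.pairing, PosRoot.root] <;> omega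

/-- Outside the dominant chamber a simple reflection goes up. Inside it, adding the short root `α₂₁`
goes up and stays in the hull unless a facet is tight; then the simple root parallel to that facet
is added. -/
theorem InHull.exists_step {lam x : Weight} (hl : Dominant lam) (h : InHull lam x)
    (hne : x ≠ lam) : ∃ y, BruhatStep x y ∧ InHull lam y := by
  have key : ∀ (β : PosRoot) (k : ℤ), ((0 < k ∧ β.pairing x < k) ∨ (k < 0 ∧ k ≤ β.pairing x)) →
      InHull lam (x - k • β.root) → ∃ y, BruhatStep x y ∧ InHull lam y := by
    intro β k hk hy
    refine ⟨_, ⟨β, β.pairing x - k, ?_, ?_, ?_⟩, hy⟩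
    · rw [affRefl_apply, pairing_sub_smul_root, sub_sub, ← add_smul]
      rw [show k + (β.pairing x - 2 * k - (β.pairing x - k)) = 0 by ring]; simp
    all_goals rw [pairing_sub_smul_root]; omega
  obtain ⟨u, v⟩ := x
  obtain ⟨l, n⟩ := lam
  obtain ⟨c0, c1, c2, c3, c4, c5, c6, c7, c8⟩ := h
  obtain ⟨hl1, hl2⟩ := hl
  simp only [ne_eq, Prod.mk.injEq] at hne
  simp only at c0 c1 c2 c3 c4 c5 c6 c7 c8 hl1 hl2
  rcases lt_or_ge u 0 with hu | hu
  · refine key .a1 u (by simp only [PosRoot.pairing]; omega) ?_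
    constructor <;> simp [PosRoot.root] <;> omega
  rcases lt_or_ge v 0 with hv | hv
  · refine key .a2 v (by simp only [PosRoot.pairing]; omega) ?_
    constructor <;> simp [PosRoot.root] <;> omega
  rcases eq_or_ne (u + v) (l + n) with h1 | h1
  · refine key .a2 (-1) (by simp only [PosRoot.pairing]; omega) ?_
    constructor <;> simp [PosRoot.root] <;> omega
  rcases eq_or_ne (u + 2 * v) (l + 2 * n) with h2 | h2
  · refine key .a1 (-1) (by simp only [PosRoot.pairing]; omega) ?_
    constructor <;> simp [PosRoot.root] <;> omega
  · refine key .a21 (-1) (by simp only [PosRoot.pairing]; omega) ?_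
    constructor <;> simp [PosRoot.root] <;> omega

theorem InHull.weightLength_le {lam x : Weight} (h : InHull lam x) :
    weightLength x ≤ 4 * (lam.1 + 2 * lam.2) + 4 * (lam.1 + lam.2) + 4 := by
  obtain ⟨c0, c1, c2, c3, c4, c5, c6, c7, c8⟩ := h
  simp only [weightLength, foldLength, PosRoot.pairing]
  omega

theorem bruhatLE_iff_inHull {lam x : Weight} (hl : Dominant lam) :
    BruhatLE x lam ↔ InHull lam x := by
  constructor
  · intro h
    induction h using Relation.ReflTransGen.head_induction_on with
    | refl => obtain ⟨hl1, hl2⟩ := hl; constructor <;> omega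
    | head h _ ih => exact ih.of_step h
  -- Climbing terminates: each step raises `weightLength`, which is bounded on the hull. The
  -- induction is on the remaining gap.
  · suffices ∀ (N : ℕ) (x : Weight), InHull lam x →
        4 * (lam.1 + 2 * lam.2) + 4 * (lam.1 + lam.2) + 4 - weightLength x ≤ N →
        BruhatLE x lam from
      fun h => this (4 * (lam.1 + 2 * lam.2) + 4 * (lam.1 + lam.2) + 4 - weightLength x).toNat x h
        (Int.self_le_toNat _)
    intro N
    induction N with
    | zero =>
      intro x hx hN
      by_cases hne : x = lam
      · rw [hne]; exact Relation.ReflTransGen.refl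
      · obtain ⟨y, hxy, hy⟩ := hx.exists_step hl hne
        have := hxy.weightLength_lt
        have := hy.weightLength_le
        push_cast at hN; omega
    | succ N ih =>
      intro x hx hN
      by_cases hne : x = lam
      · rw [hne]; exact Relation.ReflTransGen.refl
      · obtain ⟨y, hxy, hy⟩ := hx.exists_step hl hne
        have := hxy.weightLength_lt
        exact Relation.ReflTransGen.head hxy (ih y hy (by push_cast at hN; omega))

/-! ### The reflections `t_k` -/

theorem letter_add_four (k : ℕ) : letter (k + 4) = letter k := by
  simp [letter]

/-- One period of the word is the translation by `-α₂₁`, so all questions about `y_m` reduce to the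
four residues of `m`. -/
theorem yElt_four_apply (x : Weight) : yElt 4 x = x - PosRoot.a21.root := by
  obtain ⟨u, v⟩ := x
  simp [yElt, letter, simple0, simple1, simple2, affRefl_apply, PosRoot.pairing, PosRoot.root]
  constructor <;> ring

theorem yElt_add_four (k : ℕ) (x : Weight) : yElt (k + 4) x = yElt k x - PosRoot.a21.root := by
  induction k generalizing x with
  | zero => rw [yElt_four_apply]; rfl
  | succ k ih =>
    show yElt (k + 4) (letter (k + 4 + 1) x) = yElt k (letter (k + 1) x) - _
    rw [ih, show k + 4 + 1 = (k + 1) + 4 from rfl, letter_add_four]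

theorem yElt_four_mul_add (q i : ℕ) (x : Weight) :
    yElt (4 * q + i) x = yElt i x - (q : ℤ) • PosRoot.a21.root := by
  induction q with
  | zero => simp
  | succ q ih =>
    rw [show 4 * (q + 1) + i = (4 * q + i) + 4 by ring, yElt_add_four, ih]
    push_cast; rw [add_smul, one_smul, sub_sub]

theorem tRefl_succ (m : ℕ) (x : Weight) :
    tRefl (m + 1) (yElt m x) = yElt m (letter (m + 1) x) := by
  simp [tRefl, yElt]

/-- The finite part of the affine coroot of `t_k`. -/
def tRoot (k : ℕ) : PosRoot :=
  if k % 2 = 1 then .a21 else if k % 4 = 2 then .a12 else .a2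

/-- The multiple of `δ` in the affine coroot of `t_k`. -/
def tLevel (k : ℕ) : ℕ :=
  if k % 2 = 1 then (k + 1) / 2 else if k % 4 = 2 then (k + 2) / 4 else k / 4

theorem tRefl_eq {k : ℕ} (hk : 1 ≤ k) : tRefl k = affRefl (tRoot k) (-(tLevel k : ℤ)) := by
  obtain ⟨m, rfl⟩ : ∃ m, k = m + 1 := ⟨k - 1, by omega⟩
  ext1 x
  -- Since `t_{m+1} y_m = y_m s` with `s` the next letter, testing on points `y_m z` replaces
  -- `t_{m+1}` by a simple reflection.
  obtain ⟨z, rfl⟩ := (yElt m).surjective x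
  rw [tRefl_succ]
  obtain ⟨q, i, hi, rfl⟩ : ∃ q i, i < 4 ∧ m = 4 * q + i := ⟨m / 4, m % 4, by omega, by omega⟩
  obtain ⟨u, v⟩ := z
  rw [yElt_four_mul_add, yElt_four_mul_add]
  interval_cases i
  · have h1 : tRoot (4 * q + 0 + 1) = .a21 := by unfold tRoot; rw [if_pos (by omega)]
    have h2 : tLevel (4 * q + 0 + 1) = 2 * q + 1 := by unfold tLevel; rw [if_pos (by omega)]; omega
    have h3 : letter (4 * q + 0 + 1) = simple0 := by unfold letter; rw [if_pos (by omega)]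
    rw [h1, h2, h3]
    simp [yElt, simple0, affRefl_apply, PosRoot.pairing, PosRoot.root]
    ring
  · have h1 : tRoot (4 * q + 1 + 1) = .a12 := by
      unfold tRoot; rw [if_neg (by omega), if_pos (by omega)]
    have h2 : tLevel (4 * q + 1 + 1) = q + 1 := by
      unfold tLevel; rw [if_neg (by omega), if_pos (by omega)]; omega
    have h3 : letter (4 * q + 1 + 1) = simple2 := by
      unfold letter; rw [if_neg (by omega), if_neg (by omega)]
    rw [h1, h2, h3]
    simp [yElt, letter, simple0, simple2, affRefl_apply, PosRoot.pairing, PosRoot.root]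
    constructor <;> ring
  · have h1 : tRoot (4 * q + 2 + 1) = .a21 := by unfold tRoot; rw [if_pos (by omega)]
    have h2 : tLevel (4 * q + 2 + 1) = 2 * q + 2 := by unfold tLevel; rw [if_pos (by omega)]; omega
    have h3 : letter (4 * q + 2 + 1) = simple1 := by
      unfold letter; rw [if_neg (by omega), if_pos (by omega)]
    rw [h1, h2, h3]
    simp [yElt, letter, simple0, simple1, simple2, affRefl_apply, PosRoot.pairing, PosRoot.root]
    constructor <;> ring
  · have h1 : tRoot (4 * q + 3 + 1) = .a2 := by
      unfold tRoot; rw [if_neg (by omega), if_neg (by omega)]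
    have h2 : tLevel (4 * q + 3 + 1) = q + 1 := by
      unfold tLevel; rw [if_neg (by omega), if_neg (by omega)]; omega
    have h3 : letter (4 * q + 3 + 1) = simple2 := by
      unfold letter; rw [if_neg (by omega), if_neg (by omega)]
    rw [h1, h2, h3]
    simp [yElt, letter, simple0, simple1, simple2, affRefl_apply, PosRoot.pairing, PosRoot.root]
    constructor <;> ring

theorem one_le_tLevel {k : ℕ} (hk : 1 ≤ k) : 1 ≤ tLevel k := by
  unfold tLevel; split_ifs <;> omega

/-- The number of `k ≤ m` for which the affine coroot of `t_k` has finite part `β`. -/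
def levelCap (m : ℕ) : PosRoot → ℕ
  | .a1 => 0
  | .a21 => (m + 1) / 2
  | .a12 => (m + 2) / 4
  | .a2 => m / 4

theorem tLevel_le_levelCap_iff (k m : ℕ) :
    tLevel k ≤ levelCap m (tRoot k) ↔ k ≤ m := by
  unfold tLevel tRoot; split_ifs <;> simp only [levelCap] <;> omega

/-- The index `k` of the reflection `t_k` of level `j` in direction `β`. -/
def tIndex (j : ℕ) : PosRoot → ℕ
  | .a1 => 0
  | .a21 => 2 * j - 1
  | .a12 => 4 * j - 2
  | .a2 => 4 * j

theorem one_le_tIndex {j : ℕ} (hj : 1 ≤ j) {β : PosRoot} (hβ : β ≠ .a1) : 1 ≤ tIndex j β := by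
  cases β <;> simp [tIndex] at hβ ⊢ <;> omega

theorem tRoot_tIndex {j : ℕ} (hj : 1 ≤ j) {β : PosRoot} (hβ : β ≠ .a1) :
    tRoot (tIndex j β) = β := by
  cases β
  · exact absurd rfl hβ
  · show tRoot (4 * j) = _
    unfold tRoot; rw [if_neg (by omega), if_neg (by omega)]
  · show tRoot (4 * j - 2) = _
    unfold tRoot; rw [if_neg (by omega), if_pos (by omega)]
  · show tRoot (2 * j - 1) = _
    unfold tRoot; rw [if_pos (by omega)]

theorem tLevel_tIndex {j : ℕ} (hj : 1 ≤ j) {β : PosRoot} (hβ : β ≠ .a1) :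
    tLevel (tIndex j β) = j := by
  cases β
  · exact absurd rfl hβ
  · show tLevel (4 * j) = _
    unfold tLevel; rw [if_neg (by omega), if_neg (by omega)]; omega
  · show tLevel (4 * j - 2) = _
    unfold tLevel; rw [if_neg (by omega), if_pos (by omega)]; omega
  · show tLevel (2 * j - 1) = _
    unfold tLevel; rw [if_pos (by omega)]; omega

theorem tIndex_tLevel {k : ℕ} (hk : 1 ≤ k) : tIndex (tLevel k) (tRoot k) = k := by
  unfold tLevel tRoot; split_ifs <;> simp only [tIndex] <;> omega

theorem tRoot_ne_a1 (k : ℕ) : tRoot k ≠ .a1 := by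
  unfold tRoot; split_ifs <;> simp

theorem tRefl_apply {k : ℕ} (hk : 1 ≤ k) (x : Weight) :
    tRefl k x = x - ((tRoot k).pairing x + tLevel k) • (tRoot k).root := by
  rw [tRefl_eq hk, affRefl_apply, sub_neg_eq_add]

theorem tRefl_tRefl {k : ℕ} (hk : 1 ≤ k) (x : Weight) : tRefl k (tRefl k x) = x := by
  rw [tRefl_eq hk, affRefl_affRefl]

theorem tRefl_eq_sub_iff {k : ℕ} (hk : 1 ≤ k) {β : PosRoot} {l : ℤ} (hl : l ≠ 0) (x : Weight) :
    x - l • β.root = tRefl k x ↔ tRoot k = β ∧ (tLevel k : ℤ) = l - β.pairing x := by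
  rw [tRefl_apply hk, sub_right_inj]
  constructor
  · intro h
    obtain ⟨rfl, h2⟩ := smul_root_injective hl h
    exact ⟨rfl, by omega⟩
  · rintro ⟨rfl, h2⟩
    rw [h2]; congr 1; omega

/-- The reflection exchanging `x` and `x - kβ` has level `k - ⟨x, β^∨⟩`, and in direction `β` the
set `N(y_m)` consists of the levels from `1` to `levelCap m β`. -/
theorem labelIn_sub_smul_root_iff {m : ℕ} {x : Weight} {β : PosRoot} {k : ℤ} (hk : k ≠ 0) :
    LabelIn m x (x - k • β.root) ↔
      1 ≤ k - β.pairing x ∧ k - β.pairing x ≤ levelCap m β := by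
  constructor
  · rintro ⟨i, hi, him, h⟩
    obtain ⟨rfl, h2⟩ := (tRefl_eq_sub_iff hi hk x).1 h
    have h3 := one_le_tLevel hi
    have h4 := (tLevel_le_levelCap_iff i m).2 him
    omega
  · rintro ⟨h1, h2⟩
    have hβ : β ≠ .a1 := by rintro rfl; simp [levelCap] at h2; omega
    obtain ⟨j, hj⟩ := Int.eq_ofNat_of_zero_le (show 0 ≤ k - β.pairing x by omega)
    have hj1 : 1 ≤ j := by omega
    refine ⟨tIndex j β, one_le_tIndex hj1 hβ, ?_, ?_⟩
    · rw [← tLevel_le_levelCap_iff, tLevel_tIndex hj1 hβ, tRoot_tIndex hj1 hβ]; omega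
    · rw [tRefl_eq_sub_iff (one_le_tIndex hj1 hβ) hk, tLevel_tIndex hj1 hβ,
        tRoot_tIndex hj1 hβ]
      exact ⟨rfl, hj.symm⟩

theorem LabelIn.symm {m : ℕ} {x y : Weight} (h : LabelIn m x y) : LabelIn m y x := by
  obtain ⟨k, h1, h2, rfl⟩ := h
  exact ⟨k, h1, h2, (tRefl_tRefl h1 x).symm⟩

/-! ### Arrows into a weight in the twisted Bruhat graph. -/

theorem isEdge_up_iff {lam x : Weight} (hl : Dominant lam) {β : PosRoot} {k : ℤ} :
    IsEdge lam x (x - k • β.root) ↔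
      ((0 < k ∧ β.pairing x < k) ∨ (k < 0 ∧ k ≤ β.pairing x)) ∧
        InHull lam (x - k • β.root) := by
  rw [← bruhatLE_iff_inHull hl, ← bruhatLT_self_sub_smul_root_iff]
  exact ⟨fun h => ⟨h.2.1, h.2.2.1⟩, fun h => ⟨hl, h.1, h.2, β, -k, by
    rw [sub_sub_cancel_left, neg_smul]⟩⟩

theorem isEdge_down_iff {lam x : Weight} (hl : Dominant lam) {β : PosRoot} {k : ℤ} :
    IsEdge lam (x - k • β.root) x ↔
      ((0 < k ∧ k ≤ β.pairing x) ∨ (k < 0 ∧ β.pairing x < k)) ∧ InHull lam x := by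
  rw [← bruhatLE_iff_inHull hl, ← bruhatLT_sub_smul_root_iff]
  exact ⟨fun h => ⟨h.2.1, h.2.2.1⟩, fun h => ⟨hl, h.1, h.2, β, k, by rw [sub_sub_cancel]⟩⟩

/-- The largest level `j` for which the reflection of level `j` in direction `β` keeps `x` in the
hull of `lam`. -/
def hullCap (lam x : Weight) : PosRoot → ℤ
  | .a1 => 0
  | .a21 => min ((lam.1 + 2 * lam.2 - (x.1 + 2 * x.2)) / 2)
      (min (lam.1 + lam.2 - (x.1 + x.2)) (lam.1 + lam.2 - x.2))
  | .a12 => min (lam.1 + lam.2 - (x.1 + x.2))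
      (min (lam.1 + 2 * lam.2 - (x.1 + 2 * x.2)) (lam.1 + 2 * lam.2 - x.1)) / 2
  | .a2 => min (lam.1 + lam.2 - x.2)
      (min (lam.1 + 2 * lam.2 - (x.1 + 2 * x.2)) (lam.1 + 2 * lam.2 + x.1)) / 2

/-- Moving in the direction `-β` can only cross the facets facing that way; `hullCap` is the minimum
of the bounds they impose on the level. -/
theorem InHull.inHull_sub_iff {lam x : Weight} (h : InHull lam x) {β : PosRoot} (hβ : β ≠ .a1)
    {k : ℤ} (hk : 0 < k) (hk' : β.pairing x < k) :
    InHull lam (x - k • β.root) ↔ k - β.pairing x ≤ hullCap lam x β := by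
  obtain ⟨u, v⟩ := x
  obtain ⟨l, n⟩ := lam
  obtain ⟨c0, c1, c2, c3, c4, c5, c6, c7, c8⟩ := h
  simp only at c0 c1 c2 c3 c4 c5 c6 c7 c8
  constructor
  · rintro ⟨d0, d1, d2, d3, d4, d5, d6, d7, d8⟩
    cases β <;> simp [PosRoot.pairing, PosRoot.root, hullCap] at * <;> omega
  · intro h
    cases β <;> simp [PosRoot.pairing, hullCap] at hk' h hβ <;> constructor <;>
      simp [PosRoot.root] <;> omega

/-- Level `0` is a finite reflection, which preserves the hull, and the reflection of level `-⟨x,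
β^∨⟩` fixes `x`. -/
theorem InHull.hullCap_ge {lam x : Weight} (h : InHull lam x) {β : PosRoot} (hβ : β ≠ .a1) :
    0 ≤ hullCap lam x β ∧ -β.pairing x ≤ hullCap lam x β := by
  obtain ⟨u, v⟩ := x
  obtain ⟨l, n⟩ := lam
  obtain ⟨c0, c1, c2, c3, c4, c5, c6, c7, c8⟩ := h
  simp only at c0 c1 c2 c3 c4 c5 c6 c7 c8
  cases β <;> simp [PosRoot.pairing, hullCap] at hβ ⊢ <;> omega

/-- The signed distances, in direction `β`, of the sources of the arrows into `x` in the
`y_m`-twisted Bruhat graph of `lam`. -/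
noncomputable def arrowSteps (m : ℕ) (x lam : Weight) (β : PosRoot) : Finset ℤ :=
  Finset.Icc 1 (β.pairing x + min (levelCap m β : ℤ) (hullCap lam x β)) ∪
    Finset.Icc (β.pairing x + levelCap m β + 1) (-1)

/-- For `k > 0` the arrows come from lower weights (`k ≤ ⟨x, β^∨⟩`, never labelled), followed by the
reversed edges to higher weights, which need their level within `levelCap` and `hullCap`. For `k <
0` only edges from lower weights with level above `levelCap` remain. -/
theorem mem_arrowSteps_iff {m : ℕ} {x lam : Weight} (hl : Dominant lam) (h : InHull lam x)
    {β : PosRoot} {k : ℤ} :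
    k ∈ arrowSteps m x lam β ↔ k ≠ 0 ∧ IsTwistedEdge m lam (x - k • β.root) x := by
  rcases eq_or_ne k 0 with rfl | hk
  · simp [arrowSteps]
  have hlab : LabelIn m (x - k • β.root) x ↔ LabelIn m x (x - k • β.root) :=
    ⟨LabelIn.symm, LabelIn.symm⟩
  simp only [arrowSteps, Finset.mem_union, Finset.mem_Icc, IsTwistedEdge, hlab,
    isEdge_up_iff hl, isEdge_down_iff hl, labelIn_sub_smul_root_iff hk, h, and_true]
  by_cases hβ : β = .a1
  · subst hβ
    simp only [levelCap, hullCap]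
    omega
  have hc := h.hullCap_ge hβ
  by_cases hk' : 0 < k ∧ β.pairing x < k
  · rw [h.inHull_sub_iff hβ hk'.1 hk'.2]; omega
  · omega

/-- The number of arrows in one direction. -/
def dirCount (p J U : ℤ) : ℤ := max (p + min J U) (-p - 1 - J)

/-- At most one of the two intervals is nonempty, and because `hullCap` is at least `-⟨x, β^∨⟩` the
maximum in `dirCount` is its cardinality. The direction `a1`, with both caps zero, is the exception
treated apart. -/
theorem card_arrowSteps {m : ℕ} {x lam : Weight} (h : InHull lam x) (β : PosRoot) :
    ((arrowSteps m x lam β).card : ℤ) =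
      dirCount (β.pairing x) (levelCap m β) (hullCap lam x β) := by
  have hc : 0 ≤ hullCap lam x β ∧
      (-β.pairing x ≤ hullCap lam x β ∨ levelCap m β = 0 ∧ hullCap lam x β = 0) := by
    by_cases hβ : β = .a1
    · subst hβ; simp [hullCap, levelCap]
    · have := h.hullCap_ge hβ; exact ⟨this.1, Or.inl this.2⟩
  rw [arrowSteps, Finset.card_union_of_disjoint, Int.card_Icc, Int.card_Icc, dirCount]
  · push_cast; omega
  · rw [Finset.disjoint_left]; intro k; simp only [Finset.mem_Icc]; omega

theorem ellTw_eq {m : ℕ} {x lam : Weight} (hl : Dominant lam) (h : InHull lam x) :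
    (ellTw m x lam : ℤ) = foldLength x.1 +
      dirCount (x.1 + 2 * x.2) (levelCap m .a21) (hullCap lam x .a21) +
      dirCount (x.1 + x.2) (levelCap m .a12) (hullCap lam x .a12) +
      dirCount x.2 (levelCap m .a2) (hullCap lam x .a2) := by
  have hset : {ν : Weight | IsTwistedEdge m lam ν x} =
      ↑(({.a1, .a21, .a12, .a2} : Finset PosRoot).biUnion fun β =>
        (arrowSteps m x lam β).image fun k => x - k • β.root) := by
    ext ν
    simp only [Set.mem_ofPred_eq, Finset.coe_biUnion, Set.mem_iUnion, Finset.mem_coe,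
      Finset.mem_image, exists_prop, mem_arrowSteps_iff hl h]
    constructor
    · intro hν
      have : ∃ (β : PosRoot) (k : ℤ), ν = x - k • β.root := by
        rcases hν with ⟨⟨_, _, _, β, k, hk⟩, _⟩ | ⟨⟨_, _, _, β, k, hk⟩, _⟩
        · exact ⟨β, k, by rw [← hk]; abel⟩
        · exact ⟨β, -k, by rw [neg_smul, ← hk]; abel⟩
      obtain ⟨β, k, rfl⟩ := this
      refine ⟨β, by cases β <;> simp, k, ⟨?_, hν⟩, rfl⟩
      rintro rfl
      rcases hν with ⟨⟨_, h1, _⟩, _⟩ | ⟨⟨_, h1, _⟩, _⟩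
      · exact h1.2 (by simp)
      · exact h1.2 (by simp)
    · rintro ⟨β, _, k, ⟨_, hk⟩, rfl⟩
      exact hk
  rw [ellTw, hset, Set.ncard_coe_finset, Finset.card_biUnion, Nat.cast_sum]
  · have hcard : ∀ β : PosRoot,
        (((arrowSteps m x lam β).image fun k => x - k • β.root).card : ℤ) =
          dirCount (β.pairing x) (levelCap m β) (hullCap lam x β) := by
      intro β
      rw [Finset.card_image_of_injective, card_arrowSteps h]
      intro k l hkl
      have h1 : k • β.root = l • β.root := sub_right_injective hkl
      rw [← sub_eq_zero, ← sub_smul] at h1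
      have := smul_root_eq_zero h1
      omega
    simp only [hcard]
    rw [Finset.sum_insert (by simp), Finset.sum_insert (by simp), Finset.sum_insert (by simp),
      Finset.sum_singleton]
    have h1 : dirCount (PosRoot.a1.pairing x) (levelCap m .a1 : ℕ) (hullCap lam x .a1) =
        foldLength x.1 := by
      simp only [PosRoot.pairing, dirCount, foldLength, levelCap, hullCap]; push_cast; omega
    rw [h1]
    simp only [PosRoot.pairing]
    ring
  · intro α _ β _ hαβ
    rw [Function.onFun, Finset.disjoint_left]
    intro ν h1 h2
    simp only [Finset.mem_image, mem_arrowSteps_iff hl h] at h1 h2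
    obtain ⟨k, ⟨hk, _⟩, rfl⟩ := h1
    obtain ⟨k', ⟨_, _⟩, h3⟩ := h2
    exact hαβ (smul_root_injective hk (sub_right_injective h3.symm)).1

/-! ### Truncations of direction counts -/

/-- If `J > U` then `p + J > 0`, where `foldLength` is the identity, so a cut from `J` to `U` costs
exactly `J - U`. -/
theorem dirCount_eq {p J U : ℤ} (hU : -p ≤ U) :
    dirCount p J U = foldLength (p + J) - max 0 (J - U) := by
  unfold dirCount foldLength; omega

/-- `InHull` in the orthogonal coordinates `e`, `o` of a weight, in either order. -/
structure OrthHull (L n e o : ℤ) : Prop where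
  parity : (e + o - L) % 2 = 0
  le₁ : e ≤ L + n
  ge₁ : -(L + n) ≤ e
  le₂ : o ≤ L + n
  ge₂ : -(L + n) ≤ o
  le_sum : e + o ≤ L + 2 * n
  ge_sum : -(L + 2 * n) ≤ e + o
  le_diff : e - o ≤ L + 2 * n
  ge_diff : -(L + 2 * n) ≤ e - o

theorem OrthHull.swap {L n e o : ℤ} (h : OrthHull L n e o) : OrthHull L n o e := by
  obtain ⟨c0, c1, c2, c3, c4, c5, c6, c7, c8⟩ := h
  constructor <;> omega

theorem inHull_iff_orthHull {lam x : Weight} :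
    InHull lam x ↔ OrthHull lam.1 lam.2 (x.1 + x.2) x.2 := by
  constructor <;> rintro ⟨c0, c1, c2, c3, c4, c5, c6, c7, c8⟩ <;> constructor <;> omega

/-- The number of levels up to `J` in direction `a21` that leave the hull. -/
def excess21 (L n e o J : ℤ) : ℤ :=
  max 0 (J - min ((L + 2 * n - e - o) / 2) (min (L + n - e) (L + n - o)))

/-- The number of levels up to `J` in the direction of the coordinate `e` that leave the hull. -/
def excess (L n e o J : ℤ) : ℤ :=
  max 0 (J - min (L + n - e) (min (L + 2 * n - e - o) (L + 2 * n - e + o)) / 2)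

/-- The closed form of the elevation of an edge of level `J` in the direction of the
coordinate `e`. -/
def longElevation (L n e o J : ℤ) : ℤ :=
  max 0 (min (2 * J - (n + 1 - e)) (min (2 * J - (n + L + 1 - o))
    (min (J - (L - e - o) / 2) (J + e))))

/-- Twice a lower bound for the levels of non-swappable edges in the direction of the
coordinate `e`. -/
def doubleThreshold (L n e o : ℤ) : ℤ :=
  max (max (n + 1 - e) (n + L + 1 - o)) (max (L - e - o) (-2 * e))

theorem excess_eq_zero {L n e o J : ℤ} (h : e + 2 * J ≤ L + n) (h1 : e + 2 * J + o ≤ L + 2 * n)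
    (h2 : e + 2 * J - o ≤ L + 2 * n) : excess L n e o J = 0 := by
  unfold excess; omega

theorem max_min_four {a b c d k : ℤ} (h : k = max 0 (min a (min b (min c d))))
    (ha : 0 ≤ a) (hb : 0 ≤ b) (hc : 0 ≤ c) (hd : 0 ≤ d) :
    k ≤ a ∧ k ≤ b ∧ k ≤ c ∧ k ≤ d ∧ (k = a ∨ k = b ∨ k = c ∨ k = d) := by
  omega

theorem longElevation_nonneg (L n e o J : ℤ) : 0 ≤ longElevation L n e o J := le_max_left _ _

theorem longElevation_eq_zero {L n e o J : ℤ} (hs : (e + o - L) % 2 = 0)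
    (hN : e + 2 * J < n + 2 ∨ o + 2 * J < n + L + 2 ∨ e + o + 2 * J < L + 2) :
    longElevation L n e o J = 0 := by
  unfold longElevation
  refine max_eq_left ?_
  rcases hN with h | h | h
  · exact (min_le_left _ _).trans (by omega)
  · exact ((min_le_right _ _).trans (min_le_left _ _)).trans (by omega)
  · exact ((min_le_right _ _).trans ((min_le_right _ _).trans (min_le_left _ _))).trans (by omega)

/-- Lowering the atom by `j` turns the edge into one of level `J - j` and length `J + e - j`, with
`n - j` in place of `n`. The first three bounds are the least `j` at which one of the three
non-swappability inequalities `h1`, `h2`, `h3` fails for it; the fourth is the `j` at which it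
shrinks to a point. The elevation is the smallest of the four. -/
theorem longElevation_spec {L n e o J : ℤ} (hJ : 1 ≤ J + e)
    (h1 : n + 2 ≤ e + 2 * J) (h2 : n + L + 2 ≤ o + 2 * J) (h3 : L + 2 ≤ e + o + 2 * J)
    (hs : (e + o - L) % 2 = 0) :
    1 ≤ longElevation L n e o J ∧
    longElevation L n e o J ≤ 2 * J - (n + 1 - e) ∧
    longElevation L n e o J ≤ 2 * J - (n + L + 1 - o) ∧
    2 * longElevation L n e o J ≤ 2 * J - (L - e - o) ∧
    longElevation L n e o J ≤ J + e ∧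
    (longElevation L n e o J = 2 * J - (n + 1 - e) ∨
      longElevation L n e o J = 2 * J - (n + L + 1 - o) ∨
      2 * longElevation L n e o J = 2 * J - (L - e - o) ∨ longElevation L n e o J = J + e) := by
  obtain ⟨g1, g2, g3, g4, g5⟩ := max_min_four (k := longElevation L n e o J) rfl
    (by omega) (by omega) (by omega) (by omega)
  generalize longElevation L n e o J = k at *
  obtain ⟨K, hK⟩ : ∃ K, 2 * K = L - e - o := ⟨_, Int.mul_ediv_cancel' (by omega)⟩
  rw [show (L - e - o) / 2 = K by omega] at g3 g5
  omega

/-! ### Truncations at the two ends of an edge. -/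

section edge

variable {L n e o J δ k : ℤ}

/-- The parameter `δ` treats both long directions at once. When the wall of level `J` is crossed,
the caps in direction `a21` and in the other long direction are `2J - 1` and `J - 1` for `a12` (`δ =
0`), and `2J` and `J` for `a2` (`δ = 1`). -/
theorem excess21_source (hJ : 1 ≤ J) (hJ' : 1 ≤ J + e) (hδ : δ = 0 ∨ δ = 1)
    (hk : k = 0 ∨ k = longElevation L n e o J)
    (hx : OrthHull L n e o) (hy : OrthHull L n (-e - 2 * J) o) :
    excess21 L (n - k) e o (2 * J - 1 + δ) = max 0 (k + max (o + 2 * J - 1 + δ - L - n)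
      ((2 * (2 * J - 1 + δ) + e + o - L - 2 * n) / 2)) := by
  obtain ⟨c0, c1, c2, c3, c4, c5, c6, c7, c8⟩ := hx
  obtain ⟨d0, d1, d2, d3, d4, d5, d6, d7, d8⟩ := hy
  unfold excess21
  -- The facet bounding `e` never decides the truncation: for `k = 0` because the upper end lies in
  -- the hull, for `k > 0` because then `e ≤ o`.
  have key : 2 * J - 1 + δ - (L + (n - k) - e) ≤ max 0 (k + (o + 2 * J - 1 + δ - L - n)) := by
    unfold longElevation at hk
    omega
  clear hk
  omega

theorem excess21_target (hJ : 1 ≤ J) (hJ' : 1 ≤ J + e) (hδ : δ = 0 ∨ δ = 1)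
    (hx : OrthHull L n e o) (hy : OrthHull L n (-e - 2 * J) o) :
    excess21 L n (-e - 2 * J) o (2 * J - 1 + δ) = max 0 (max (o + 2 * J - 1 + δ - L - n)
      ((2 * J - 2 + 2 * δ - e + o - L - 2 * n) / 2)) := by
  obtain ⟨c0, c1, c2, c3, c4, c5, c6, c7, c8⟩ := hx
  obtain ⟨d0, d1, d2, d3, d4, d5, d6, d7, d8⟩ := hy
  unfold excess21
  omega

theorem excess_target (hJ : 1 ≤ J) (hJ' : 1 ≤ J + e)
    (hy : OrthHull L n (-e - 2 * J) o) :
    excess L n o (-e - 2 * J) (J - 1 + δ) = max 0 (max ((2 * J - 1 + 2 * δ + o - L - n) / 2)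
      ((2 * (2 * J - 1 + δ) + e + o - L - 2 * n) / 2)) := by
  obtain ⟨d0, d1, d2, d3, d4, d5, d6, d7, d8⟩ := hy
  unfold excess
  omega

theorem excess_source (hJ : 1 ≤ J) (hJ' : 1 ≤ J + e) (hδ : δ = 0 ∨ δ = 1)
    (hk : k = 0 ∨ k = longElevation L n e o J)
    (hx : OrthHull L n e o) (hy : OrthHull L n (-e - 2 * J) o) :
    excess L (n - k) o e (J - 1 + δ) = max 0 (max ((2 * J - 1 + 2 * δ + o - L - n + k) / 2)
      ((2 * J - 1 + 2 * δ + o - e - L - 2 * n + 2 * k) / 2)) := by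
  obtain ⟨c0, c1, c2, c3, c4, c5, c6, c7, c8⟩ := hx
  obtain ⟨d0, d1, d2, d3, d4, d5, d6, d7, d8⟩ := hy
  unfold excess
  unfold longElevation at hk
  omega

/-- The truncations at the two ends of an edge agree up to the elevation. -/
theorem excess_add_excess (hL : 0 ≤ L) (hn : 0 ≤ n) (hJ : 1 ≤ J) (hJ' : 1 ≤ J + e)
    (hδ : δ = 0 ∨ δ = 1) (hx : OrthHull L n e o) (hy : OrthHull L n (-e - 2 * J) o)
    (hk : k = longElevation L n e o J) :
    excess21 L (n - k) e o (2 * J - 1 + δ) + excess L (n - k) o e (J - 1 + δ) =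
      excess21 L n (-e - 2 * J) o (2 * J - 1 + δ) + excess L n o (-e - 2 * J) (J - 1 + δ) + k := by
  rw [excess21_source hJ hJ' hδ (Or.inr hk) hx hy, excess21_target hJ hJ' hδ hx hy,
    excess_target hJ hJ' hy, excess_source hJ hJ' hδ (Or.inr hk) hx hy]
  obtain ⟨c0, c1, c2, c3, c4, c5, c6, c7, c8⟩ := hx
  obtain ⟨d0, d1, d2, d3, d4, d5, d6, d7, d8⟩ := hy
  have hk' := hk
  obtain ⟨X, hX⟩ : ∃ X, 2 * X = 2 * (2 * J - 1 + δ) + e + o - L - 2 * n := ⟨_, Int.mul_ediv_cancel' (by omega)⟩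
  obtain ⟨Y, hY⟩ : ∃ Y, 2 * Y = 2 * J - 2 + 2 * δ - e + o - L - 2 * n := ⟨_, Int.mul_ediv_cancel' (by omega)⟩
  obtain ⟨K, hK⟩ : ∃ K, 2 * K = L - e - o := ⟨_, Int.mul_ediv_cancel' (by omega)⟩
  obtain ⟨D, hD⟩ : ∃ D, D = o + 2 * J - 1 + δ - L - n := ⟨_, rfl⟩
  rw [show (2 * (2 * J - 1 + δ) + e + o - L - 2 * n) / 2 = X by omega, show (2 * J - 2 + 2 * δ - e + o - L - 2 * n) / 2 = Y by omega,
    show (2 * J - 1 + 2 * δ + o - e - L - 2 * n + 2 * k) / 2 = Y + k by omega, ← hD]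
  rw [longElevation, show (L - e - o) / 2 = K by omega] at hk
  rw [show 2 * J - 1 + 2 * δ + o - L - n + k = D + δ + k by omega, show 2 * J - 1 + 2 * δ + o - L - n = D + δ by omega]
  by_cases hN : e + 2 * J < n + 2 ∨ o + 2 * J < n + L + 2 ∨ e + o + 2 * J < L + 2
  · obtain rfl : k = 0 := hk'.trans (longElevation_eq_zero c0 hN)
    clear hk hk'
    rcases le_or_gt D 0 with h | h
    · have : (D + δ) / 2 ≤ 0 := by omega
      clear hX hY
      omega
    · rcases hN with hN | hN | hN
      · have h1 : X ≤ (D + δ) / 2 := by omega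
        have h2 : Y ≤ (D + δ) / 2 := by omega
        clear hX hY hN
        omega
      · have h1 : (D + δ) / 2 = D := by omega
        clear hX hY hN
        omega
      · have h1 : D ≤ Y := by omega
        have h2 : D ≤ X := by omega
        have h3 : (D + δ) / 2 ≤ D := by omega
        have h4 : 0 ≤ (D + δ) / 2 := by omega
        clear hX hY hN
        omega
  · push Not at hN
    obtain ⟨n1, n2, n3⟩ := hN
    have h0 : 0 ≤ k := by rw [hk]; exact le_max_left _ _
    obtain ⟨g1, g2, g3, g4, g5⟩ := max_min_four hk (by omega) (by omega) (by omega) (by omega)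
    clear hk hk' c0 c1 c2 c3 c4 c5 c6 c7 c8 d0 d1 d2 d3 d4 d5 d6 d7 d8
    have h1 : Y < D := by omega
    have h2 : (D + δ) / 2 ≤ X := by omega
    have h5 : 0 ≤ (D + δ) / 2 := by omega
    -- Each of the four possible values of the elevation makes one entry of the maximum equal to `D`
    -- or `X`. The identity then reads `(k + max D X) + min D X = D + X + k`.
    have h3 : max ((D + δ + k) / 2) (Y + k) = min D X := by
      rcases g5 with g | g | g | g
      · have : (D + δ + k) / 2 = X := by omega
        omega
      · have : (D + δ + k) / 2 = D := by omega
        omega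
      · have : Y + k = D := by omega
        omega
      · have : Y + k = X := by omega
        omega
    rw [h3]
    clear hX hY n1 n2 n3 g1 g2 g3 g4 g5
    omega

/-- At a non-swappable edge the truncations differ. -/
theorem excess_add_excess_lt (hJ : 1 ≤ J) (hJ' : 1 ≤ J + e)
    (hδ : δ = 0 ∨ δ = 1) (hx : OrthHull L n e o) (hy : OrthHull L n (-e - 2 * J) o)
    (h1 : n + 2 ≤ e + 2 * J) (h2 : n + L + 2 ≤ o + 2 * J) (h3 : L + 2 ≤ e + o + 2 * J) :
    excess21 L n e o (2 * J - 1 + δ) + excess L n o e (J - 1 + δ) <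
      excess21 L n (-e - 2 * J) o (2 * J - 1 + δ) + excess L n o (-e - 2 * J) (J - 1 + δ) := by
  have e1 := excess21_source (k := 0) hJ hJ' hδ (Or.inl rfl) hx hy
  have e2 := excess_source (k := 0) hJ hJ' hδ (Or.inl rfl) hx hy
  rw [sub_zero] at e1 e2
  rw [e1, e2, excess21_target hJ hJ' hδ hx hy, excess_target hJ hJ' hy]
  have c0 := hx.parity
  clear e1 e2 hx hy
  obtain ⟨X, hX⟩ : ∃ X, 2 * X = 2 * (2 * J - 1 + δ) + e + o - L - 2 * n :=
    ⟨_, Int.mul_ediv_cancel' (by omega)⟩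
  obtain ⟨Y, hY⟩ : ∃ Y, 2 * Y = 2 * J - 2 + 2 * δ - e + o - L - 2 * n :=
    ⟨_, Int.mul_ediv_cancel' (by omega)⟩
  obtain ⟨D, hD⟩ : ∃ D, D = o + 2 * J - 1 + δ - L - n := ⟨_, rfl⟩
  rw [show (2 * (2 * J - 1 + δ) + e + o - L - 2 * n) / 2 = X by omega,
    show (2 * J - 2 + 2 * δ - e + o - L - 2 * n) / 2 = Y by omega,
    show (2 * J - 1 + 2 * δ + o - e - L - 2 * n + 2 * 0) / 2 = Y by omega, ← hD,
    show (2 * J - 1 + 2 * δ + o - L - n + 0) / 2 = (D + δ) / 2 by omega,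
    show (2 * J - 1 + 2 * δ + o - L - n) / 2 = (D + δ) / 2 by omega]
  have g1 : Y < D := by omega
  have g2 : (D + δ) / 2 < X := by omega
  have g3 : 0 ≤ (D + δ) / 2 := by omega
  have g4 : (D + δ) / 2 < D := by omega
  have g5 : Y < X := by omega
  clear hX hY hD h1 h2 h3
  omega

/-- Truncations in the long directions are invariant under the reflections in
direction `a21`. -/
theorem excess_reflect (hJ : 1 ≤ J) (hJ' : 1 ≤ J + (e + o)) {p : ℤ} (hp : 2 * p ≤ J)
    (hx : OrthHull L n e o) (hy : OrthHull L n (-o - J) (-e - J)) :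
    excess L n (-o - J) (-e - J) p = excess L n e o p := by
  obtain ⟨c0, c1, c2, c3, c4, c5, c6, c7, c8⟩ := hx
  obtain ⟨d0, d1, d2, d3, d4, d5, d6, d7, d8⟩ := hy
  unfold excess
  omega

end edge

/-! ### The correction to the untruncated length -/

/-- The truncation in the direction of the coordinate `e`, together with the number of non-swappable
edges of level at most `J`. -/
def fullExcess (L n e o J : ℤ) : ℤ :=
  max (excess L n e o J) (J - doubleThreshold L n e o / 2)

/-- The closed form of the length of the longest staircase in the direction of the
coordinate `e`. -/
def stairLength (L n e o J : ℤ) : ℤ :=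
  if doubleThreshold L n e o % 2 = 0 ∧ e + doubleThreshold L n e o + o ≤ L + 2 * n ∧
      e + doubleThreshold L n e o - o ≤ L + 2 * n then
    max 0 (min J (L + n - e - doubleThreshold L n e o / 2) - doubleThreshold L n e o / 2)
  else 0

/-- The closed form of the difference between the untruncated length and `σ_m`, as a function of the
numbers of levels in the directions `a21`, `a12`, `a2`. -/
def defect (L n e o J₀ J₁ J₂ a : ℤ) : ℤ :=
  excess21 L n e o J₀ + fullExcess L n e o J₁ + fullExcess L n o e J₂ -
    min a (max (stairLength L n e o J₁) (stairLength L n o e J₂)) - a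

section

variable {L n e o J : ℤ}

theorem excess_nonneg : 0 ≤ excess L n e o J := le_max_left _ _

theorem stairLength_nonneg : 0 ≤ stairLength L n e o J := by
  unfold stairLength; split_ifs <;> omega

theorem fullExcess_eq_excess (h : 2 * J ≤ doubleThreshold L n e o) :
    fullExcess L n e o J = excess L n e o J := by
  have := excess_nonneg (L := L) (n := n) (e := e) (o := o) (J := J)
  unfold fullExcess; omega

theorem stairLength_eq_zero (h : 2 * J ≤ doubleThreshold L n e o) :
    stairLength L n e o J = 0 := by
  unfold stairLength; split_ifs <;> omega

/-- In the direction of the larger coordinate the threshold lies beyond the facet, so there are no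
non-swappable edges. Hence at most one of the two long directions carries a correction. -/
theorem fullExcess_eq_excess_of_le (h : e ≤ o) :
    fullExcess L n o e J = excess L n o e J := by
  have : L + n + 1 - e ≤ doubleThreshold L n o e := by unfold doubleThreshold; omega
  unfold fullExcess excess; omega

theorem stairLength_eq_zero_of_le (h : e ≤ o) : stairLength L n o e J = 0 := by
  have : L + n + 1 - e ≤ doubleThreshold L n o e := by unfold doubleThreshold; omega
  unfold stairLength; split_ifs <;> omega

theorem neg_two_mul_le_doubleThreshold : -2 * e ≤ doubleThreshold L n e o := by
  unfold doubleThreshold; omega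

theorem OrthHull.excess_eq_zero_of_lt (h : OrthHull L n e o) (hJ : J ≤ -e) :
    excess L n e o J = 0 := by
  obtain ⟨c0, c1, c2, c3, c4, c5, c6, c7, c8⟩ := h
  unfold excess; omega

theorem le_doubleThreshold (hs : (e + o - L) % 2 = 0)
    (hN : e + 2 * J < n + 2 ∨ o + 2 * J < n + L + 2 ∨ e + o + 2 * J < L + 2) :
    2 * J ≤ doubleThreshold L n e o := by
  unfold doubleThreshold
  rcases hN with h | h | h <;> simp only [le_max_iff] <;> omega

theorem doubleThreshold_lt (hJ : 1 ≤ J + e)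
    (h1 : n + 2 ≤ e + 2 * J) (h2 : n + L + 2 ≤ o + 2 * J) (h3 : L + 2 ≤ e + o + 2 * J) :
    doubleThreshold L n e o < 2 * J := by
  unfold doubleThreshold; omega

/-- The entries of `doubleThreshold` are the values that `2J` must exceed for each non-swappability
inequality and for `1 ≤ J + e`; for the inequality on `e + o` parity makes the strict bound
equivalent. -/
theorem doubleThreshold_div_two_lt_iff (hs : (e + o - L) % 2 = 0) (hJ : 1 ≤ J + e) :
    doubleThreshold L n e o / 2 < J ↔
      n + 2 ≤ e + 2 * J ∧ n + L + 2 ≤ o + 2 * J ∧ L + 2 ≤ e + o + 2 * J := by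
  constructor
  · intro h
    by_contra hc
    have := le_doubleThreshold (n := n) (J := J) hs (by omega)
    omega
  · rintro ⟨h1, h2, h3⟩
    have := doubleThreshold_lt hJ h1 h2 h3
    omega

/-- Below an edge of positive elevation the threshold is attained at the shortened edge. -/
theorem doubleThreshold_shortened {k : ℤ} (hJ : 1 ≤ J + e) (h1 : n + 2 ≤ e + 2 * J)
    (h2 : n + L + 2 ≤ o + 2 * J) (h3 : L + 2 ≤ e + o + 2 * J) (hs : (e + o - L) % 2 = 0)
    (hk : k = longElevation L n e o J) :
    doubleThreshold L (n - k) e o = 2 * (J - k) := by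
  obtain ⟨g0, g1, g2, g3, g4, g5⟩ := longElevation_spec hJ h1 h2 h3 hs
  rw [← hk] at g0 g1 g2 g3 g4 g5
  unfold doubleThreshold
  clear hk
  rcases g5 with g | g | g | g <;> omega

/-- The lower end of an edge survives the shift by the elevation. -/
theorem OrthHull.sub_longElevation {k : ℤ} (hL : 0 ≤ L) (hn : 0 ≤ n) (hJ : 1 ≤ J)
    (hJ' : 1 ≤ J + e) (hx : OrthHull L n e o)
    (hy : OrthHull L n (-e - 2 * J) o) (hk : k = longElevation L n e o J) :
    k ≤ n ∧ OrthHull L (n - k) e o := by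
  by_cases hN : e + 2 * J < n + 2 ∨ o + 2 * J < n + L + 2 ∨ e + o + 2 * J < L + 2
  · rw [longElevation_eq_zero hx.parity hN] at hk
    subst hk
    rw [sub_zero]
    exact ⟨hn, hx⟩
  · push Not at hN
    obtain ⟨g0, g1, g2, g3, g4, _⟩ := longElevation_spec hJ' hN.1 hN.2.1 hN.2.2 hx.parity
    rw [← hk] at g0 g1 g2 g3 g4
    obtain ⟨c0, c1, c2, c3, c4, c5, c6, c7, c8⟩ := hx
    obtain ⟨d0, d1, d2, d3, d4, d5, d6, d7, d8⟩ := hy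
    refine ⟨by omega, ?_⟩
    constructor <;> omega

theorem longElevation_lt {k : ℤ} (hL : 0 ≤ L) (hn : 0 ≤ n) (hJ : 1 ≤ J)
    (hJ' : 1 ≤ J + e) (hx : OrthHull L n e o)
    (hy : OrthHull L n (-e - 2 * J) o) (hk : k = longElevation L n e o J) : k < J := by
  by_cases hN : e + 2 * J < n + 2 ∨ o + 2 * J < n + L + 2 ∨ e + o + 2 * J < L + 2
  · rw [longElevation_eq_zero hx.parity hN] at hk
    omega
  · push Not at hN
    obtain ⟨g0, g1, g2, g3, g4, _⟩ := longElevation_spec hJ' hN.1 hN.2.1 hN.2.2 hx.parity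
    rw [← hk] at g0 g1 g2 g3 g4
    obtain ⟨c0, c1, c2, c3, c4, c5, c6, c7, c8⟩ := hx
    obtain ⟨d0, d1, d2, d3, d4, d5, d6, d7, d8⟩ := hy
    omega

/-- With `L = 0` the hull gives `e + 2 * J ≤ n`, so every long edge is swappable. This keeps the
atomic index even in the preatoms where only even indices occur. -/
theorem longElevation_eq_zero_of_first_eq_zero (hL : L = 0) (hx : OrthHull L n e o)
    (hy : OrthHull L n (-e - 2 * J) o) : longElevation L n e o J = 0 := by
  have := hy.ge₁
  exact longElevation_eq_zero hx.parity (Or.inl (by omega))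

/-- For a non-swappable edge the threshold after the shift is `2 * (J - k)`, so `fullExcess` and
`stairLength` both equal `J' - J + k`, which is at most `a + k`: the staircase term cancels the
non-swappable edges. Comparing `h2` of `longElevation_spec` with the hull bound `e + 2 * J ≤ L + n`
yields `e ≤ o`. -/
theorem excess_shortened {k a : ℤ} (hJ : 1 ≤ J) (hJ' : 1 ≤ J + e) (ha : 0 ≤ a)
    (hx : OrthHull L n e o) (hy : OrthHull L n (-e - 2 * J) o) (hk : k = longElevation L n e o J)
    {J' : ℤ} (hJJ : J' = J ∨ J' = J - 1) :
    (k = 0 ∧ fullExcess L (n - k) e o J' = 0 ∧ stairLength L (n - k) e o J' = 0) ∨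
      e ≤ o ∧ fullExcess L (n - k) e o J' =
        min (a + k) (stairLength L (n - k) e o J') := by
  by_cases hN : e + 2 * J < n + 2 ∨ o + 2 * J < n + L + 2 ∨ e + o + 2 * J < L + 2
  · left
    rw [longElevation_eq_zero hx.parity hN] at hk
    subst hk
    have h := le_doubleThreshold hx.parity hN
    rw [sub_zero, fullExcess_eq_excess (by omega), stairLength_eq_zero (by omega)]
    refine ⟨rfl, excess_eq_zero ?_ ?_ ?_, rfl⟩
    · have := hy.ge₁; omega
    · have := hy.ge_diff; omega
    · have := hy.ge_sum; omega
  · right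
    push Not at hN
    have h := doubleThreshold_shortened hJ' hN.1 hN.2.1 hN.2.2 hx.parity hk
    obtain ⟨g0, -, -, -, -, -⟩ := longElevation_spec hJ' hN.1 hN.2.1 hN.2.2 hx.parity
    rw [← hk] at g0
    obtain ⟨d0, d1, d2, d3, d4, d5, d6, d7, d8⟩ := hy
    refine ⟨by omega, ?_⟩
    have e1 : excess L (n - k) e o J' ≤ J' - J + k := by unfold excess; omega
    rw [fullExcess, stairLength, h, if_pos (by omega)]
    omega

end

/-! ### Comparison of defects across a wall. -/

section swap

variable {L n e o J δ k a J' : ℤ}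

/-- The defect of the upper end of an edge in a long direction. -/
theorem long_defect_target (hJ : 1 ≤ J) (hJ' : 1 ≤ J + e) (hδ : δ = 0 ∨ δ = 1) (ha : 0 ≤ a)
    (hx : OrthHull L n e o) (hy : OrthHull L n (-e - 2 * J) o) (hJJ : J' = J ∨ J' = J - 1) :
    fullExcess L n (-e - 2 * J) o J' = 0 ∧ stairLength L n (-e - 2 * J) o J' = 0 ∧
    fullExcess L n o (-e - 2 * J) (J - 1 + δ) = excess L n o (-e - 2 * J) (J - 1 + δ) ∧
    stairLength L n o (-e - 2 * J) (J - 1 + δ) = 0 := by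
  have h1 : 2 * J' ≤ doubleThreshold L n (-e - 2 * J) o := by
    have := neg_two_mul_le_doubleThreshold (L := L) (n := n) (e := -e - 2 * J) (o := o)
    omega
  have h2 : 2 * (J - 1 + δ) ≤ doubleThreshold L n o (-e - 2 * J) := by
    have h3 : n + L + 1 - (-e - 2 * J) ≤ doubleThreshold L n o (-e - 2 * J) := by
      unfold doubleThreshold; omega
    have := hx.ge₁
    omega
  refine ⟨?_, stairLength_eq_zero h1, fullExcess_eq_excess h2, stairLength_eq_zero h2⟩
  rw [fullExcess_eq_excess h1]
  exact hy.excess_eq_zero_of_lt (by omega)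

/-- Either the hull bound `e + 2 * J ≤ L + n` puts all relevant levels below the threshold of the
other direction, or the latter belongs to the larger coordinate. -/
theorem long_other_source (hJ : 1 ≤ J) (hJ' : 1 ≤ J + e) (hδ : δ = 0 ∨ δ = 1)
    (hy : OrthHull L n (-e - 2 * J) o) (h : k = 0 ∨ e ≤ o) :
    fullExcess L (n - k) o e (J - 1 + δ) = excess L (n - k) o e (J - 1 + δ) ∧
    stairLength L (n - k) o e (J - 1 + δ) = 0 := by
  rcases h with rfl | h
  · have h2 : 2 * (J - 1 + δ) ≤ doubleThreshold L (n - 0) o e := by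
      have h3 : n + L + 1 - e ≤ doubleThreshold L (n - 0) o e := by
        unfold doubleThreshold; omega
      have := hy.ge₁
      omega
    exact ⟨fullExcess_eq_excess h2, stairLength_eq_zero h2⟩
  · exact ⟨fullExcess_eq_excess_of_le h, stairLength_eq_zero_of_le h⟩

/-- The defects at the two ends of an edge in direction `a12`. -/
theorem defect_a12 (hL : 0 ≤ L) (hn : 0 ≤ n) (hJ : 1 ≤ J) (hJ' : 1 ≤ J + e) (ha : 0 ≤ a)
    (hx : OrthHull L n e o) (hy : OrthHull L n (-e - 2 * J) o)
    (hk : k = longElevation L n e o J)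
    {J₁ J₂ : ℤ} (h₁ : J₁ = J ∨ J₁ = J - 1) (h₂ : J₂ = J ∨ J₂ = J - 1) :
    defect L n (-e - 2 * J) o (2 * J - 1) J₁ (J - 1) a =
      defect L (n - k) e o (2 * J - 1) J₂ (J - 1) (a + k) := by
  obtain ⟨t1, t2, t3, t4⟩ := long_defect_target (δ := 0) hJ hJ' (Or.inl rfl) ha hx hy h₁
  have key := excess_add_excess (δ := 0) hL hn hJ hJ' (Or.inl rfl) hx hy hk
  have hs := excess_shortened (J' := J₂) hJ hJ' ha hx hy hk h₂
  obtain ⟨o1, o2⟩ := long_other_source (k := k) (δ := 0) hJ hJ' (Or.inl rfl) hy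
    (hs.imp (fun h => h.1) fun h => h.1)
  have hnn := stairLength_nonneg (L := L) (n := n - k) (e := e) (o := o) (J := J₂)
  have hk0 : 0 ≤ k := hk ▸ longElevation_nonneg _ _ _ _ _
  simp only [add_zero] at *
  unfold defect
  rw [t1, t2, t3, t4, o1, o2]
  clear hk hx hy t1 t2 t3 t4 o1 o2 h₁ h₂
  rcases hs with ⟨h1, h2, h3⟩ | ⟨h1, h2⟩
  · rw [h2, h3]; omega
  · rw [h2]; omega

/-- The defects at the two ends of an edge in direction `a2`. -/
theorem defect_a2 (hL : 0 ≤ L) (hn : 0 ≤ n) (hJ : 1 ≤ J) (hJ' : 1 ≤ J + e) (ha : 0 ≤ a)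
    (hx : OrthHull L n e o) (hy : OrthHull L n (-e - 2 * J) o)
    (hk : k = longElevation L n e o J)
    {J₁ J₂ : ℤ} (h₁ : J₁ = J ∨ J₁ = J - 1) (h₂ : J₂ = J ∨ J₂ = J - 1) :
    defect L n o (-e - 2 * J) (2 * J) J J₁ a =
      defect L (n - k) o e (2 * J) J J₂ (a + k) := by
  obtain ⟨t1, t2, t3, t4⟩ := long_defect_target (δ := 1) hJ hJ' (Or.inr rfl) ha hx hy h₁
  have key := excess_add_excess (δ := 1) hL hn hJ hJ' (Or.inr rfl) hx hy hk
  have hs := excess_shortened (J' := J₂) hJ hJ' ha hx hy hk h₂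
  obtain ⟨o1, o2⟩ := long_other_source (k := k) (δ := 1) hJ hJ' (Or.inr rfl) hy
    (hs.imp (fun h => h.1) fun h => h.1)
  have hnn := stairLength_nonneg (L := L) (n := n - k) (e := e) (o := o) (J := J₂)
  have hk0 : 0 ≤ k := hk ▸ longElevation_nonneg _ _ _ _ _
  have c1 : ∀ N x y : ℤ, excess21 L N x y (2 * J) = excess21 L N y x (2 * J) := by
    intro N x y; unfold excess21
    rw [show L + 2 * N - x - y = L + 2 * N - y - x by ring, min_comm (L + N - x)]
  simp only [sub_add_cancel] at *
  unfold defect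
  rw [t1, t2, t3, t4, o1, o2, c1 n o, c1 (n - k) o]
  clear hk hx hy t1 t2 t3 t4 o1 o2 h₁ h₂ c1
  rcases hs with ⟨h1, h2, h3⟩ | ⟨h1, h2⟩
  · rw [h2, h3]; omega
  · rw [h2]; omega

/-- The defects at the two ends of an edge in direction `a21`. -/
theorem defect_a21 (hJ : 1 ≤ J) (hJ' : 1 ≤ J + (e + o))
    (hx : OrthHull L n e o) (hy : OrthHull L n (-o - J) (-e - J))
    {J₁ J₂ p q : ℤ} (h₁ : J₁ = J ∨ J₁ = J - 1) (h₂ : J₂ = J ∨ J₂ = J - 1)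
    (hp : 2 * p ≤ J) (hq : 2 * q ≤ J) :
    defect L n (-o - J) (-e - J) J₁ p q a = defect L n e o J₂ p q a := by
  have e1 := excess_reflect hJ hJ' hp hx hy
  have e2 := excess_reflect hJ (by omega) hq hx.swap hy.swap
  have b1 : excess21 L n e o J₂ = 0 := by
    obtain ⟨c0, c1, c2, c3, c4, c5, c6, c7, c8⟩ := hx
    obtain ⟨d0, d1, d2, d3, d4, d5, d6, d7, d8⟩ := hy
    unfold excess21; omega
  have b2 : excess21 L n (-o - J) (-e - J) J₁ = 0 := by
    obtain ⟨c0, c1, c2, c3, c4, c5, c6, c7, c8⟩ := hx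
    obtain ⟨d0, d1, d2, d3, d4, d5, d6, d7, d8⟩ := hy
    unfold excess21; omega
  -- The long levels present are at most `J / 2`, below all thresholds at both ends; neither
  -- non-swappable edges nor staircases occur, and only truncations remain.
  have f1 : J ≤ doubleThreshold L n e o := by
    have := hy.ge₁; unfold doubleThreshold; omega
  have f2 : J ≤ doubleThreshold L n o e := by
    have := hy.ge₂; unfold doubleThreshold; omega
  have f3 : J ≤ doubleThreshold L n (-o - J) (-e - J) := by
    have := hx.ge₁; unfold doubleThreshold; omega
  have f4 : J ≤ doubleThreshold L n (-e - J) (-o - J) := by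
    have := hx.ge₂; unfold doubleThreshold; omega
  unfold defect
  rw [b1, b2, fullExcess_eq_excess (by omega), fullExcess_eq_excess (by omega),
    fullExcess_eq_excess (by omega), fullExcess_eq_excess (by omega),
    stairLength_eq_zero (by omega), stairLength_eq_zero (by omega),
    stairLength_eq_zero (by omega), stairLength_eq_zero (by omega), e1, e2]

/-- If the defect does not grow with the level in a long direction, then the weight is the lower end
of an edge which has been moved by its elevation. -/
theorem exists_elevation_or (hL : 0 ≤ L) (hJ : 1 ≤ J) (hJ' : 1 ≤ J + e) (ha : 0 ≤ a)
    (hx : OrthHull L n e o) {D : ℤ} (hD : e ≤ o → D = 0) :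
    (fullExcess L n e o J - min a (max (stairLength L n e o J) D) =
      fullExcess L n e o (J - 1) - min a (max (stairLength L n e o (J - 1)) D) + 1) ∨
    ∃ j, 0 ≤ j ∧ j ≤ a ∧ OrthHull L (n + j) (-e - 2 * J) o ∧
      longElevation L (n + j) e o J = j ∧ (L = 0 → j = 0) := by
  obtain ⟨c0, c1, c2, c3, c4, c5, c6, c7, c8⟩ := hx
  -- Up to the threshold there are no corrections: either level `J` leaves the hull and the excess
  -- grows, or the edge exists and is swappable, hence has elevation `0`.
  rcases le_or_gt J (doubleThreshold L n e o / 2) with hg | hg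
  · rw [stairLength_eq_zero (by omega), stairLength_eq_zero (by omega),
      fullExcess_eq_excess (by omega), fullExcess_eq_excess (by omega)]
    by_cases hU : OrthHull L n (-e - 2 * J) o
    · right
      refine ⟨0, le_rfl, ha, by rwa [add_zero], ?_, fun _ => rfl⟩
      rw [add_zero]
      apply longElevation_eq_zero c0
      have := mt (doubleThreshold_div_two_lt_iff (n := n) c0 hJ').2 (by omega)
      omega
    · left
      have : ¬ (e + 2 * J ≤ L + n ∧ e + 2 * J + o ≤ L + 2 * n ∧ e + 2 * J - o ≤ L + 2 * n) := by
        intro h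
        apply hU
        constructor <;> omega
      unfold excess
      omega
  -- Beyond the threshold `fullExcess` always grows. The first alternative can fail only if the
  -- staircase term grows too, which requires room in the hull (`h1`) and `a ≥ J - g`, where `2g` is
  -- the threshold.
  · have e1 : fullExcess L n e o J = fullExcess L n e o (J - 1) + 1 := by
      unfold fullExcess excess; omega
    by_cases hc : doubleThreshold L n e o % 2 = 0 ∧
      e + doubleThreshold L n e o + o ≤ L + 2 * n ∧ e + doubleThreshold L n e o - o ≤ L + 2 * n
    · rcases le_or_gt J (L + n - e - doubleThreshold L n e o / 2) with h1 | h1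
      · rcases le_or_gt a (J - 1 - doubleThreshold L n e o / 2) with h2 | h2
        · left
          have s1 : stairLength L n e o J = J - doubleThreshold L n e o / 2 := by
            unfold stairLength; rw [if_pos hc]; omega
          have s2 : stairLength L n e o (J - 1) = J - 1 - doubleThreshold L n e o / 2 := by
            unfold stairLength; rw [if_pos hc]; omega
          omega
        · right
          obtain ⟨g, hgg⟩ : ∃ g, doubleThreshold L n e o = 2 * g :=
            ⟨doubleThreshold L n e o / 2, by omega⟩
          rw [hgg] at hg h1 h2 hc
          rw [show 2 * g / 2 = g by omega] at hg h1 h2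
          have hh : n + 1 - e ≤ 2 * g ∧ n + L + 1 - o ≤ 2 * g ∧ L - e - o ≤ 2 * g ∧ -2 * e ≤ 2 * g ∧
            (n + 1 - e = 2 * g ∨ n + L + 1 - o = 2 * g ∨ L - e - o = 2 * g ∨ -2 * e = 2 * g) := by
            unfold doubleThreshold at hgg; omega
          -- The foot of the staircase, at level `g`, must be the shortened edge; the unshortened
          -- one has level `J`, so the shift is `J - g`.
          refine ⟨J - g, by omega, by omega, ?_, ?_, by omega⟩
          · constructor <;> omega
          · obtain ⟨K, hK⟩ : ∃ K, L - e - o = 2 * K := ⟨(L - e - o) / 2, by omega⟩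
            unfold longElevation
            rw [show (L - e - o) / 2 = K by omega]
            obtain ⟨a1, a2, a3, a4, a5⟩ := hh
            rw [max_eq_right]
            · apply le_antisymm
              · simp only [min_le_iff]; omega
              · simp only [le_min_iff]; omega
            · simp only [le_min_iff]; omega
      · left
        rw [show stairLength L n e o J = stairLength L n e o (J - 1) by
          unfold stairLength; rw [if_pos hc, if_pos hc]; omega]
        omega
    · left
      rw [show stairLength L n e o J = 0 by unfold stairLength; rw [if_neg hc],
        show stairLength L n e o (J - 1) = 0 by unfold stairLength; rw [if_neg hc]]
      omega

end swap

/-! ### Closed forms of the statistics -/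

/-- The length of a weight in the untruncated twisted order. -/
def twistedLength (m : ℕ) (x : Weight) : ℤ :=
  foldLength x.1 + foldLength (x.1 + 2 * x.2 + levelCap m .a21) +
    foldLength (x.1 + x.2 + levelCap m .a12) + foldLength (x.2 + levelCap m .a2)

theorem ellTw_eq_sub {m : ℕ} {x lam : Weight} (hl : Dominant lam) (h : InHull lam x) :
    (ellTw m x lam : ℤ) = twistedLength m x -
      excess21 lam.1 lam.2 (x.1 + x.2) x.2 (levelCap m .a21) -
      excess lam.1 lam.2 (x.1 + x.2) x.2 (levelCap m .a12) -
      excess lam.1 lam.2 x.2 (x.1 + x.2) (levelCap m .a2) := by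
  have h21 : hullCap lam x .a21 = min ((lam.1 + 2 * lam.2 - (x.1 + x.2) - x.2) / 2)
      (min (lam.1 + lam.2 - (x.1 + x.2)) (lam.1 + lam.2 - x.2)) := by
    unfold hullCap
    rw [show lam.1 + 2 * lam.2 - (x.1 + 2 * x.2) = lam.1 + 2 * lam.2 - (x.1 + x.2) - x.2 by ring]
  have h12 : hullCap lam x .a12 = min (lam.1 + lam.2 - (x.1 + x.2))
      (min (lam.1 + 2 * lam.2 - (x.1 + x.2) - x.2)
        (lam.1 + 2 * lam.2 - (x.1 + x.2) + x.2)) / 2 := by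
    unfold hullCap
    rw [show lam.1 + 2 * lam.2 - (x.1 + 2 * x.2) = lam.1 + 2 * lam.2 - (x.1 + x.2) - x.2 by ring,
      show lam.1 + 2 * lam.2 - x.1 = lam.1 + 2 * lam.2 - (x.1 + x.2) + x.2 by ring]
  have h2 : hullCap lam x .a2 = min (lam.1 + lam.2 - x.2)
      (min (lam.1 + 2 * lam.2 - x.2 - (x.1 + x.2))
        (lam.1 + 2 * lam.2 - x.2 + (x.1 + x.2))) / 2 := by
    unfold hullCap
    rw [show lam.1 + 2 * lam.2 - (x.1 + 2 * x.2) = lam.1 + 2 * lam.2 - x.2 - (x.1 + x.2) by ring,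
      show lam.1 + 2 * lam.2 + x.1 = lam.1 + 2 * lam.2 - x.2 + (x.1 + x.2) by ring]
  have g21 := (h.hullCap_ge (β := .a21) (by simp)).2
  have g12 := (h.hullCap_ge (β := .a12) (by simp)).2
  have g2 := (h.hullCap_ge (β := .a2) (by simp)).2
  simp only [PosRoot.pairing] at g21 g12 g2
  rw [ellTw_eq hl h, dirCount_eq g21, dirCount_eq g12, dirCount_eq g2, h21, h12, h2]
  unfold twistedLength excess21 excess
  ring

theorem foldLength_neg_sub_one (k : ℤ) : foldLength (-k - 1) = foldLength k := by
  unfold foldLength; omega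

theorem foldLength_eq_of_add {j k : ℤ} (h : j + k = -1) : foldLength j = foldLength k := by
  rw [← foldLength_neg_sub_one k]; congr 1; omega

theorem foldLength_of_nonneg {k : ℤ} (h : 0 ≤ k) : foldLength k = k := by
  unfold foldLength; omega

/-- The coroots of the three directions are interleaved in `N(y_∞)`, so at the crossing of a wall
its level determines the caps in all directions. Here the long caps are at most half the level. -/
theorem levelCap_of_tRoot_a21 {m : ℕ} (h : tRoot (m + 1) = .a21) :
    (levelCap m .a21 : ℤ) = tLevel (m + 1) - 1 ∧ levelCap (m + 1) .a21 = tLevel (m + 1) ∧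
    levelCap (m + 1) .a12 = levelCap m .a12 ∧ levelCap (m + 1) .a2 = levelCap m .a2 ∧
    (levelCap m .a12 : ℤ) = (tLevel (m + 1) : ℤ) / 2 ∧
    (levelCap m .a2 : ℤ) = ((tLevel (m + 1) : ℤ) - 1) / 2 := by
  unfold tRoot at h
  split_ifs at h with h1 h2
  simp only [levelCap, tLevel, if_pos h1]
  push_cast
  refine ⟨?_, trivial, ?_, ?_, ?_, ?_⟩ <;> omega

theorem levelCap_of_tRoot_a12 {m : ℕ} (h : tRoot (m + 1) = .a12) :
    (levelCap m .a21 : ℤ) = 2 * tLevel (m + 1) - 1 ∧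
    (levelCap (m + 1) .a21 : ℤ) = 2 * tLevel (m + 1) - 1 ∧
    (levelCap m .a12 : ℤ) = tLevel (m + 1) - 1 ∧ levelCap (m + 1) .a12 = tLevel (m + 1) ∧
    (levelCap m .a2 : ℤ) = tLevel (m + 1) - 1 ∧
    (levelCap (m + 1) .a2 : ℤ) = tLevel (m + 1) - 1 := by
  unfold tRoot at h
  split_ifs at h with h1 h2
  simp only [levelCap, tLevel, if_neg h1, if_pos h2]
  push_cast
  refine ⟨?_, ?_, ?_, ?_, ?_, ?_⟩ <;> first | trivial | omega

theorem levelCap_of_tRoot_a2 {m : ℕ} (h : tRoot (m + 1) = .a2) :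
    (levelCap m .a21 : ℤ) = 2 * tLevel (m + 1) ∧
    (levelCap (m + 1) .a21 : ℤ) = 2 * tLevel (m + 1) ∧
    levelCap m .a12 = tLevel (m + 1) ∧ levelCap (m + 1) .a12 = tLevel (m + 1) ∧
    (levelCap m .a2 : ℤ) = tLevel (m + 1) - 1 ∧ levelCap (m + 1) .a2 = tLevel (m + 1) := by
  unfold tRoot at h
  split_ifs at h with h1 h2
  simp only [levelCap, tLevel, if_neg h1, if_neg h2]
  push_cast
  refine ⟨?_, ?_, ?_, ?_, ?_, ?_⟩ <;> first | trivial | omega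

theorem tRefl_of_a21 {k : ℕ} (hk : 1 ≤ k) (h : tRoot k = .a21) (x : Weight) :
    tRefl k x = (x.1, -x.1 - x.2 - tLevel k) := by
  rw [tRefl_apply hk, h]; ext <;> simp [PosRoot.pairing, PosRoot.root]; ring

theorem tRefl_of_a12 {k : ℕ} (hk : 1 ≤ k) (h : tRoot k = .a12) (x : Weight) :
    tRefl k x = (-x.1 - 2 * x.2 - 2 * tLevel k, x.2) := by
  rw [tRefl_apply hk, h]; ext <;> simp [PosRoot.pairing, PosRoot.root]; ring

theorem tRefl_of_a2 {k : ℕ} (hk : 1 ≤ k) (h : tRoot k = .a2) (x : Weight) :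
    tRefl k x = (x.1 + 2 * x.2 + 2 * tLevel k, -x.2 - 2 * tLevel k) := by
  rw [tRefl_apply hk, h]; ext <;> simp [PosRoot.pairing, PosRoot.root] <;> ring

theorem bruhatLT_tRefl_iff {k : ℕ} (hk : 1 ≤ k) (x : Weight) :
    BruhatLT x (tRefl k x) ↔ 1 ≤ tLevel k + (tRoot k).pairing x := by
  have := one_le_tLevel hk
  rw [tRefl_apply hk, bruhatLT_self_sub_smul_root_iff]; omega

theorem tRefl_bruhatLT_iff {k : ℕ} (hk : 1 ≤ k) (x : Weight) :
    BruhatLT (tRefl k x) x ↔ tLevel k + (tRoot k).pairing x < 0 := by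
  have := one_le_tLevel hk
  rw [tRefl_apply hk, bruhatLT_sub_smul_root_iff]; omega

theorem tRefl_eq_self_iff {k : ℕ} (hk : 1 ≤ k) (x : Weight) :
    tRefl k x = x ↔ tLevel k + (tRoot k).pairing x = 0 := by
  rw [tRefl_apply hk, sub_eq_self]
  constructor
  · intro h; have := smul_root_eq_zero h; omega
  · intro h; rw [add_comm, h, zero_smul]

/-- The untruncated length changes by one across a wall. -/
theorem twistedLength_tRefl {m : ℕ} {x : Weight}
    (h : 1 ≤ tLevel (m + 1) + (tRoot (m + 1)).pairing x) :
    twistedLength m (tRefl (m + 1) x) = twistedLength m x + 1 ∧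
    twistedLength (m + 1) x = twistedLength m x + 1 ∧
    twistedLength (m + 1) (tRefl (m + 1) x) = twistedLength m x := by
  have hJ := one_le_tLevel (k := m + 1) (by omega)
  obtain ⟨u, v⟩ := x
  cases hr : tRoot (m + 1)
  · exact absurd hr (tRoot_ne_a1 _)
  · obtain ⟨c1, c2, c3, c4, c5, c6⟩ := levelCap_of_tRoot_a2 hr
    rw [hr] at h
    simp only [PosRoot.pairing] at h
    rw [tRefl_of_a2 (by omega) hr]
    simp only [twistedLength, c1, c2, c3, c4, c5, c6]
    generalize (tLevel (m + 1) : ℤ) = J at *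
    -- Up to the symmetry `k ↦ -1 - k` of `foldLength`, the reflection exchanges the terms of `a1`
    -- and `a21` and preserves that of `a12`; only the term of `a2` itself changes. The other two
    -- cases follow the same pattern.
    rw [foldLength_eq_of_add (j := u + 2 * v + 2 * J) (k := -u - 2 * v - 2 * J - 1) (by ring),
      foldLength_eq_of_add (j := u) (k := -u - 1) (by ring),
      foldLength_eq_of_add (j := u + 2 * v + 2 * J + (-v - 2 * J) + J)
        (k := -(u + v + J) - 1) (by ring), foldLength_neg_sub_one (u + v + J),
      foldLength_eq_of_add (j := u + 2 * v + 2 * J + 2 * (-v - 2 * J) + 2 * J) (k := -u - 1)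
        (by ring),
      foldLength_eq_of_add (j := -v - 2 * J + (J - 1)) (k := v + J) (by ring),
      foldLength_eq_of_add (j := -v - 2 * J + J) (k := v + J - 1) (by ring),
      foldLength_of_nonneg (k := v + (J - 1)) (by omega),
      foldLength_of_nonneg (k := v + J) (by omega), foldLength_of_nonneg (k := v + J - 1) (by omega)]
    refine ⟨?_, ?_, ?_⟩ <;> ring
  · obtain ⟨c1, c2, c3, c4, c5, c6⟩ := levelCap_of_tRoot_a12 hr
    rw [hr] at h
    simp only [PosRoot.pairing] at h
    rw [tRefl_of_a12 (by omega) hr]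
    simp only [twistedLength, c1, c2, c3, c4, c5, c6]
    generalize (tLevel (m + 1) : ℤ) = J at *
    rw [foldLength_eq_of_add (j := -u - 2 * v - 2 * J) (k := u + 2 * v + (2 * J - 1)) (by ring),
      foldLength_eq_of_add (j := -u - 2 * v - 2 * J + 2 * v + (2 * J - 1)) (k := u) (by ring),
      foldLength_eq_of_add (j := -u - 2 * v - 2 * J + v + (J - 1)) (k := u + v + J) (by ring),
      foldLength_eq_of_add (j := -u - 2 * v - 2 * J + v + J) (k := u + v + J - 1) (by ring),
      foldLength_of_nonneg (k := u + v + (J - 1)) (by omega),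
      foldLength_of_nonneg (k := u + v + J) (by omega),
      foldLength_of_nonneg (k := u + v + J - 1) (by omega)]
    refine ⟨?_, ?_, ?_⟩ <;> ring
  · obtain ⟨c1, c2, c3, c4, c5, c6⟩ := levelCap_of_tRoot_a21 hr
    rw [hr] at h
    simp only [PosRoot.pairing] at h
    rw [tRefl_of_a21 (by omega) hr]
    simp only [twistedLength, c1, c2, c3, c4, c5, c6]
    generalize (tLevel (m + 1) : ℤ) = J at *
    rw [foldLength_eq_of_add (j := u + 2 * (-u - v - J) + (J - 1)) (k := u + 2 * v + J) (by ring),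
      foldLength_eq_of_add (j := u + 2 * (-u - v - J) + J) (k := u + 2 * v + J - 1) (by ring),
      foldLength_eq_of_add (j := u + (-u - v - J) + J / 2) (k := v + (J - 1) / 2) (by omega),
      foldLength_eq_of_add (j := -u - v - J + (J - 1) / 2) (k := u + v + J / 2) (by omega),
      foldLength_of_nonneg (k := u + 2 * v + (J - 1)) (by omega),
      foldLength_of_nonneg (k := u + 2 * v + J) (by omega),
      foldLength_of_nonneg (k := u + 2 * v + J - 1) (by omega)]
    refine ⟨?_, ?_, ?_⟩ <;> ring

theorem inHull_tRefl_a21_iff {k : ℕ} (hk : 1 ≤ k) (h : tRoot k = .a21) {lam x : Weight} :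
    InHull lam (tRefl k x) ↔
      OrthHull lam.1 lam.2 (-x.2 - tLevel k) (-(x.1 + x.2) - tLevel k) := by
  rw [tRefl_of_a21 hk h, inHull_iff_orthHull]
  rw [show x.1 + (-x.1 - x.2 - tLevel k) = -x.2 - tLevel k by ring,
    show -x.1 - x.2 - tLevel k = -(x.1 + x.2) - tLevel k by ring]

theorem inHull_tRefl_a12_iff {k : ℕ} (hk : 1 ≤ k) (h : tRoot k = .a12) {lam x : Weight} :
    InHull lam (tRefl k x) ↔
      OrthHull lam.1 lam.2 (-(x.1 + x.2) - 2 * tLevel k) x.2 := by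
  rw [tRefl_of_a12 hk h, inHull_iff_orthHull]
  rw [show -x.1 - 2 * x.2 - 2 * tLevel k + x.2 = -(x.1 + x.2) - 2 * tLevel k by ring]

theorem inHull_tRefl_a2_iff {k : ℕ} (hk : 1 ≤ k) (h : tRoot k = .a2) {lam x : Weight} :
    InHull lam (tRefl k x) ↔
      OrthHull lam.1 lam.2 (-x.2 - 2 * tLevel k) (x.1 + x.2) := by
  rw [tRefl_of_a2 hk h, inHull_iff_orthHull]
  rw [show x.1 + 2 * x.2 + 2 * tLevel k + (-x.2 - 2 * tLevel k) = x.1 + x.2 by ring]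
  exact ⟨OrthHull.swap, OrthHull.swap⟩

/-- The numerical condition for the edge of level `j` in direction `β` to be non-swappable. -/
def NonSwapCond (lam x : Weight) (j : ℤ) : PosRoot → Prop
  | .a1 => False
  | .a21 => False
  | .a12 => lam.2 + 2 ≤ x.1 + x.2 + 2 * j ∧ lam.2 + lam.1 + 2 ≤ x.2 + 2 * j ∧
      lam.1 + 2 ≤ x.1 + x.2 + x.2 + 2 * j
  | .a2 => lam.2 + 2 ≤ x.2 + 2 * j ∧ lam.2 + lam.1 + 2 ≤ x.1 + x.2 + 2 * j ∧
      lam.1 + 2 ≤ x.2 + (x.1 + x.2) + 2 * j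

/-- As `twistedLength` increases by one along the edge, swappability says that the truncations at
both ends have the same sum. `excess_add_excess` with elevation zero gives equality,
`excess_add_excess_lt` a strict inequality in the non-swappable case. -/
theorem swap_condition_iff {m : ℕ} {lam x : Weight} (hl : Dominant lam) (hx : InHull lam x)
    (hy : InHull lam (tRefl (m + 1) x)) (h : 1 ≤ tLevel (m + 1) + (tRoot (m + 1)).pairing x) :
    (ellTw m x lam : ℤ) = (ellTw m (tRefl (m + 1) x) lam : ℤ) - 1 ↔
      ¬ NonSwapCond lam x (tLevel (m + 1)) (tRoot (m + 1)) := by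
  have hm : 1 ≤ m + 1 := by omega
  have hJ := one_le_tLevel hm
  rw [ellTw_eq_sub hl hx, ellTw_eq_sub hl hy, (twistedLength_tRefl h).1]
  have hx' := inHull_iff_orthHull.1 hx
  obtain ⟨hl1, hl2⟩ := hl
  cases hr : tRoot (m + 1)
  · exact absurd hr (tRoot_ne_a1 _)
  · obtain ⟨c1, c2, c3, c4, c5, c6⟩ := levelCap_of_tRoot_a2 hr
    rw [hr] at h
    simp only [PosRoot.pairing] at h
    rw [inHull_tRefl_a2_iff hm hr] at hy
    rw [tRefl_of_a2 hm hr]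
    simp only [c1, c3, c5, NonSwapCond]
    generalize hJJ : (tLevel (m + 1) : ℤ) = J at *
    have hJ1 : 1 ≤ J := by omega
    rw [show x.1 + 2 * x.2 + 2 * J + (-x.2 - 2 * J) = x.1 + x.2 by ring]
    have s1 : ∀ p q K : ℤ, excess21 lam.1 lam.2 p q K = excess21 lam.1 lam.2 q p K := by
      intro p q K
      unfold excess21
      rw [min_comm (lam.1 + lam.2 - p), sub_right_comm]
    -- No truncation occurs in the direction of the edge: at the lower end even level `J` stays in
    -- the hull, and the upper end lies beyond the wall.
    have z1 : excess lam.1 lam.2 x.2 (x.1 + x.2) (J - 1) = 0 := by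
      obtain ⟨d0, d1, d2, d3, d4, d5, d6, d7, d8⟩ := hy
      apply excess_eq_zero <;> omega
    have z2 : excess lam.1 lam.2 (-x.2 - 2 * J) (x.1 + x.2) (J - 1) = 0 :=
      hy.excess_eq_zero_of_lt (by omega)
    rw [z1, z2, s1 (x.1 + x.2) x.2, s1 (x.1 + x.2) (-x.2 - 2 * J)]
    constructor
    · rintro h1 ⟨h2, h3, h4⟩
      have := excess_add_excess_lt (δ := 1) hJ1 h (Or.inr rfl) hx'.swap hy h2 h3 h4
      rw [sub_add_cancel, sub_add_cancel] at this
      omega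
    · intro h1
      have h5 := longElevation_eq_zero (n := lam.2) (J := J) hx'.swap.parity (by omega)
      have := excess_add_excess (δ := 1) hl1 hl2 hJ1 h (Or.inr rfl) hx'.swap hy h5.symm
      rw [sub_add_cancel, sub_add_cancel, sub_zero] at this
      omega
  · obtain ⟨c1, c2, c3, c4, c5, c6⟩ := levelCap_of_tRoot_a12 hr
    rw [hr] at h
    simp only [PosRoot.pairing] at h
    rw [inHull_tRefl_a12_iff hm hr] at hy
    rw [tRefl_of_a12 hm hr]
    simp only [c1, c3, c5, NonSwapCond]
    generalize hJJ : (tLevel (m + 1) : ℤ) = J at *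
    have hJ1 : 1 ≤ J := by omega
    rw [show -x.1 - 2 * x.2 - 2 * J + x.2 = -(x.1 + x.2) - 2 * J by ring]
    have z1 : excess lam.1 lam.2 (x.1 + x.2) x.2 (J - 1) = 0 := by
      obtain ⟨d0, d1, d2, d3, d4, d5, d6, d7, d8⟩ := hy
      apply excess_eq_zero <;> omega
    have z2 : excess lam.1 lam.2 (-(x.1 + x.2) - 2 * J) x.2 (J - 1) = 0 :=
      hy.excess_eq_zero_of_lt (by omega)
    rw [z1, z2]
    constructor
    · rintro h1 ⟨h2, h3, h4⟩
      have := excess_add_excess_lt (δ := 0) hJ1 h (Or.inl rfl) hx' hy h2 h3 h4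
      rw [add_zero, add_zero] at this
      omega
    · intro h1
      have h5 := longElevation_eq_zero (n := lam.2) (J := J) hx'.parity (by omega)
      have := excess_add_excess (δ := 0) hl1 hl2 hJ1 h (Or.inl rfl) hx' hy h5.symm
      rw [add_zero, add_zero, sub_zero] at this
      omega
  · obtain ⟨c1, c2, c3, c4, c5, c6⟩ := levelCap_of_tRoot_a21 hr
    rw [hr] at h
    simp only [PosRoot.pairing] at h
    rw [inHull_tRefl_a21_iff hm hr] at hy
    rw [tRefl_of_a21 hm hr]
    simp only [c1, c5, c6, NonSwapCond, not_false_eq_true, iff_true]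
    generalize hJJ : (tLevel (m + 1) : ℤ) = J at *
    have hJ1 : 1 ≤ J := by omega
    rw [show x.1 + (-x.1 - x.2 - J) = -x.2 - J by ring,
      show -x.1 - x.2 - J = -(x.1 + x.2) - J by ring]
    rw [excess_reflect hJ1 (by omega) (by omega) hx' hy,
      excess_reflect hJ1 (by omega) (by omega) hx'.swap hy.swap]
    have b1 : excess21 lam.1 lam.2 (x.1 + x.2) x.2 (J - 1) = 0 := by
      obtain ⟨c0, c1, c2, c3, c4, c5, c6, c7, c8⟩ := hx'
      obtain ⟨d0, d1, d2, d3, d4, d5, d6, d7, d8⟩ := hy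
      unfold excess21; omega
    have b2 : excess21 lam.1 lam.2 (-x.2 - J) (-(x.1 + x.2) - J) (J - 1) = 0 := by
      obtain ⟨c0, c1, c2, c3, c4, c5, c6, c7, c8⟩ := hx'
      obtain ⟨d0, d1, d2, d3, d4, d5, d6, d7, d8⟩ := hy
      unfold excess21; omega
    rw [b1, b2]
    ring

theorem IsEdge.inHull {lam x y : Weight} (h : IsEdge lam x y) : InHull lam x ∧ InHull lam y :=
  ⟨(bruhatLE_iff_inHull h.1).1 (h.2.1.1.trans h.2.2.1), (bruhatLE_iff_inHull h.1).1 h.2.2.1⟩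

theorem isEdge_tRefl_iff {k : ℕ} (hk : 1 ≤ k) {lam x : Weight} (hl : Dominant lam) :
    IsEdge lam x (tRefl k x) ↔
      1 ≤ tLevel k + (tRoot k).pairing x ∧ InHull lam (tRefl k x) := by
  rw [tRefl_apply hk, isEdge_up_iff hl]
  have := one_le_tLevel hk
  refine and_congr_left fun _ => ?_
  omega

/-- The ends of an edge determine the reflection, so the existential index in `IsSwappable` and
`IsNonSwappable` is unambiguous. -/
theorem tRefl_injective_index {i j : ℕ} (hi : 1 ≤ i) (hj : 1 ≤ j) {x : Weight}
    (hne : tRefl i x ≠ x) (h : tRefl i x = tRefl j x) : i = j := by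
  have h0 : (tRoot i).pairing x + tLevel i ≠ 0 := by
    intro h0; exact hne ((tRefl_eq_self_iff hi x).2 (by omega))
  rw [tRefl_apply hi, tRefl_eq_sub_iff hj h0] at h
  rw [← tIndex_tLevel hi, ← tIndex_tLevel hj, h.1]
  congr 1
  omega

theorem IsEdge.ne {lam x y : Weight} (h : IsEdge lam x y) : y ≠ x := fun e => h.2.1.2 e.symm

theorem isSwappable_tRefl_iff {m : ℕ} {lam x : Weight} :
    IsSwappable lam x (tRefl (m + 1) x) ↔ IsEdge lam x (tRefl (m + 1) x) ∧
      ¬ NonSwapCond lam x (tLevel (m + 1)) (tRoot (m + 1)) := by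
  constructor
  · rintro ⟨i, hi, he, h⟩
    obtain rfl : m = i := by
      have := tRefl_injective_index (by omega) (by omega) he.ne hi
      omega
    refine ⟨he, ?_⟩
    rwa [← swap_condition_iff he.1 he.inHull.1 he.inHull.2
      ((isEdge_tRefl_iff (by omega) he.1).1 he).1]
  · rintro ⟨he, h⟩
    refine ⟨m, rfl, he, ?_⟩
    rwa [swap_condition_iff he.1 he.inHull.1 he.inHull.2
      ((isEdge_tRefl_iff (by omega) he.1).1 he).1]

theorem isNonSwappable_tRefl_iff {m : ℕ} {lam x : Weight} :
    IsNonSwappable lam x (tRefl (m + 1) x) ↔ IsEdge lam x (tRefl (m + 1) x) ∧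
      NonSwapCond lam x (tLevel (m + 1)) (tRoot (m + 1)) := by
  constructor
  · rintro ⟨i, hi, he, h⟩
    obtain rfl : m = i := by
      have := tRefl_injective_index (by omega) (by omega) he.ne hi
      omega
    refine ⟨he, ?_⟩
    rwa [ne_eq, swap_condition_iff he.1 he.inHull.1 he.inHull.2
      ((isEdge_tRefl_iff (by omega) he.1).1 he).1, not_not] at h
  · rintro ⟨he, h⟩
    refine ⟨m, rfl, he, ?_⟩
    rwa [ne_eq, swap_condition_iff he.1 he.inHull.1 he.inHull.2
      ((isEdge_tRefl_iff (by omega) he.1).1 he).1, not_not]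

theorem exists_tRefl_eq {x : Weight} {β : PosRoot} {j : ℤ} (hβ : β ≠ .a1) (hj : 1 ≤ j) :
    ∃ i, tRoot (i + 1) = β ∧ (tLevel (i + 1) : ℤ) = j ∧
      tRefl (i + 1) x = x - (β.pairing x + j) • β.root := by
  obtain ⟨j, rfl⟩ := Int.eq_ofNat_of_zero_le (by omega : 0 ≤ j)
  have hj' : 1 ≤ j := by omega
  have h1 := one_le_tIndex hj' hβ
  refine ⟨tIndex j β - 1, ?_⟩
  rw [Nat.sub_add_cancel h1, tRefl_apply h1, tRoot_tIndex hj' hβ, tLevel_tIndex hj' hβ]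
  exact ⟨rfl, rfl, rfl⟩

/-- The numerical form of the edges `x → x - k β` with `β ≠ α₁` whose reflection is some `t_i`. -/
def IsLabelledEdge (lam x : Weight) (β : PosRoot) (k : ℤ) : Prop :=
  Dominant lam ∧ β ≠ .a1 ∧ 1 ≤ k ∧ 1 ≤ k - β.pairing x ∧ InHull lam (x - k • β.root)

theorem isLabelledEdge_iff_exists {lam x : Weight} {β : PosRoot} {k : ℤ} :
    IsLabelledEdge lam x β k ↔ ∃ m, x - k • β.root = tRefl (m + 1) x ∧
      IsEdge lam x (tRefl (m + 1) x) ∧ tRoot (m + 1) = β ∧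
      (tLevel (m + 1) : ℤ) = k - β.pairing x := by
  constructor
  · rintro ⟨hl, hβ, hk, hj, hy⟩
    obtain ⟨i, h1, h2, h3⟩ := exists_tRefl_eq (x := x) hβ hj
    rw [add_sub_cancel] at h3
    refine ⟨i, h3.symm, ?_, h1, h2⟩
    rw [isEdge_tRefl_iff (by omega) hl, h1, h2, h3]
    exact ⟨by omega, hy⟩
  · rintro ⟨m, h1, h2, rfl, h4⟩
    have h5 := (isEdge_tRefl_iff (by omega) h2.1).1 h2
    have h6 := one_le_tLevel (k := m + 1) (by omega)
    exact ⟨h2.1, tRoot_ne_a1 _, by omega, by omega, h1 ▸ h5.2⟩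

theorem exists_tRefl_of_edge {lam x : Weight} {β : PosRoot} {k : ℤ} {m : ℕ}
    (he : IsEdge lam x (tRefl (m + 1) x)) (h : x - k • β.root = tRefl (m + 1) x) :
    tRoot (m + 1) = β ∧ (tLevel (m + 1) : ℤ) = k - β.pairing x := by
  refine (tRefl_eq_sub_iff (by omega) ?_ x).1 h
  rintro rfl
  exact he.ne (by rw [← h]; simp)

theorem isSwappable_sub_iff {lam x : Weight} {β : PosRoot} {k : ℤ} :
    IsSwappable lam x (x - k • β.root) ↔ IsLabelledEdge lam x β k ∧
      ¬ NonSwapCond lam x (k - β.pairing x) β := by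
  constructor
  · rintro ⟨m, h1, h2, h3⟩
    have h4 := h1 ▸ h2
    obtain ⟨h5, h6⟩ := exists_tRefl_of_edge h4 h1
    have h7 := (isSwappable_tRefl_iff (m := m) (lam := lam) (x := x)).1
      ⟨m, rfl, h4, by rwa [h1] at h3⟩
    rw [h5, h6] at h7
    exact ⟨isLabelledEdge_iff_exists.2 ⟨m, h1, h4, h5, h6⟩, h7.2⟩
  · rintro ⟨h1, h2⟩
    obtain ⟨m, h3, h4, h5, h6⟩ := isLabelledEdge_iff_exists.1 h1
    rw [h3]
    exact isSwappable_tRefl_iff.2 ⟨h4, by rwa [h5, h6]⟩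

theorem isNonSwappable_sub_iff {lam x : Weight} {β : PosRoot} {k : ℤ} :
    IsNonSwappable lam x (x - k • β.root) ↔ IsLabelledEdge lam x β k ∧
      NonSwapCond lam x (k - β.pairing x) β := by
  constructor
  · rintro ⟨m, h1, h2, h3⟩
    have h4 := h1 ▸ h2
    obtain ⟨h5, h6⟩ := exists_tRefl_of_edge h4 h1
    have h7 := (isNonSwappable_tRefl_iff (m := m) (lam := lam) (x := x)).1
      ⟨m, rfl, h4, by rwa [h1] at h3⟩
    rw [h5, h6] at h7
    exact ⟨isLabelledEdge_iff_exists.2 ⟨m, h1, h4, h5, h6⟩, h7.2⟩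
  · rintro ⟨h1, h2⟩
    obtain ⟨m, h3, h4, h5, h6⟩ := isLabelledEdge_iff_exists.1 h1
    rw [h3]
    exact isNonSwappable_tRefl_iff.2 ⟨h4, by rwa [h5, h6]⟩

/-! ### Long directions in orthogonal coordinates -/

/-- The coordinates `(e, o)` of a weight for the directions `a12` and `a2`. -/
def longCoord (x : Weight) : PosRoot → ℤ × ℤ
  | .a2 => (x.2, x.1 + x.2)
  | _ => (x.1 + x.2, x.2)

/-- The directions of the long roots `α₁₂` and `α₂`. -/
def IsLong (β : PosRoot) : Prop := β = .a12 ∨ β = .a2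

theorem IsLong.pairing {β : PosRoot} (h : IsLong β) (x : Weight) :
    β.pairing x = (longCoord x β).1 := by
  rcases h with rfl | rfl <;> rfl

theorem IsLong.ne_a1 {β : PosRoot} (h : IsLong β) : β ≠ .a1 := by
  rcases h with rfl | rfl <;> simp

theorem IsLong.inHull_iff {β : PosRoot} (h : IsLong β) {lam x : Weight} :
    InHull lam x ↔ OrthHull lam.1 lam.2 (longCoord x β).1 (longCoord x β).2 := by
  rw [inHull_iff_orthHull]
  rcases h with rfl | rfl
  · rfl
  · exact ⟨OrthHull.swap, OrthHull.swap⟩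

theorem IsLong.longCoord_sub {β : PosRoot} (h : IsLong β) (x : Weight) (k : ℤ) :
    longCoord (x - k • β.root) β = ((longCoord x β).1 - 2 * k, (longCoord x β).2) := by
  rcases h with rfl | rfl <;> simp [longCoord, PosRoot.root] <;> ring

theorem IsLong.nonSwapCond_iff {β : PosRoot} (h : IsLong β) {lam x : Weight} {j : ℤ} :
    NonSwapCond lam x j β ↔ lam.2 + 2 ≤ (longCoord x β).1 + 2 * j ∧
      lam.2 + lam.1 + 2 ≤ (longCoord x β).2 + 2 * j ∧
      lam.1 + 2 ≤ (longCoord x β).1 + (longCoord x β).2 + 2 * j := by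
  rcases h with rfl | rfl <;> rfl

theorem NonSwapCond.isLong {β : PosRoot} {lam x : Weight} {j : ℤ} (h : NonSwapCond lam x j β) :
    IsLong β := by
  cases β
  · exact h.elim
  · exact Or.inr rfl
  · exact Or.inl rfl
  · exact h.elim

theorem IsLong.isLabelledEdge_iff {β : PosRoot} (h : IsLong β) {lam x : Weight} {k : ℤ} :
    IsLabelledEdge lam x β k ↔ Dominant lam ∧ 1 ≤ k ∧ 1 ≤ k - (longCoord x β).1 ∧
      OrthHull lam.1 lam.2 ((longCoord x β).1 - 2 * k) (longCoord x β).2 := by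
  rw [IsLabelledEdge, h.inHull_iff, h.longCoord_sub, h.pairing]
  simp [h.ne_a1]

/-! ### Elevations -/

theorem sub_nsmul_fw2 (lam : Weight) (j : ℕ) : lam - j • fw2 = (lam.1, lam.2 - j) := by
  ext <;> simp [fw2]

theorem add_nsmul_fw2 (lam : Weight) (j : ℕ) : lam + j • fw2 = (lam.1, lam.2 + j) := by
  ext <;> simp [fw2]

theorem zero_mem_elevationSet {lam x y : Weight} {α : PosRoot} {k : ℤ}
    (hy : y = x - k • α.root) (h : IsSwappable lam x y) : 0 ∈ elevationSet lam x y := by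
  refine ⟨α, k, hy, Or.inr ?_⟩
  rw [Nat.cast_zero, sub_zero, ← hy, zero_smul, sub_zero]
  exact h

theorem mem_elevationSet_iff {lam x : Weight} {β : PosRoot} (h : IsLong β) {k : ℤ}
    (he : IsLabelledEdge lam x β k) (hx : InHull lam x) {j : ℕ} :
    j ∈ elevationSet lam x (x - k • β.root) ↔
      (k = j ∧ Dominant (lam - j • fw2) ∧ BruhatLE x (lam - j • fw2)) ∨
        IsSwappable (lam - j • fw2) x (x - (k - (j : ℤ)) • β.root) := by
  constructor
  · rintro ⟨α, k', h1, h2⟩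
    have hk : k ≠ 0 := by have := he.2.2.1; omega
    obtain ⟨rfl, rfl⟩ := smul_root_injective hk (sub_right_injective h1)
    exact h2
  · intro h
    exact ⟨β, k, rfl, h⟩

/-- The elevation of an edge in a long direction. -/
theorem isLeast_elevationSet {lam x : Weight} {β : PosRoot} (h : IsLong β) {k : ℤ}
    (he : IsLabelledEdge lam x β k) (hx : InHull lam x) {w : ℕ}
    (hw : (w : ℤ) = longElevation lam.1 lam.2 (longCoord x β).1 (longCoord x β).2
      (k - (longCoord x β).1)) :
    IsLeast (elevationSet lam x (x - k • β.root)) w := by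
  have he' := h.isLabelledEdge_iff.1 he
  have hx' := h.inHull_iff.1 hx
  have hset := fun j : ℕ => mem_elevationSet_iff h he hx (j := j)
  obtain ⟨⟨hl1, hl2⟩, hk1, hk2, hy⟩ := he'
  have hpar := hx'.parity
  generalize he1 : (longCoord x β).1 = e at *
  generalize ho1 : (longCoord x β).2 = o at *
  obtain ⟨J, hJ⟩ : ∃ J, J = k - e := ⟨_, rfl⟩
  rw [show e - 2 * k = -e - 2 * J by omega] at hy
  rw [← hJ] at hw
  -- Shortening by `j` while lowering the highest weight by `jϖ₂` replaces `n` by `n - j` and the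
  -- level `J` by `J - j`.
  have hswap : ∀ j : ℕ, IsSwappable (lam - j • fw2) x (x - (k - (j : ℤ)) • β.root) ↔
      (0 ≤ lam.2 - j ∧ 1 ≤ k - j ∧ 1 ≤ k - j - e ∧
        OrthHull lam.1 (lam.2 - j) (e - 2 * (k - j)) o) ∧
      ¬ (lam.2 - j + 2 ≤ e + 2 * (k - j - e) ∧ lam.2 - j + lam.1 + 2 ≤ o + 2 * (k - j - e) ∧
        lam.1 + 2 ≤ e + o + 2 * (k - j - e)) := by
    intro j
    rw [isSwappable_sub_iff, h.isLabelledEdge_iff, h.nonSwapCond_iff, h.pairing, he1, ho1,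
      sub_nsmul_fw2]
    simp only [Dominant, hl1, true_and]
  constructor
  · rw [hset, hswap, sub_nsmul_fw2]
    by_cases hN : e + 2 * J < lam.2 + 2 ∨ o + 2 * J < lam.2 + lam.1 + 2 ∨ e + o + 2 * J < lam.1 + 2
    · rw [longElevation_eq_zero hpar hN] at hw
      right
      rw [hw]
      simp only [sub_zero]
      rw [show e - 2 * k = -e - 2 * J by omega]
      exact ⟨⟨hl2, hk1, hk2, hy⟩, by omega⟩
    · push Not at hN
      have g := longElevation_spec (by omega) hN.1 hN.2.1 hN.2.2 hpar
      rw [← hw] at g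
      obtain ⟨g0, g1, g2, g3, g4, g5⟩ := g
      obtain ⟨s1, s2⟩ := hx'.sub_longElevation hl1 hl2 (by omega) (by omega) hy hw
      -- If the elevation is the full length of the edge, the shortened edge is a point and the
      -- degenerate clause applies. Otherwise `w < J`, so the shortened edge still has positive
      -- level.
      by_cases hc : k = w
      · left
        have hd : Dominant (lam.1, lam.2 - (w : ℤ)) := ⟨hl1, sub_nonneg.2 s1⟩
        refine ⟨hc, hd, ?_⟩
        rw [bruhatLE_iff_inHull hd, h.inHull_iff, he1, ho1]
        exact s2
      · right
        have s3 := longElevation_lt hl1 hl2 (by omega) (by omega) hx' hy hw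
        refine ⟨⟨by omega, by omega, by omega, ?_⟩, by omega⟩
        obtain ⟨c0, c1, c2, c3, c4, c5, c6, c7, c8⟩ := s2
        obtain ⟨d0, d1, d2, d3, d4, d5, d6, d7, d8⟩ := hy
        constructor <;> omega
  -- A member `j` either equals the length of the edge or violates one of the three inequalities; in
  -- each case it reaches one of the four bounds.
  · intro j hj
    rw [hset, hswap] at hj
    by_cases hN : e + 2 * J < lam.2 + 2 ∨ o + 2 * J < lam.2 + lam.1 + 2 ∨ e + o + 2 * J < lam.1 + 2
    · rw [longElevation_eq_zero hpar hN] at hw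
      omega
    · push Not at hN
      have g := longElevation_spec (by omega) hN.1 hN.2.1 hN.2.2 hpar
      rw [← hw] at g
      obtain ⟨g0, g1, g2, g3, g4, g5⟩ := g
      rcases hj with hj | ⟨-, hj⟩ <;> omega

/-! ### Non-swappable edges -/

theorem doubleThreshold_pos {L n e o : ℤ} (ho : o ≤ L + n) : 1 ≤ doubleThreshold L n e o := by
  unfold doubleThreshold; omega

/-- The levels of the non-swappable edges of level at most `J` in the direction of the
coordinate `e`. -/
noncomputable def nonSwapLevels (L n e o : ℤ) (J : ℕ) : Finset ℕ :=
  Finset.Icc (doubleThreshold L n e o / 2 + 1).toNat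
    (min (J : ℤ) (min (L + n - e) (min (L + 2 * n - e - o) (L + 2 * n - e + o)) / 2)).toNat

theorem mem_nonSwapLevels_iff {lam x : Weight} (hl : Dominant lam) (hx : InHull lam x)
    {β : PosRoot} (h : IsLong β) {j J : ℕ} :
    j ∈ nonSwapLevels lam.1 lam.2 (longCoord x β).1 (longCoord x β).2 J ↔
      1 ≤ j ∧ j ≤ J ∧ IsNonSwappable lam x (x - (β.pairing x + j) • β.root) := by
  have hx' := h.inHull_iff.1 hx
  rw [isNonSwappable_sub_iff, h.isLabelledEdge_iff, h.nonSwapCond_iff, h.pairing]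
  generalize (longCoord x β).1 = e at *
  generalize (longCoord x β).2 = o at *
  have hpos := doubleThreshold_pos (n := lam.2) (e := e) hx'.le₂
  have hneg := neg_two_mul_le_doubleThreshold (L := lam.1) (n := lam.2) (e := e) (o := o)
  have key := doubleThreshold_div_two_lt_iff (n := lam.2) (J := j) hx'.parity
  rw [nonSwapLevels, Finset.mem_Icc, add_sub_cancel_left]
  obtain ⟨c0, c1, c2, c3, c4, c5, c6, c7, c8⟩ := hx'
  constructor
  · rintro ⟨h1, h2⟩
    have h3 : 1 ≤ j + e := by omega
    refine ⟨by omega, by omega, ⟨hl, by omega, by omega, ?_⟩, (key h3).1 (by omega)⟩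
    constructor <;> omega
  · rintro ⟨h1, h2, ⟨_, h3, h4, h5⟩, h6⟩
    have := (key (by omega)).2 h6
    obtain ⟨d0, d1, d2, d3, d4, d5, d6, d7, d8⟩ := h5
    omega

theorem nonSwapCount_eq {m : ℕ} {lam x : Weight} (hl : Dominant lam) (hx : InHull lam x) :
    nonSwapCount m x lam =
      (nonSwapLevels lam.1 lam.2 (x.1 + x.2) x.2 (levelCap m .a12)).card +
      (nonSwapLevels lam.1 lam.2 x.2 (x.1 + x.2) (levelCap m .a2)).card := by
  have m1 := fun j => mem_nonSwapLevels_iff hl hx (β := .a12) (Or.inl rfl) (j := j)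
    (J := levelCap m .a12)
  have m2 := fun j => mem_nonSwapLevels_iff hl hx (β := .a2) (Or.inr rfl) (j := j)
    (J := levelCap m .a2)
  simp only [longCoord] at m1 m2
  have hset : {k : ℕ | 1 ≤ k ∧ k ≤ m ∧ IsNonSwappable lam x (tRefl k x)} =
      ↑((nonSwapLevels lam.1 lam.2 (x.1 + x.2) x.2 (levelCap m .a12)).image
          (fun j => tIndex j .a12) ∪
        (nonSwapLevels lam.1 lam.2 x.2 (x.1 + x.2) (levelCap m .a2)).image
          (fun j => tIndex j .a2)) := by
    ext k
    simp only [Set.mem_ofPred_eq, Finset.mem_coe, Finset.mem_union, Finset.mem_image, m1, m2]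
    constructor
    · rintro ⟨h1, h2, h3⟩
      have h4 := (tLevel_le_levelCap_iff k m).2 h2
      have h5 := one_le_tLevel h1
      have h6 := h3
      rw [tRefl_apply h1, isNonSwappable_sub_iff] at h6
      have h8 := h3
      rw [tRefl_apply h1] at h8
      have h9 := tIndex_tLevel h1
      rcases h6.2.isLong with h7 | h7 <;> rw [h7] at h8 h9 h4
      · exact Or.inl ⟨tLevel k, ⟨h5, h4, h8⟩, h9⟩
      · exact Or.inr ⟨tLevel k, ⟨h5, h4, h8⟩, h9⟩
    · have aux : ∀ (β : PosRoot) (j : ℕ), β ≠ .a1 → 1 ≤ j → j ≤ levelCap m β →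
          IsNonSwappable lam x (x - (β.pairing x + j) • β.root) →
          1 ≤ tIndex j β ∧ tIndex j β ≤ m ∧ IsNonSwappable lam x (tRefl (tIndex j β) x) := by
        intro β j hβ h1 h2 h3
        have h4 := one_le_tIndex h1 hβ
        refine ⟨h4, ?_, ?_⟩
        · rw [← tLevel_le_levelCap_iff, tLevel_tIndex h1 hβ, tRoot_tIndex h1 hβ]
          exact h2
        · rw [tRefl_apply h4, tLevel_tIndex h1 hβ, tRoot_tIndex h1 hβ]
          exact h3
      rintro (⟨j, ⟨h1, h2, h3⟩, rfl⟩ | ⟨j, ⟨h1, h2, h3⟩, rfl⟩)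
      · exact aux .a12 j (by simp) h1 h2 h3
      · exact aux .a2 j (by simp) h1 h2 h3
  rw [nonSwapCount, hset, Set.ncard_coe_finset, Finset.card_union_of_disjoint,
    Finset.card_image_of_injOn, Finset.card_image_of_injOn]
  · intro a _ b _ hab
    simp only [tIndex] at hab
    omega
  · intro a ha b hb hab
    have := ((m1 a).1 ha).1
    have := ((m1 b).1 hb).1
    simp only [tIndex] at hab
    omega
  · rw [Finset.disjoint_left]
    intro k hk hk'
    simp only [Finset.mem_image, m1, m2, tIndex] at hk hk'
    obtain ⟨j, _, rfl⟩ := hk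
    obtain ⟨i, _, _⟩ := hk'
    omega

/-- With `U` the hull bound and `T` the threshold, the non-swappable levels fill the interval from
`T / 2 + 1` to `min J U`. Adding the `J - min J U` levels outside the hull gives `J - T / 2`
whenever the interval is nonempty. -/
theorem excess_add_card {L n e o : ℤ} (h : OrthHull L n e o) (J : ℕ) :
    excess L n e o J + ((nonSwapLevels L n e o J).card : ℤ) = fullExcess L n e o J := by
  have hpos := doubleThreshold_pos (n := n) (e := e) h.le₂
  obtain ⟨c0, c1, c2, c3, c4, c5, c6, c7, c8⟩ := h
  rw [nonSwapLevels, Nat.card_Icc, fullExcess, excess]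
  omega

/-! ### Staircases -/

theorem isStaircase_labelled_iff {m : ℕ} {x lam : Weight} {β : PosRoot} {n len : ℕ} :
    (IsStaircase x lam β n len ∧
      ∀ i : ℕ, 1 ≤ i → i ≤ len → LabelIn m x (x - (n + i) • β.root)) ↔
    (∀ i : ℕ, 1 ≤ i → i ≤ len →
      (IsLabelledEdge (lam.1, lam.2 + i) x β (n + i) ∧
        NonSwapCond (lam.1, lam.2 + i) x (n + i - β.pairing x) β) ∧
      (n + i : ℤ) - β.pairing x ≤ levelCap m β) ∧
    (n = 0 ∨ IsLabelledEdge lam x β n ∧ ¬ NonSwapCond lam x (n - β.pairing x) β) := by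
  have c1 : ∀ i : ℕ, x - (n + i) • β.root = x - ((n : ℤ) + i) • β.root := by
    intro i; rw [← natCast_zsmul]; push_cast; rfl
  have c2 : x - n • β.root = x - (n : ℤ) • β.root := by rw [natCast_zsmul]
  simp only [IsStaircase, c1, c2, isNonSwappable_sub_iff, isSwappable_sub_iff, add_nsmul_fw2]
  constructor
  · rintro ⟨⟨h1, h2⟩, h3⟩
    refine ⟨fun i hi hi' => ⟨h1 i hi hi', ?_⟩, h2⟩
    exact ((labelIn_sub_smul_root_iff (by omega)).1 (h3 i hi hi')).2
  · rintro ⟨h1, h2⟩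
    refine ⟨⟨fun i hi hi' => (h1 i hi hi').1, h2⟩, fun i hi hi' => ?_⟩
    rw [labelIn_sub_smul_root_iff (by omega)]
    exact ⟨(h1 i hi hi').1.1.2.2.2.1, (h1 i hi hi').2⟩

/-- Along a staircase level and highest weight grow together. The facets on `e ± o` then give
conditions independent of the step `i`, while the facet on `e` and the cap `levelCap` bound the
length. -/
theorem staircase_le_stairLength {m : ℕ} {x lam : Weight} {β : PosRoot} {n len : ℕ}
    (hx : InHull lam x) (hlen : 1 ≤ len)
    (h : ∀ i : ℕ, 1 ≤ i → i ≤ len →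
      (IsLabelledEdge (lam.1, lam.2 + i) x β (n + i) ∧
        NonSwapCond (lam.1, lam.2 + i) x (n + i - β.pairing x) β) ∧
      (n + i : ℤ) - β.pairing x ≤ levelCap m β)
    (h0 : n = 0 ∨ IsLabelledEdge lam x β n ∧ ¬ NonSwapCond lam x (n - β.pairing x) β) :
    IsLong β ∧ (len : ℤ) ≤
      stairLength lam.1 lam.2 (longCoord x β).1 (longCoord x β).2 (levelCap m β) := by
  have hβ := (h 1 le_rfl hlen).1.2.isLong
  refine ⟨hβ, ?_⟩
  have h1 := h 1 le_rfl hlen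
  have h2 := h len hlen le_rfl
  have hx' := hβ.inHull_iff.1 hx
  rw [hβ.isLabelledEdge_iff, hβ.nonSwapCond_iff, hβ.pairing] at h1 h2 h0
  generalize (longCoord x β).1 = e at *
  generalize (longCoord x β).2 = o at *
  obtain ⟨⟨⟨-, -, a1, a2⟩, a3, a4, a5⟩, a6⟩ := h1
  obtain ⟨⟨⟨-, -, b1, b2⟩, b3, b4, b5⟩, b6⟩ := h2
  simp only at *
  have c0 := hx'.parity
  -- The base is swappable or a point, so its doubled level is at most the threshold; the first step
  -- is non-swappable for the weight raised by `ϖ₂`, which gives the opposite inequality. In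
  -- particular the threshold is even.
  have hT : doubleThreshold lam.1 lam.2 e o = 2 * (n - e) := by
    unfold doubleThreshold
    obtain ⟨d0, d1, d2, d3, d4, d5, d6, d7, d8⟩ := a2
    clear b2 b3 b4 b5 hx' h
    rcases h0 with h0 | ⟨_, h0⟩
    · omega
    · omega
  rw [stairLength, hT]
  obtain ⟨d0, d1, d2, d3, d4, d5, d6, d7, d8⟩ := a2
  obtain ⟨f0, f1, f2, f3, f4, f5, f6, f7, f8⟩ := b2
  rw [if_pos (by omega)]
  omega

theorem exists_staircase {m : ℕ} {x lam : Weight} {β : PosRoot} (hβ : IsLong β) {len : ℕ}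
    (hl : Dominant lam) (hx : InHull lam x) (hlen : 1 ≤ len)
    (h : (len : ℤ) =
      stairLength lam.1 lam.2 (longCoord x β).1 (longCoord x β).2 (levelCap m β)) :
    ∃ n : ℕ, (∀ i : ℕ, 1 ≤ i → i ≤ len →
      (IsLabelledEdge (lam.1, lam.2 + i) x β (n + i) ∧
        NonSwapCond (lam.1, lam.2 + i) x (n + i - β.pairing x) β) ∧
      (n + i : ℤ) - β.pairing x ≤ levelCap m β) ∧
    (n = 0 ∨ IsLabelledEdge lam x β n ∧ ¬ NonSwapCond lam x (n - β.pairing x) β) := by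
  have hx' := hβ.inHull_iff.1 hx
  simp only [hβ.isLabelledEdge_iff, hβ.nonSwapCond_iff, hβ.pairing]
  generalize (longCoord x β).1 = e at *
  generalize (longCoord x β).2 = o at *
  obtain ⟨hl1, hl2⟩ := hl
  have hpos := doubleThreshold_pos (n := lam.2) (e := e) hx'.le₂
  rw [stairLength] at h
  split_ifs at h with hc
  · obtain ⟨g, hg⟩ : ∃ g, doubleThreshold lam.1 lam.2 e o = 2 * g :=
      ⟨doubleThreshold lam.1 lam.2 e o / 2, by omega⟩
    have hh : lam.2 + 1 - e ≤ 2 * g ∧ lam.2 + lam.1 + 1 - o ≤ 2 * g ∧ lam.1 - e - o ≤ 2 * g ∧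
        -2 * e ≤ 2 * g ∧ (lam.2 + 1 - e = 2 * g ∨ lam.2 + lam.1 + 1 - o = 2 * g ∨
          lam.1 - e - o = 2 * g ∨ -2 * e = 2 * g) := by
      unfold doubleThreshold at hg; omega
    rw [hg] at h hc hpos
    rw [show 2 * g / 2 = g by omega] at h
    obtain ⟨a1, a2, a3, a4, a5⟩ := hh
    -- The base has level `g`, half the threshold, hence length `g + e`; this is zero exactly when
    -- the base is a point.
    obtain ⟨n, hn⟩ := Int.eq_ofNat_of_zero_le (show 0 ≤ g + e by omega)
    obtain ⟨c0, c1, c2, c3, c4, c5, c6, c7, c8⟩ := hx'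
    have hlen' : len ≤ lam.1 + lam.2 - e - g - g ∧ len + g ≤ levelCap m β := by omega
    clear h hg
    refine ⟨n, fun i hi hi' => ⟨⟨⟨⟨hl1, ?_⟩, ?_, ?_, ?_⟩, ?_⟩, ?_⟩, ?_⟩
    · simp only; omega
    · omega
    · omega
    · constructor <;> omega
    · omega
    · omega
    · by_cases hn0 : n = 0
      · exact Or.inl hn0
      · refine Or.inr ⟨⟨⟨hl1, hl2⟩, by omega, by omega, ?_⟩, by omega⟩
        constructor <;> omega
  · omega

theorem staircaseMax_eq {m : ℕ} {x lam : Weight} (hl : Dominant lam) (hx : InHull lam x) :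
    (staircaseMax m x lam : ℤ) =
      max (stairLength lam.1 lam.2 (x.1 + x.2) x.2 (levelCap m .a12))
        (stairLength lam.1 lam.2 x.2 (x.1 + x.2) (levelCap m .a2)) := by
  obtain ⟨D, hD⟩ := Int.eq_ofNat_of_zero_le (le_max_of_le_left stairLength_nonneg :
    0 ≤ max (stairLength lam.1 lam.2 (x.1 + x.2) x.2 (levelCap m .a12))
        (stairLength lam.1 lam.2 x.2 (x.1 + x.2) (levelCap m .a2)))
  rw [hD, staircaseMax]
  norm_cast
  simp only [isStaircase_labelled_iff]
  apply IsGreatest.csSup_eq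
  constructor
  · rcases Nat.eq_zero_or_pos D with rfl | hpos
    -- The empty staircase, for which any root serves, shows that the value `0` is attained.
    · exact ⟨.a1, 0, fun i hi hi' => by omega, Or.inl rfl⟩
    · rcases max_choice (stairLength lam.1 lam.2 (x.1 + x.2) x.2 (levelCap m .a12))
        (stairLength lam.1 lam.2 x.2 (x.1 + x.2) (levelCap m .a2)) with h | h
      · exact ⟨.a12, exists_staircase (Or.inl rfl) hl hx hpos (hD.symm.trans h)⟩
      · exact ⟨.a2, exists_staircase (Or.inr rfl) hl hx hpos (hD.symm.trans h)⟩
  · rintro len ⟨β, n, h1, h2⟩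
    rcases Nat.eq_zero_or_pos len with rfl | hpos
    · exact Nat.zero_le _
    · obtain ⟨hβ, h3⟩ := staircase_le_stairLength hx hpos h1 h2
      zify
      rw [← hD]
      rcases hβ with rfl | rfl
      · exact le_max_of_le_left h3
      · exact le_max_of_le_right h3

/-! ### The closed form of `σ_m` -/

/-- The statistic `σ_m - 2p` on the element of weight `x` in the atom of highest weight
`z - a ϖ₂`. -/
noncomputable def atomStat (m : ℕ) (x z : Weight) (a : ℕ) : ℤ :=
  (ellTw m x (z - a • fw2) : ℤ) - (nonSwapCount m x (z - a • fw2) : ℤ) +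
    (staircaseTrunc m x z a : ℤ) + (a : ℤ)

/-- `excess_add_card` merges `𝒩_m` with the long truncations into `fullExcess`; the staircase term
and `a` make up the rest of `defect`. -/
theorem atomStat_eq {m : ℕ} {x z : Weight} {a : ℕ} (hl : Dominant (z - a • fw2))
    (hx : InHull (z - a • fw2) x) :
    atomStat m x z a = twistedLength m x - defect z.1 (z.2 - a) (x.1 + x.2) x.2
      (levelCap m .a21) (levelCap m .a12) (levelCap m .a2) a := by
  have hx' := inHull_iff_orthHull.1 hx
  have h1 := ellTw_eq_sub (m := m) hl hx
  have h2 := nonSwapCount_eq (m := m) hl hx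
  have h3 := staircaseMax_eq (m := m) hl hx
  have h4 := excess_add_card hx' (levelCap m .a12)
  have h5 := excess_add_card hx'.swap (levelCap m .a2)
  rw [sub_nsmul_fw2] at *
  simp only at *
  rw [atomStat, staircaseTrunc, defect, ← h4, ← h5, sub_nsmul_fw2, h1, h2, Nat.cast_min, h3]
  push_cast
  ring

/-! ### The crystal reflection -/

/-- The strings of the elements of `ℬ(lam)` for the reduced word `s₁ s₂ s₁ s₂`. -/
structure IsString12 (lam : Weight) (T : AString) : Prop where
  a_nonneg : 0 ≤ T.a
  d_nonneg : 0 ≤ T.d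
  d_le : 2 * T.d ≤ T.c
  c_le : T.c ≤ 2 * T.b
  d_le' : T.d ≤ lam.2
  c_le' : T.c ≤ lam.1 + 2 * T.d
  b_le' : T.b ≤ lam.2 - 2 * T.d + T.c
  a_le' : T.a ≤ lam.1 + 2 * T.d - 2 * T.c + 2 * T.b

theorem isString12_theta21 {lam : Weight} {T : AString} (h : T ∈ crystal lam) :
    IsString12 lam (theta21 T) := by
  obtain ⟨h1, h2, h3, h4, h5, h6, h7, h8⟩ := h
  constructor <;> simp only [theta21] <;> omega

theorem theta12_mem_crystal {lam : Weight} {T : AString} (h : IsString12 lam T) :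
    theta12 T ∈ crystal lam := by
  obtain ⟨h1, h2, h3, h4, h5, h6, h7, h8⟩ := h
  refine ⟨?_, ?_, ?_, ?_, ?_, ?_, ?_, ?_⟩ <;> simp only [theta12] <;> omega

theorem theta12_theta21 {T : AString} (h2 : 0 ≤ T.d) (h3 : T.d ≤ T.c)
    (h4 : T.c ≤ T.b) : theta12 (theta21 T) = T := by
  ext <;> simp only [theta12, theta21] <;> omega

theorem theta21_theta12 {T : AString} (h2 : 0 ≤ T.d) (h3 : 2 * T.d ≤ T.c)
    (h4 : T.c ≤ 2 * T.b) : theta21 (theta12 T) = T := by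
  ext <;> simp only [theta12, theta21] <;> omega

theorem theta21_sum (T : AString) :
    (theta21 T).a + (theta21 T).c = T.b + T.d ∧ (theta21 T).b + (theta21 T).d = T.a + T.c := by
  simp only [theta21]; omega

theorem theta12_sum (T : AString) :
    (theta12 T).a + (theta12 T).c = T.b + T.d ∧ (theta12 T).b + (theta12 T).d = T.a + T.c := by
  simp only [theta12]; omega

theorem wt_fst (lam : Weight) (T : AString) :
    (wt lam T).1 = lam.1 + 2 * (T.a + T.c) - 2 * (T.b + T.d) := by
  simp [wt, PosRoot.root]; ring

theorem wt_snd (lam : Weight) (T : AString) :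
    (wt lam T).2 = lam.2 - 2 * (T.a + T.c) + (T.b + T.d) := by
  simp [wt, PosRoot.root]; ring

/-- `φ₁` is the upper bound for the first entry in `IsString12` minus that entry. Thus `s₁` reflects
the first entry in its interval, preserving the string polytope and squaring to the identity. -/
theorem phi1_eq (lam : Weight) (T : AString) :
    phi1 lam T = lam.1 + 2 * (theta21 T).d - 2 * (theta21 T).c + 2 * (theta21 T).b -
      (theta21 T).a := by
  obtain ⟨h1, h2⟩ := theta21_sum T
  rw [phi1, eps1, PosRoot.pairing, wt_fst]
  linarith

theorem isString12_reflect {lam : Weight} {T : AString} (h : T ∈ crystal lam) :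
    IsString12 lam { theta21 T with a := phi1 lam T } := by
  have h' := isString12_theta21 h
  have := phi1_eq lam T
  obtain ⟨h1, h2, h3, h4, h5, h6, h7, h8⟩ := h'
  constructor <;> simp only <;> omega

theorem theta21_crystalS1 {lam : Weight} {T : AString} (h : T ∈ crystal lam) :
    theta21 (crystalS1 lam T) = { theta21 T with a := phi1 lam T } := by
  have h' := isString12_reflect h
  exact theta21_theta12 h'.d_nonneg h'.d_le h'.c_le

theorem crystalS1_mem {lam : Weight} {T : AString} (h : T ∈ crystal lam) :
    crystalS1 lam T ∈ crystal lam :=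
  theta12_mem_crystal (isString12_reflect h)

theorem crystalS1_crystalS1 {lam : Weight} {T : AString} (h : T ∈ crystal lam) :
    crystalS1 lam (crystalS1 lam T) = T := by
  have h1 := theta21_crystalS1 h
  have h2 := phi1_eq lam T
  have h3 := phi1_eq lam (crystalS1 lam T)
  rw [h1] at h3
  simp only at h3
  rw [crystalS1, h1, show phi1 lam (crystalS1 lam T) = (theta21 T).a by omega]
  exact theta12_theta21 h.2.1 h.2.2.1 h.2.2.2.1

theorem wt_crystalS1_fst {lam : Weight} {T : AString} :
    (wt lam (crystalS1 lam T)).1 = -(wt lam T).1 := by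
  obtain ⟨h1, h2⟩ := theta21_sum T
  obtain ⟨h3, h4⟩ := theta12_sum { theta21 T with a := phi1 lam T }
  have h5 := phi1_eq lam T
  rw [wt_fst, wt_fst, crystalS1]
  simp only at h3 h4
  linarith

theorem wt_crystalS1_snd {lam : Weight} {T : AString} :
    (wt lam (crystalS1 lam T)).2 = (wt lam T).1 + (wt lam T).2 := by
  obtain ⟨h1, h2⟩ := theta21_sum T
  obtain ⟨h3, h4⟩ := theta12_sum { theta21 T with a := phi1 lam T }
  have h5 := phi1_eq lam T
  rw [wt_snd, wt_snd, wt_fst, crystalS1]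
  simp only at h3 h4
  linarith

theorem crystalS1_eq_self {lam : Weight} {T : AString} (h : T ∈ crystal lam)
    (h0 : (wt lam T).1 = 0) : crystalS1 lam T = T := by
  have h1 : phi1 lam T = (theta21 T).a := by
    rw [phi1, eps1, PosRoot.pairing, h0, add_zero]
  rw [crystalS1, h1]
  exact theta12_theta21 h.2.1 h.2.2.1 h.2.2.2.1

theorem theta21_Phi (T : AString) : theta21 (Phi T) =
    ⟨(theta21 T).a + 1, (theta21 T).b + 1, (theta21 T).c + 1, (theta21 T).d⟩ := by
  ext <;> simp only [theta21, Phi] <;> omega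

theorem theta12_add (T : AString) :
    theta12 ⟨T.a + 1, T.b + 1, T.c + 1, T.d⟩ = Phi (theta12 T) := by
  ext <;> simp only [theta12, Phi] <;> omega

/-- In both parametrizations `Φ` is a translation. For `s₁ s₂ s₁ s₂` it raises the first entry by
one and its upper bound by two, so the reflected entry also rises by one. -/
theorem crystalS1_Phi (L n : ℤ) (T : AString) :
    crystalS1 (L, n) (Phi T) = Phi (crystalS1 (L - 2, n) T) := by
  rw [crystalS1, crystalS1, phi1_eq, phi1_eq, theta21_Phi, ← theta12_add]
  congr 1
  ext <;> simp only
  ring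

theorem Phi_injective : Function.Injective Phi := by
  intro S T h
  simp only [Phi, AString.mk.injEq] at h
  ext <;> omega

theorem Phi_mem_crystal {L n : ℤ} {T : AString} (h : T ∈ crystal (L - 2, n)) :
    Phi T ∈ crystal (L, n) := by
  obtain ⟨h1, h2, h3, h4, h5, h6, h7, h8⟩ := h
  simp only at h5 h6 h7 h8
  refine ⟨?_, ?_, ?_, ?_, ?_, ?_, ?_, ?_⟩ <;> simp only [Phi] <;> omega

theorem wt_Phi (L n : ℤ) (T : AString) : wt (L, n) (Phi T) = wt (L - 2, n) T := by
  ext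
  · rw [wt_fst, wt_fst]; simp only [Phi]; ring
  · rw [wt_snd, wt_snd]; simp only [Phi]; ring

theorem sub_nsmul_fw1 (lam : Weight) (j : ℕ) : lam - j • fw1 = (lam.1 - j, lam.2) := by
  ext <;> simp [fw1]

theorem mem_preatom_iff' {L n : ℤ} {T : AString} : T ∈ preatom (L, n) ↔
    T ∈ crystal (L, n) ∧ ¬ (2 ≤ L ∧ ∃ U ∈ crystal (L - 2, n), T = Phi U) := by
  rw [preatom, sub_nsmul_fw1]
  split_ifs with h
  · simp only at h
    simp only [Set.mem_sdiff, Set.mem_image, h, true_and, eq_comm (a := T)]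
    rfl
  · simp only at h
    simp only [h, false_and, not_false_eq_true, and_true]

/-- The principal preatom consists of the strings for which one of three inequalities is sharp. -/
theorem mem_preatom_iff {L n : ℤ} {T : AString} : T ∈ preatom (L, n) ↔
    T ∈ crystal (L, n) ∧ (T.d = 0 ∨ T.d = L ∨ T.b = L - 2 * T.d + 2 * T.c) := by
  rw [mem_preatom_iff']
  refine and_congr_right fun h => ?_
  obtain ⟨h1, h2, h3, h4, h5, h6, h7, h8⟩ := h
  simp only at h5 h6 h7 h8
  constructor
  · intro h
    by_contra hc
    refine h ⟨by omega, ⟨T.a, T.b - 1, T.c - 1, T.d - 1⟩, ?_, ?_⟩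
    · refine ⟨?_, ?_, ?_, ?_, ?_, ?_, ?_, ?_⟩ <;> simp only <;> omega
    · ext <;> simp [Phi]
  · rintro h ⟨_, U, hU, rfl⟩
    obtain ⟨g1, g2, g3, g4, g5, g6, g7, g8⟩ := hU
    simp only [Phi] at *
    omega

theorem preatom_subset {L n : ℤ} {T : AString} (h : T ∈ preatom (L, n)) : T ∈ crystal (L, n) :=
  (mem_preatom_iff.1 h).1

theorem crystalS1_mem_preatom {L n : ℤ} {T : AString} (h : T ∈ preatom (L, n)) :
    crystalS1 (L, n) T ∈ preatom (L, n) := by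
  rw [mem_preatom_iff'] at h ⊢
  refine ⟨crystalS1_mem h.1, ?_⟩
  rintro ⟨hL, U, hU, hT⟩
  refine h.2 ⟨hL, crystalS1 (L - 2, n) U, crystalS1_mem hU, ?_⟩
  rw [← crystalS1_Phi, ← hT, crystalS1_crystalS1 h.1]

/-! ### The maps `Ψ` and `Ψ̄` -/

theorem Psi_mem {L n : ℤ} {T : AString} (h : T ∈ preatom (L, n)) :
    Psi (L, n) T ∈ preatom (L, n + 1) := by
  rw [mem_preatom_iff] at h ⊢
  obtain ⟨⟨h1, h2, h3, h4, h5, h6, h7, h8⟩, h9⟩ := h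
  simp only at h5 h6 h7 h8
  rw [Psi]
  simp only
  split_ifs with hd
  · refine ⟨⟨?_, ?_, ?_, ?_, ?_, ?_, ?_, ?_⟩, ?_⟩ <;> simp only <;> omega
  · refine ⟨⟨?_, ?_, ?_, ?_, ?_, ?_, ?_, ?_⟩, ?_⟩ <;> simp only <;> omega

theorem wt_Psi (L n : ℤ) (T : AString) : wt (L, n + 1) (Psi (L, n) T) = wt (L, n) T := by
  rw [Psi]
  ext
  · rw [wt_fst, wt_fst]; split_ifs <;> simp only <;> ring
  · rw [wt_snd, wt_snd]; split_ifs <;> simp only <;> ring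

theorem Psi_injOn (L n : ℤ) : Set.InjOn (Psi (L, n)) (preatom (L, n)) := by
  intro S hS T hT h
  rw [mem_preatom_iff] at hS hT
  obtain ⟨⟨h1, h2, h3, h4, h5, h6, h7, h8⟩, h9⟩ := hS
  obtain ⟨⟨g1, g2, g3, g4, g5, g6, g7, g8⟩, g9⟩ := hT
  simp only at h5 h6 h7 h8 g5 g6 g7 g8
  simp only [Psi] at h
  split_ifs at h <;> simp only [AString.mk.injEq] at h <;> ext <;> omega

theorem add_fw2 (L n : ℤ) : ((L, n) : Weight) + fw2 = (L, n + 1) := by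
  ext <;> simp [fw2]

theorem PsiBar_mem {L n : ℤ} {T : AString} (h : T ∈ preatom (L, n)) :
    PsiBar (L, n) T ∈ preatom (L, n + 1) := by
  rw [PsiBar, add_fw2]
  split_ifs
  · exact Psi_mem h
  · exact crystalS1_mem_preatom (Psi_mem (crystalS1_mem_preatom h))

theorem wt_PsiBar (L n : ℤ) (T : AString) : wt (L, n + 1) (PsiBar (L, n) T) = wt (L, n) T := by
  rw [PsiBar, add_fw2]
  split_ifs
  · exact wt_Psi L n T
  · have h1 := wt_crystalS1_fst (lam := (L, n)) (T := T)
    have h2 := wt_crystalS1_snd (lam := (L, n)) (T := T)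
    ext
    · rw [wt_crystalS1_fst, wt_Psi, h1, neg_neg]
    · rw [wt_crystalS1_snd, wt_Psi, h1, h2]; ring

/-- `Ψ̄` preserves weights, so elements with the same image are treated by the same branch of its
definition. -/
theorem PsiBar_injOn (L n : ℤ) : Set.InjOn (PsiBar (L, n)) (preatom (L, n)) := by
  intro S hS T hT h
  have hw : wt (L, n) S = wt (L, n) T := by rw [← wt_PsiBar, h, wt_PsiBar]
  rw [PsiBar, PsiBar, hw, add_fw2] at h
  split_ifs at h
  · exact Psi_injOn L n hS hT h
  · have h1 := congrArg (crystalS1 (L, n + 1)) h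
    rw [crystalS1_crystalS1 (preatom_subset (Psi_mem (crystalS1_mem_preatom hS))),
      crystalS1_crystalS1 (preatom_subset (Psi_mem (crystalS1_mem_preatom hT)))] at h1
    have h2 := Psi_injOn L n (crystalS1_mem_preatom hS) (crystalS1_mem_preatom hT) h1
    rw [← crystalS1_crystalS1 (preatom_subset hS), h2, crystalS1_crystalS1 (preatom_subset hT)]

/-- The two branches are conjugate under `s₁`; on the wall `⟨wt, α₁^∨⟩ = 0` the reflection fixes
both the element and its image. Atoms therefore inherit the `s₁`-symmetry. -/
theorem PsiBar_crystalS1 {L n : ℤ} {T : AString} (h : T ∈ preatom (L, n)) :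
    PsiBar (L, n) (crystalS1 (L, n) T) = crystalS1 (L, n + 1) (PsiBar (L, n) T) := by
  have h1 := wt_crystalS1_fst (lam := (L, n)) (T := T)
  rcases lt_trichotomy (wt (L, n) T).1 0 with h0 | h0 | h0
  · rw [PsiBar, PsiBar, if_neg (by omega), if_pos h0.le, add_fw2,
      crystalS1_crystalS1 (preatom_subset h)]
  · rw [crystalS1_eq_self (preatom_subset h) h0,
      crystalS1_eq_self (preatom_subset (PsiBar_mem h)) (by rw [wt_PsiBar, h0])]
  · rw [PsiBar, PsiBar, if_pos (by omega), if_neg (by omega), add_fw2,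
      crystalS1_crystalS1 (preatom_subset (Psi_mem (crystalS1_mem_preatom h)))]

theorem PsiBarPow_succ (L n : ℤ) (k : ℕ) (T : AString) :
    PsiBarPow (L, n) (k + 1) T = PsiBar (L, n + k) (PsiBarPow (L, n) k T) := by
  rw [PsiBarPow, add_nsmul_fw2]

theorem PsiBarPow_mem {L n : ℤ} {T : AString} (h : T ∈ preatom (L, n)) (k : ℕ) :
    PsiBarPow (L, n) k T ∈ preatom (L, n + k) := by
  induction k with
  | zero => simpa [PsiBarPow] using h
  | succ k ih =>
    rw [PsiBarPow_succ]
    have := PsiBar_mem ih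
    rw [add_assoc] at this
    exact_mod_cast this

theorem wt_PsiBarPow (L n : ℤ) (T : AString) (k : ℕ) :
    wt (L, n + k) (PsiBarPow (L, n) k T) = wt (L, n) T := by
  induction k with
  | zero => simp [PsiBarPow]
  | succ k ih =>
    rw [PsiBarPow_succ]
    push_cast
    rw [← add_assoc, wt_PsiBar, ih]

theorem PsiBarPow_injOn (L n : ℤ) (k : ℕ) : Set.InjOn (PsiBarPow (L, n) k) (preatom (L, n)) := by
  induction k with
  | zero => intro S _ T _ h; exact h
  | succ k ih =>
    intro S hS T hT h
    rw [PsiBarPow_succ, PsiBarPow_succ] at h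
    exact ih hS hT (PsiBar_injOn _ _ (PsiBarPow_mem hS k) (PsiBarPow_mem hT k) h)

theorem PsiBarPow_add (L n : ℤ) (j k : ℕ) (T : AString) :
    PsiBarPow (L, n) (j + k) T = PsiBarPow (L, n + j) k (PsiBarPow (L, n) j T) := by
  induction k with
  | zero => rfl
  | succ k ih =>
    rw [← add_assoc, PsiBarPow_succ, PsiBarPow_succ, ih]
    push_cast
    rw [add_assoc]

theorem PsiBarPow_crystalS1 {L n : ℤ} {T : AString} (h : T ∈ preatom (L, n)) (k : ℕ) :
    PsiBarPow (L, n) k (crystalS1 (L, n) T) = crystalS1 (L, n + k) (PsiBarPow (L, n) k T) := by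
  induction k with
  | zero => simp [PsiBarPow]
  | succ k ih =>
    rw [PsiBarPow_succ, PsiBarPow_succ, ih, PsiBar_crystalS1 (PsiBarPow_mem h k)]
    push_cast
    rw [add_assoc]

/-! ### Atoms -/

theorem one_le_atomStep (lam : Weight) : 1 ≤ atomStep lam := by
  unfold atomStep; split_ifs <;> omega

theorem atomStep_mk (L n n' : ℤ) : atomStep (L, n) = atomStep (L, n') := rfl

theorem mem_atom_iff {L n : ℤ} {T : AString} : T ∈ atom (L, n) ↔
    T ∈ preatom (L, n) ∧ ¬ ((atomStep (L, n) : ℤ) ≤ n ∧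
      ∃ U ∈ preatom (L, n - atomStep (L, n)),
        T = PsiBarPow (L, n - atomStep (L, n)) (atomStep (L, n)) U) := by
  rw [atom, sub_nsmul_fw2]
  split_ifs with h
  · simp only at h
    simp only [Set.mem_sdiff, Set.mem_image, h, true_and, eq_comm (a := T)]
  · simp only at h
    simp only [h, false_and, not_false_eq_true, and_true]

theorem crystalS1_mem_atom {L n : ℤ} {T : AString} (h : T ∈ atom (L, n)) :
    crystalS1 (L, n) T ∈ atom (L, n) := by
  rw [mem_atom_iff] at h ⊢
  refine ⟨crystalS1_mem_preatom h.1, ?_⟩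
  rintro ⟨h1, U, hU, hT⟩
  refine h.2 ⟨h1, _, crystalS1_mem_preatom hU, ?_⟩
  rw [PsiBarPow_crystalS1 hU, ← hT, sub_add_cancel, crystalS1_crystalS1 (preatom_subset h.1)]

/-- The part of the atom in which `Ψ̄` agrees with `Ψ`. -/
theorem mem_atom_iff_of_nonpos {L n : ℤ} (hL : 0 ≤ L) {T : AString}
    (hw : (wt (L, n) T).1 ≤ 0) : T ∈ atom (L, n) ↔ T ∈ preatom (L, n) ∧
      (1 ≤ L ∧ (T.d = 0 ∧ (T.c = 0 ∨ T.b = L + 2 * T.c) ∨ T.d = 1 ∧ T.b = L - 2 + 2 * T.c ∨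
        T.b = L - 2 * T.d + 2 * T.c ∧ T.c = n + T.d) ∨
      L = 0 ∧ (T.b = 2 * T.c ∨ T.b = 2 * T.c - 1)) := by
  rw [mem_atom_iff]
  refine and_congr_right fun hT => ?_
  rw [mem_preatom_iff] at hT
  obtain ⟨⟨h1, h2, h3, h4, h5, h6, h7, h8⟩, h9⟩ := hT
  simp only at h5 h6 h7 h8
  rcases eq_or_lt_of_le hL with rfl | hL'
  · have hs : atomStep ((0 : ℤ), n) = 2 := by simp [atomStep]
    rw [hs]
    -- For `L = 0` every string has `d = 0`, so the first branch of `Ψ` applies twice.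
    have key : ∀ U : AString, (wt (0, n - (2 : ℕ)) U).1 ≤ 0 → U.d = 0 →
        PsiBarPow (0, n - (2 : ℕ)) 2 U = ⟨U.a, U.b + 2, U.c + 2, 0⟩ := by
      intro U hU hd
      have e1 : PsiBar (0, n - (2 : ℕ)) U = ⟨U.a, U.b + 1, U.c + 1, 0⟩ := by
        rw [PsiBar, if_pos hU, Psi, if_pos (Or.inl hd), hd]
      have e2 := wt_PsiBar 0 (n - (2 : ℕ)) U
      have e3 : PsiBarPow (0, n - (2 : ℕ)) 1 U = PsiBar (0, n - (2 : ℕ)) U := by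
        rw [PsiBarPow_succ]; simp [PsiBarPow]
      rw [show (2 : ℕ) = 1 + 1 from rfl, PsiBarPow_succ, e3, e1, PsiBar, if_pos, Psi,
        if_pos (Or.inl rfl)]
      · simp only [add_assoc]; rfl
      · rw [← e1]; push_cast; push_cast at e2 hU; rw [e2]; exact hU
    constructor
    · intro h
      by_contra hc
      refine h ⟨by push_cast; omega, ⟨T.a, T.b - 2, T.c - 2, 0⟩, ?_, ?_⟩
      · rw [mem_preatom_iff]
        refine ⟨⟨?_, ?_, ?_, ?_, ?_, ?_, ?_, ?_⟩, Or.inl rfl⟩ <;> simp only <;> push_cast <;> omega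
      · rw [key]
        · ext <;> simp; omega
        · rw [wt_fst] at hw ⊢; simp only at hw ⊢; omega
        · rfl
    · rintro h ⟨g1, U, hU, hTU⟩
      have hd : U.d = 0 := by
        obtain ⟨⟨-, g2, -, -, g5, -⟩, -⟩ := mem_preatom_iff.1 hU
        simp only at g5; omega
      have hw' : (wt (0, n - (2 : ℕ)) U).1 ≤ 0 := by
        rw [← wt_PsiBarPow _ _ _ 2, ← hTU, sub_add_cancel]; exact hw
      rw [key U hw' hd] at hTU
      obtain ⟨⟨-, g2, g3, g4, g5, g6, g7, g8⟩, -⟩ := mem_preatom_iff.1 hU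
      subst hTU
      simp only at *
      omega
  · have hs : atomStep (L, n) = 1 := by simp [atomStep, hL'.ne']
    rw [hs]
    have key : ∀ U : AString, (wt (L, n - (1 : ℕ)) U).1 ≤ 0 →
        PsiBarPow (L, n - (1 : ℕ)) 1 U = Psi (L, n - (1 : ℕ)) U := by
      intro U hU
      have e3 : PsiBarPow (L, n - (1 : ℕ)) 1 U = PsiBar (L, n - (1 : ℕ)) U := by
        rw [PsiBarPow_succ]; simp [PsiBarPow]
      rw [e3, PsiBar, if_pos hU]
    constructor
    · intro h
      by_contra hc
      -- This decides which branch of `Ψ` produced `T`. When `d = L` and the bound on `b` is sharp,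
      -- lowering `b` and `c` would violate that bound, so `c` and `d` are lowered instead.
      by_cases hd : T.d = 0 ∨ T.d = L ∧ T.b ≠ 2 * T.c - L
      · refine h ⟨by push_cast; omega, ⟨T.a, T.b - 1, T.c - 1, T.d⟩, ?_, ?_⟩
        · rw [mem_preatom_iff]
          refine ⟨⟨?_, ?_, ?_, ?_, ?_, ?_, ?_, ?_⟩, ?_⟩ <;> simp only <;> push_cast <;> omega
        · rw [key, Psi, if_pos]
          · simp
          · simp only; omega
          · rw [wt_fst] at hw ⊢; simp only at hw ⊢; omega
      · refine h ⟨by push_cast; omega, ⟨T.a, T.b, T.c - 1, T.d - 1⟩, ?_, ?_⟩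
        · rw [mem_preatom_iff]
          refine ⟨⟨?_, ?_, ?_, ?_, ?_, ?_, ?_, ?_⟩, ?_⟩ <;> simp only <;> push_cast <;> omega
        · rw [key, Psi, if_neg]
          · simp
          · simp only; omega
          · rw [wt_fst] at hw ⊢; simp only at hw ⊢; omega
    · rintro h ⟨g1, U, hU, hTU⟩
      have hw' : (wt (L, n - (1 : ℕ)) U).1 ≤ 0 := by
        rw [← wt_PsiBarPow _ _ _ 1, ← hTU, sub_add_cancel]; exact hw
      rw [key U hw'] at hTU
      obtain ⟨⟨-, g2, g3, g4, g5, g6, g7, g8⟩, g9⟩ := mem_preatom_iff.1 hU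
      rw [Psi] at hTU
      subst hTU
      split_ifs at * <;> simp only at * <;> push_cast at * <;> omega

theorem inHull_wt {lam : Weight} {T : AString} (h : T ∈ crystal lam) : InHull lam (wt lam T) := by
  obtain ⟨h1, h2, h3, h4, h5, h6, h7, h8⟩ := h
  have g1 := wt_fst lam T
  have g2 := wt_snd lam T
  constructor <;> omega

theorem exists_mem_atom_of_nonpos {L n : ℤ} (hL : 0 ≤ L) (hn : 0 ≤ n) {x : Weight}
    (hx : InHull (L, n) x) (h0 : x.1 ≤ 0) : ∃ T ∈ atom (L, n), wt (L, n) T = x := by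
  suffices h : ∃ T : AString, wt (L, n) T = x ∧ T ∈ preatom (L, n) ∧
      (1 ≤ L ∧ (T.d = 0 ∧ (T.c = 0 ∨ T.b = L + 2 * T.c) ∨ T.d = 1 ∧ T.b = L - 2 + 2 * T.c ∨
        T.b = L - 2 * T.d + 2 * T.c ∧ T.c = n + T.d) ∨
      L = 0 ∧ (T.b = 2 * T.c ∨ T.b = 2 * T.c - 1)) by
    obtain ⟨T, rfl, h⟩ := h
    exact ⟨T, (mem_atom_iff_of_nonpos hL h0).2 h, rfl⟩
  obtain ⟨hp, h1, h2, h3, h4, h5, h6, h7, h8⟩ := hx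
  simp only at hp h1 h2 h3 h4 h5 h6 h7 h8
  obtain ⟨x1, x2⟩ := x
  simp only at *
  -- Here `(L, n) - x = u α₁ + v α₂`, so the string must satisfy `b + d = u` and `a + c = v`. The
  -- families of the atom correspond to consecutive ranges of `u`.
  obtain ⟨u, hu⟩ : ∃ u, u = L + n - x1 - x2 := ⟨_, rfl⟩
  obtain ⟨v, hv⟩ : ∃ v, 2 * v = n + u - x2 := ⟨(n + u - x2) / 2, by omega⟩
  have e1 : x1 = L + 2 * v - 2 * u := by omega
  have e2 : x2 = n - 2 * v + u := by omega
  have main : ∀ a b c d : ℤ, b + d = u → a + c = v →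
      (0 ≤ a ∧ 0 ≤ d ∧ d ≤ c ∧ c ≤ b ∧ d ≤ L ∧ c ≤ n + d ∧ b ≤ L - 2 * d + 2 * c ∧
        a ≤ n + d - 2 * c + b) →
      (d = 0 ∨ d = L ∨ b = L - 2 * d + 2 * c) →
      (1 ≤ L ∧ (d = 0 ∧ (c = 0 ∨ b = L + 2 * c) ∨ d = 1 ∧ b = L - 2 + 2 * c ∨
        b = L - 2 * d + 2 * c ∧ c = n + d) ∨ L = 0 ∧ (b = 2 * c ∨ b = 2 * c - 1)) →
      ∃ T : AString, wt (L, n) T = (x1, x2) ∧ T ∈ preatom (L, n) ∧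
      (1 ≤ L ∧ (T.d = 0 ∧ (T.c = 0 ∨ T.b = L + 2 * T.c) ∨ T.d = 1 ∧ T.b = L - 2 + 2 * T.c ∨
        T.b = L - 2 * T.d + 2 * T.c ∧ T.c = n + T.d) ∨
      L = 0 ∧ (T.b = 2 * T.c ∨ T.b = 2 * T.c - 1)) := by
    intro a b c d hb ha hc hd he
    refine ⟨⟨a, b, c, d⟩, ?_, mem_preatom_iff.2 ⟨hc, hd⟩, he⟩
    ext
    · rw [wt_fst]; simp only; omega
    · rw [wt_snd]; simp only; omega
  clear hu hv
  subst e1 e2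
  rcases eq_or_lt_of_le hL with rfl | hL'
  · obtain ⟨c, hc⟩ : ∃ c, u = 2 * c ∨ u = 2 * c - 1 := ⟨(u + 1) / 2, by omega⟩
    exact main (v - c) u c 0 (by omega) (by omega) (by omega) (by omega) (by omega)
  · by_cases c1 : u ≤ L
    · exact main v u 0 0 (by omega) (by omega) (by omega) (by omega) (by omega)
    by_cases c2 : L + 2 * n + 2 ≤ u
    · exact main (v - (u - L - n)) (L + 2 * n) (u - L - n) (u - L - 2 * n)
        (by omega) (by omega) (by omega) (by omega) (by omega)
    obtain ⟨c, hc⟩ : ∃ c, u - L = 2 * c ∨ u - L = 2 * c - 1 := ⟨(u - L + 1) / 2, by omega⟩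
    rcases hc with hc | hc
    · exact main (v - c) u c 0 (by omega) (by omega) (by omega) (by omega) (by omega)
    · exact main (v - c) (u - 1) c 1 (by omega) (by omega) (by omega) (by omega) (by omega)

/-- The weight fixes `b + d` and `a + c`, and within the families describing the atom the value of
`b + d` already determines `c` and `d`. -/
theorem atom_unique_of_nonpos {L n : ℤ} (hL : 0 ≤ L) {S T : AString}
    (hS : S ∈ atom (L, n)) (hT : T ∈ atom (L, n)) (hST : wt (L, n) S = wt (L, n) T)
    (h0 : (wt (L, n) T).1 ≤ 0) : S = T := by
  rw [mem_atom_iff_of_nonpos hL (hST ▸ h0), mem_preatom_iff] at hS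
  rw [mem_atom_iff_of_nonpos hL h0, mem_preatom_iff] at hT
  have e1 := congrArg Prod.fst hST
  have e2 := congrArg Prod.snd hST
  rw [wt_fst, wt_fst] at e1
  rw [wt_snd, wt_snd] at e2
  obtain ⟨⟨⟨h1, h2, h3, h4, h5, h6, h7, h8⟩, -⟩, h9⟩ := hS
  obtain ⟨⟨⟨g1, g2, g3, g4, g5, g6, g7, g8⟩, -⟩, g9⟩ := hT
  obtain ⟨a, b, c, d⟩ := S
  obtain ⟨a', b', c', d'⟩ := T
  simp only at *
  have e3 : b + d = b' + d' := by omega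
  have e4 : a + c = a' + c' := by omega
  clear e1 e2 hST h0
  have : d = d' ∧ c = c' := by omega
  ext <;> simp only <;> omega

/-- Every vertex of the Bruhat graph is the weight of exactly one element of the atom. -/
theorem existsUnique_mem_atom {L n : ℤ} (hL : 0 ≤ L) (hn : 0 ≤ n) {x : Weight}
    (hx : InHull (L, n) x) : ∃! T, T ∈ atom (L, n) ∧ wt (L, n) T = x := by
  have sub : ∀ {T}, T ∈ atom (L, n) → T ∈ crystal (L, n) := fun h =>
    preatom_subset (mem_atom_iff.1 h).1
  rcases le_or_gt x.1 0 with h0 | h0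
  · obtain ⟨T, hT, rfl⟩ := exists_mem_atom_of_nonpos hL hn hx h0
    exact ⟨T, ⟨hT, rfl⟩, fun S hS => atom_unique_of_nonpos hL hS.1 hT hS.2 h0⟩
  -- The remaining half follows by `s₁`, which preserves the atom and the hull.
  · have hy : InHull (L, n) (-x.1, x.1 + x.2) := by
      obtain ⟨hp, h1, h2, h3, h4, h5, h6, h7, h8⟩ := hx
      constructor <;> simp only at * <;> omega
    obtain ⟨T, hT, hTw⟩ := exists_mem_atom_of_nonpos hL hn hy (by simp only; omega)
    have w1 := congrArg Prod.fst hTw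
    have w2 := congrArg Prod.snd hTw
    simp only at w1 w2
    refine ⟨crystalS1 (L, n) T, ⟨crystalS1_mem_atom hT, ?_⟩, ?_⟩
    · ext
      · rw [wt_crystalS1_fst]; omega
      · rw [wt_crystalS1_snd]; omega
    · rintro S ⟨hS, rfl⟩
      rw [← crystalS1_crystalS1 (sub hS)]
      congr 1
      refine atom_unique_of_nonpos hL (crystalS1_mem_atom hS) hT ?_ (by omega)
      rw [hTw]
      ext
      · rw [wt_crystalS1_fst]
      · rw [wt_crystalS1_snd]

/-! ### The atomic decomposition -/

theorem exists_atom_of_mem_preatom {L : ℤ} (N : ℕ) : ∀ {T : AString},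
    T ∈ preatom (L, (N : ℤ)) → ∃ a : ℕ, a ≤ N ∧ atomStep (L, (N : ℤ)) ∣ a ∧
      ∃ U ∈ atom (L, (N : ℤ) - a), T = PsiBarPow (L, (N : ℤ) - a) a U := by
  induction N using Nat.strong_induction_on with
  | _ N ih =>
    intro T hT
    by_cases h : T ∈ atom (L, (N : ℤ))
    · exact ⟨0, by omega, dvd_zero _, T, by simpa using h, by simp [PsiBarPow]⟩
    rw [mem_atom_iff, not_and_not_right] at h
    obtain ⟨h1, U, hU, rfl⟩ := h hT
    set κ := atomStep (L, (N : ℤ)) with hκ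
    have hκ1 : 1 ≤ κ := one_le_atomStep _
    have e : (N : ℤ) - κ = ((N - κ : ℕ) : ℤ) := by omega
    rw [e] at hU
    obtain ⟨a, ha, hd, V, hV, rfl⟩ := ih (N - κ) (by omega) hU
    have e' : ((N - κ : ℕ) : ℤ) - a = N - (a + κ : ℕ) := by omega
    refine ⟨a + κ, by omega, dvd_add hd dvd_rfl, V, by rwa [← e'], ?_⟩
    rw [PsiBarPow_add, e', e]
    congr 2
    push_cast
    omega

/-- If `a < b`, the difference is a positive multiple of the step. Cancelling the injective map
`Ψ̄^a` then exhibits `U` as the image of an element one step lower, which is impossible in an atom.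
-/
theorem atom_index_le {L n : ℤ} {a b : ℕ} (ha : atomStep (L, n) ∣ a) (hb : atomStep (L, n) ∣ b)
    (hbn : (b : ℤ) ≤ n) {U V : AString} (hU : U ∈ atom (L, n - a)) (hV : V ∈ atom (L, n - b))
    (h : PsiBarPow (L, n - a) a U = PsiBarPow (L, n - b) b V) : b ≤ a := by
  by_contra! hlt
  obtain ⟨k, hk⟩ : ∃ k, b = a + atomStep (L, n) * (k + 1) := by
    obtain ⟨i, rfl⟩ := ha
    obtain ⟨j, rfl⟩ := hb
    have : i < j := lt_of_mul_lt_mul_left' hlt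
    exact ⟨j - i - 1, by rw [← mul_add]; congr 1; omega⟩
  set κ := atomStep (L, n) with hκ
  have hV' := (mem_atom_iff.1 hV).1
  rw [mem_atom_iff] at hU
  refine hU.2 ⟨?_, PsiBarPow (L, n - b) (κ * k) V, ?_, ?_⟩
  · rw [atomStep_mk L _ n, ← hκ]
    have : κ * 1 ≤ κ * (k + 1) := Nat.mul_le_mul_left _ (by omega)
    omega
  · have := PsiBarPow_mem hV' (κ * k)
    rw [atomStep_mk L _ n, ← hκ]
    convert this using 2
    ext
    · rfl
    · simp only; rw [hk]; push_cast; ring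
  · rw [atomStep_mk L _ n, ← hκ]
    have e : n - (b : ℤ) + (κ * k + κ : ℕ) = n - a := by rw [hk]; push_cast; ring
    have e' : n - (b : ℤ) + (κ * k : ℕ) = n - a - κ := by rw [hk]; push_cast; ring
    rw [← e', ← PsiBarPow_add]
    refine PsiBarPow_injOn L (n - a) a hU.1 ?_ ?_
    · have := PsiBarPow_mem hV' (κ * k + κ)
      rwa [e] at this
    · rw [h, ← e, ← PsiBarPow_add]
      congr 1
      rw [hk]; ring

theorem exists_preatom_of_mem_crystal {n : ℤ} (N : ℕ) : ∀ {T : AString},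
    T ∈ crystal ((N : ℤ), n) → ∃ p : ℕ, 2 * p ≤ N ∧
      ∃ U ∈ preatom ((N : ℤ) - 2 * p, n), T = Phi^[p] U := by
  induction N using Nat.strong_induction_on with
  | _ N ih =>
    intro T hT
    by_cases h : T ∈ preatom ((N : ℤ), n)
    · exact ⟨0, by omega, T, by simpa using h, rfl⟩
    rw [mem_preatom_iff', not_and_not_right] at h
    obtain ⟨h1, U, hU, rfl⟩ := h hT
    have e : (N : ℤ) - 2 = ((N - 2 : ℕ) : ℤ) := by omega
    rw [e] at hU
    obtain ⟨p, hp, V, hV, rfl⟩ := ih (N - 2) (by omega) hU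
    have e' : ((N - 2 : ℕ) : ℤ) - 2 * p = N - 2 * (p + 1 : ℕ) := by omega
    exact ⟨p + 1, by omega, V, by rwa [← e'], by rw [Function.iterate_succ_apply']⟩

theorem iterate_Phi_mem {L n : ℤ} {U : AString} (h : U ∈ crystal (L, n)) (p : ℕ) :
    Phi^[p] U ∈ crystal (L + 2 * p, n) := by
  induction p with
  | zero => simpa using h
  | succ p ih =>
    rw [Function.iterate_succ_apply']
    refine Phi_mem_crystal ?_
    convert ih using 2
    ext
    · push_cast; ring
    · rfl

theorem wt_iterate_Phi (L n : ℤ) (U : AString) (p : ℕ) :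
    wt (L + 2 * p, n) (Phi^[p] U) = wt (L, n) U := by
  induction p with
  | zero => simp
  | succ p ih =>
    rw [Function.iterate_succ_apply', wt_Phi, ← ih]
    congr 2
    push_cast; ring

theorem preatom_index_le {L n : ℤ} {p r : ℕ} (hr : 2 * (r : ℤ) ≤ L) {U V : AString}
    (hU : U ∈ preatom (L - 2 * p, n)) (hV : V ∈ preatom (L - 2 * r, n))
    (h : Phi^[p] U = Phi^[r] V) : r ≤ p := by
  by_contra! hlt
  obtain ⟨k, rfl⟩ : ∃ k, r = p + (k + 1) := ⟨r - p - 1, by omega⟩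
  rw [Function.iterate_add_apply] at h
  have h' := Function.Injective.iterate Phi_injective p h
  rw [Function.iterate_succ_apply'] at h'
  rw [mem_preatom_iff'] at hU
  refine hU.2 ⟨by push_cast at hr; omega, _, ?_, h'⟩
  convert iterate_Phi_mem (preatom_subset hV) k using 2
  ext
  · push_cast; ring
  · rfl

theorem mem_atomIn_iff {L n : ℤ} {p a : ℕ} {T : AString} : T ∈ atomIn (L, n) p a ↔
    2 * (p : ℤ) ≤ L ∧ (a : ℤ) ≤ n ∧ atomStep (L - 2 * p, n) ∣ a ∧
      ∃ U ∈ atom (L - 2 * p, n - a), T = Phi^[p] (PsiBarPow (L - 2 * p, n - a) a U) := by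
  simp only [atomIn, Set.mem_ofPred_eq, sub_nsmul_fw1, sub_nsmul_fw2]
  push_cast
  rfl

theorem wt_atomIn {L n : ℤ} {p a : ℕ} (U : AString) :
    wt (L, n) (Phi^[p] (PsiBarPow (L - 2 * p, n - a) a U)) = wt (L - 2 * p, n - a) U := by
  have h1 := wt_iterate_Phi (L - 2 * p) n (PsiBarPow (L - 2 * p, n - a) a U) p
  have h2 := wt_PsiBarPow (L - 2 * p) (n - a) U a
  rw [sub_add_cancel] at h1 h2
  rw [h1, h2]

theorem exists_mem_atomIn {L n : ℤ} (hL : 0 ≤ L) (hn : 0 ≤ n) {T : AString}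
    (h : T ∈ crystal (L, n)) : ∃ p a : ℕ, T ∈ atomIn (L, n) p a := by
  lift L to ℕ using hL
  lift n to ℕ using hn
  obtain ⟨p, hp, U, hU, rfl⟩ := exists_preatom_of_mem_crystal L h
  obtain ⟨a, ha, hd, V, hV, rfl⟩ := exists_atom_of_mem_preatom n hU
  exact ⟨p, a, mem_atomIn_iff.2 ⟨by omega, by omega, hd, V, hV, rfl⟩⟩

theorem atomIn_subset {L n : ℤ} {p a : ℕ} {T : AString} (h : T ∈ atomIn (L, n) p a) :
    T ∈ crystal (L, n) := by
  obtain ⟨h1, h2, h3, U, hU, rfl⟩ := mem_atomIn_iff.1 h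
  have := iterate_Phi_mem (preatom_subset (PsiBarPow_mem (mem_atom_iff.1 hU).1 a)) p
  simpa only [sub_add_cancel] using this

theorem inHull_of_mem_atomIn {L n : ℤ} {p a : ℕ} {T : AString} (h : T ∈ atomIn (L, n) p a) :
    InHull (L - 2 * p, n - a) (wt (L, n) T) := by
  obtain ⟨h1, h2, h3, U, hU, rfl⟩ := mem_atomIn_iff.1 h
  rw [wt_atomIn]
  exact inHull_wt (preatom_subset (mem_atom_iff.1 hU).1)

theorem atomIn_index_unique {L n : ℤ} {p a r b : ℕ} {T : AString} (h : T ∈ atomIn (L, n) p a)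
    (h' : T ∈ atomIn (L, n) r b) : p = r ∧ a = b := by
  obtain ⟨h1, h2, h3, U, hU, rfl⟩ := mem_atomIn_iff.1 h
  obtain ⟨g1, g2, g3, V, hV, hUV⟩ := mem_atomIn_iff.1 h'
  have hU' := PsiBarPow_mem (mem_atom_iff.1 hU).1 a
  have hV' := PsiBarPow_mem (mem_atom_iff.1 hV).1 b
  rw [sub_add_cancel] at hU' hV'
  have hp : p = r := le_antisymm (preatom_index_le h1 hV' hU' hUV.symm)
    (preatom_index_le g1 hU' hV' hUV)
  subst hp
  have e := Function.Injective.iterate Phi_injective p hUV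
  exact ⟨rfl, le_antisymm (atom_index_le g3 h3 h2 hV hU e.symm) (atom_index_le h3 g3 g2 hU hV e)⟩

theorem existsUnique_mem_atomIn {L n : ℤ} {p a : ℕ} (hp : 2 * (p : ℤ) ≤ L) (ha : (a : ℤ) ≤ n)
    (hd : atomStep (L - 2 * p, n) ∣ a) {x : Weight} (hx : InHull (L - 2 * p, n - a) x) :
    ∃! T, T ∈ atomIn (L, n) p a ∧ wt (L, n) T = x := by
  obtain ⟨U, ⟨hU, hUw⟩, hu⟩ := existsUnique_mem_atom (by omega) (by omega) hx
  refine ⟨Phi^[p] (PsiBarPow (L - 2 * p, n - a) a U),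
    ⟨mem_atomIn_iff.2 ⟨hp, ha, hd, U, hU, rfl⟩, by rw [wt_atomIn, hUw]⟩, ?_⟩
  rintro S ⟨hS, hSw⟩
  obtain ⟨-, -, -, V, hV, rfl⟩ := mem_atomIn_iff.1 hS
  rw [wt_atomIn] at hSw
  rw [hu V ⟨hV, hSw⟩]

theorem patNum_eq_and_atNum_eq {lam : Weight} {p a : ℕ} {T : AString} (h : T ∈ atomIn lam p a) :
    patNum lam T = p ∧ atNum lam T = a := by
  have h1 : patNum lam T = p := by
    rw [patNum, show {p : ℕ | ∃ a : ℕ, T ∈ atomIn lam p a} = {p} from ?_, csInf_singleton]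
    ext r
    exact ⟨fun ⟨b, hb⟩ => (atomIn_index_unique hb h).1, fun hr => ⟨a, hr ▸ h⟩⟩
  refine ⟨h1, ?_⟩
  rw [atNum, h1, show {a : ℕ | T ∈ atomIn lam p a} = {a} from ?_, csInf_singleton]
  ext b
  exact ⟨fun hb => (atomIn_index_unique hb h).2, fun hb => hb ▸ h⟩

theorem mem_atomIn_patNum_atNum {lam : Weight} (hlam : Dominant lam) {T : AString}
    (h : T ∈ crystal lam) : T ∈ atomIn lam (patNum lam T) (atNum lam T) := by
  obtain ⟨p, a, ha⟩ := exists_mem_atomIn hlam.1 hlam.2 h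
  obtain ⟨h1, h2⟩ := patNum_eq_and_atNum_eq ha
  rwa [h1, h2]

/-! ### Edges moved by their elevation. -/

/-- The elevation of the edge `x → t_{m+1} x` in the Bruhat graph of `z - aϖ₂`. -/
def reflElevation (m : ℕ) (z x : Weight) (a : ℕ) : ℕ :=
  match tRoot (m + 1) with
  | .a12 => (longElevation z.1 (z.2 - a) (x.1 + x.2) x.2 (tLevel (m + 1))).toNat
  | .a2 => (longElevation z.1 (z.2 - a) x.2 (x.1 + x.2) (tLevel (m + 1))).toNat
  | _ => 0

theorem reflElevation_of_a12 {m : ℕ} (h : tRoot (m + 1) = .a12) (z x : Weight) (a : ℕ) :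
    (reflElevation m z x a : ℤ) =
      longElevation z.1 (z.2 - a) (x.1 + x.2) x.2 (tLevel (m + 1)) := by
  rw [reflElevation, h]
  exact Int.toNat_of_nonneg (longElevation_nonneg _ _ _ _ _)

theorem reflElevation_of_a2 {m : ℕ} (h : tRoot (m + 1) = .a2) (z x : Weight) (a : ℕ) :
    (reflElevation m z x a : ℤ) =
      longElevation z.1 (z.2 - a) x.2 (x.1 + x.2) (tLevel (m + 1)) := by
  rw [reflElevation, h]
  exact Int.toNat_of_nonneg (longElevation_nonneg _ _ _ _ _)

theorem reflElevation_of_a21 {m : ℕ} (h : tRoot (m + 1) = .a21) (z x : Weight) (a : ℕ) :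
    reflElevation m z x a = 0 := by
  rw [reflElevation, h]

theorem longElevation_mono {L n n' e o J : ℤ} (h : n' ≤ n) :
    longElevation L n e o J ≤ longElevation L n' e o J := by
  unfold longElevation; omega

/-- Lowering the atom can only increase the elevation, as each of its bounds is nonincreasing in `n`
(`longElevation_mono`). This is the source of the injectivity of `ψ`. -/
theorem add_reflElevation_strictMono (m : ℕ) (z x : Weight) :
    StrictMono fun a => a + reflElevation m z x a := by
  intro a b hab
  have : reflElevation m z x a ≤ reflElevation m z x b := by
    cases h : tRoot (m + 1)
    · exact absurd h (tRoot_ne_a1 _)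
    · have := longElevation_mono (L := z.1) (n := z.2 - a) (n' := z.2 - b) (e := x.2)
        (o := x.1 + x.2) (J := tLevel (m + 1)) (by omega)
      rw [← reflElevation_of_a2 h, ← reflElevation_of_a2 h] at this
      exact_mod_cast this
    · have := longElevation_mono (L := z.1) (n := z.2 - a) (n' := z.2 - b) (e := x.1 + x.2)
        (o := x.2) (J := tLevel (m + 1)) (by omega)
      rw [← reflElevation_of_a12 h, ← reflElevation_of_a12 h] at this
      exact_mod_cast this
    · rw [reflElevation_of_a21 h, reflElevation_of_a21 h]
  simp only
  omega

/-- The two ends of an edge `x → t_{m+1} x`, the lower one moved by the elevation. -/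
theorem reflElevation_spec {m : ℕ} {z x : Weight} {a : ℕ} (hz : 0 ≤ z.1) (ha : (a : ℤ) ≤ z.2)
    (hg : 1 ≤ tLevel (m + 1) + (tRoot (m + 1)).pairing x)
    (hy : InHull (z - a • fw2) (tRefl (m + 1) x)) :
    IsLeast (elevationSet (z - a • fw2) x (tRefl (m + 1) x)) (reflElevation m z x a) ∧
    ((a + reflElevation m z x a : ℕ) : ℤ) ≤ z.2 ∧ (z.1 = 0 → reflElevation m z x a = 0) ∧
    InHull (z - (a + reflElevation m z x a) • fw2) x ∧
    atomStat (m + 1) (tRefl (m + 1) x) z a =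
      atomStat (m + 1) x z (a + reflElevation m z x a) - 1 ∧
    atomStat m (tRefl (m + 1) x) z a = atomStat (m + 1) x z (a + reflElevation m z x a) ∧
    atomStat m x z (a + reflElevation m z x a) = atomStat (m + 1) (tRefl (m + 1) x) z a := by
  obtain ⟨k, hk⟩ : ∃ k, k = reflElevation m z x a := ⟨_, rfl⟩
  rw [← hk]
  have hd : Dominant (z - a • fw2) := by rw [sub_nsmul_fw2]; exact ⟨hz, by simp only; omega⟩
  have he : IsEdge (z - a • fw2) x (tRefl (m + 1) x) :=
    (isEdge_tRefl_iff (by omega) hd).2 ⟨hg, hy⟩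
  have hx := he.inHull.1
  have hJ : (1 : ℤ) ≤ tLevel (m + 1) := by exact_mod_cast one_le_tLevel (k := m + 1) (by omega)
  obtain ⟨tl1, tl2, tl3⟩ := twistedLength_tRefl hg
  -- It is enough that the defects at the two ends agree for all four choices of counting the levels
  -- for `m` or `m + 1`; the relations between the statistics then come from `twistedLength` alone.
  suffices h : IsLeast (elevationSet (z - a • fw2) x (tRefl (m + 1) x)) k ∧
      ((a + k : ℕ) : ℤ) ≤ z.2 ∧ (z.1 = 0 → k = 0) ∧ InHull (z - (a + k) • fw2) x ∧
      ∀ i j : ℕ, (i = m ∨ i = m + 1) → (j = m ∨ j = m + 1) →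
        defect z.1 (z.2 - a) ((tRefl (m + 1) x).1 + (tRefl (m + 1) x).2) (tRefl (m + 1) x).2
          (levelCap i .a21) (levelCap i .a12) (levelCap i .a2) a =
        defect z.1 (z.2 - (a + k : ℕ)) (x.1 + x.2) x.2
          (levelCap j .a21) (levelCap j .a12) (levelCap j .a2) (a + k : ℕ) by
    obtain ⟨h1, h2, h3, h4, h5⟩ := h
    have hd' : Dominant (z - (a + k) • fw2) := by
      rw [sub_nsmul_fw2]; exact ⟨hz, by simp only; omega⟩
    refine ⟨h1, h2, h3, h4, ?_⟩
    rw [atomStat_eq hd hy, atomStat_eq hd hy, atomStat_eq hd' h4, atomStat_eq hd' h4,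
      h5 (m + 1) (m + 1) (Or.inr rfl) (Or.inr rfl), h5 m (m + 1) (Or.inl rfl) (Or.inr rfl),
      ← h5 (m + 1) m (Or.inr rfl) (Or.inl rfl), ← h5 (m + 1) (m + 1) (Or.inr rfl) (Or.inr rfl)]
    omega
  have hel : IsLong (tRoot (m + 1)) → IsLabelledEdge (z - a • fw2) x (tRoot (m + 1))
      ((tRoot (m + 1)).pairing x + tLevel (m + 1)) := fun hl =>
    isLabelledEdge_iff_exists.2 ⟨m, (tRefl_apply (by omega) x).symm, he, rfl, by ring⟩
  rw [sub_nsmul_fw2] at hx hy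
  have hxo := inHull_iff_orthHull.1 hx
  simp only at hxo
  have hn : 0 ≤ z.2 - a := by omega
  cases hr : tRoot (m + 1)
  · exact absurd hr (tRoot_ne_a1 _)
  · rw [hr] at hg hel
    simp only [PosRoot.pairing] at hg
    have hyo := (inHull_tRefl_a2_iff (by omega) hr).1 hy
    simp only at hyo
    have hkl := reflElevation_of_a2 hr z x a
    rw [← hk] at hkl
    obtain ⟨s1, s2⟩ := OrthHull.sub_longElevation hz hn hJ hg hxo.swap hyo hkl
    refine ⟨?_, by push_cast; omega, ?_, ?_, ?_⟩
    · have := isLeast_elevationSet (Or.inr rfl) (hel (Or.inr rfl))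
        (by rw [sub_nsmul_fw2]; exact hx) (w := k) (by
          rw [hkl, sub_nsmul_fw2]
          simp only [longCoord, PosRoot.pairing, add_sub_cancel_left])
      rwa [← hr, ← tRefl_apply (by omega)] at this
    · intro h0
      have := longElevation_eq_zero_of_first_eq_zero h0 hxo.swap hyo
      omega
    · rw [sub_nsmul_fw2, inHull_iff_orthHull]
      push_cast
      rw [← sub_sub]
      exact s2.swap
    · obtain ⟨c1, c2, c3, c4, c5, c6⟩ := levelCap_of_tRoot_a2 hr
      intro i j hi hj
      rw [tRefl_of_a2 (by omega) hr]
      simp only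
      have := defect_a2 hz hn hJ hg (Int.natCast_nonneg a) hxo.swap hyo hkl
        (J₁ := levelCap i .a2) (J₂ := levelCap j .a2)
        (by rcases hi with rfl | rfl <;> simp [c5, c6]) (by rcases hj with rfl | rfl <;> simp [c5, c6])
      rw [show x.1 + 2 * x.2 + 2 * (tLevel (m + 1) : ℤ) + (-x.2 - 2 * tLevel (m + 1)) = x.1 + x.2 by
        ring, show (levelCap i .a21 : ℤ) = 2 * tLevel (m + 1) by rcases hi with rfl | rfl <;> assumption,
        show (levelCap j .a21 : ℤ) = 2 * tLevel (m + 1) by rcases hj with rfl | rfl <;> assumption,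
        show levelCap i .a12 = tLevel (m + 1) by rcases hi with rfl | rfl <;> assumption,
        show levelCap j .a12 = tLevel (m + 1) by rcases hj with rfl | rfl <;> assumption, this]
      push_cast
      rw [sub_sub]
  · rw [hr] at hg hel
    simp only [PosRoot.pairing] at hg
    have hyo := (inHull_tRefl_a12_iff (by omega) hr).1 hy
    simp only at hyo
    have hkl := reflElevation_of_a12 hr z x a
    rw [← hk] at hkl
    obtain ⟨s1, s2⟩ := OrthHull.sub_longElevation hz hn hJ hg hxo hyo hkl
    refine ⟨?_, by push_cast; omega, ?_, ?_, ?_⟩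
    · have := isLeast_elevationSet (Or.inl rfl) (hel (Or.inl rfl))
        (by rw [sub_nsmul_fw2]; exact hx) (w := k) (by
          rw [hkl, sub_nsmul_fw2]
          simp only [longCoord, PosRoot.pairing, add_sub_cancel_left])
      rwa [← hr, ← tRefl_apply (by omega)] at this
    · intro h0
      have := longElevation_eq_zero_of_first_eq_zero h0 hxo hyo
      omega
    · rw [sub_nsmul_fw2, inHull_iff_orthHull]
      push_cast
      rw [← sub_sub]
      exact s2
    · obtain ⟨c1, c2, c3, c4, c5, c6⟩ := levelCap_of_tRoot_a12 hr
      intro i j hi hj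
      rw [tRefl_of_a12 (by omega) hr]
      simp only
      have := defect_a12 hz hn hJ hg (Int.natCast_nonneg a) hxo hyo hkl
        (J₁ := levelCap i .a12) (J₂ := levelCap j .a12)
        (by rcases hi with rfl | rfl <;> simp [c3, c4]) (by rcases hj with rfl | rfl <;> simp [c3, c4])
      rw [show -x.1 - 2 * x.2 - 2 * (tLevel (m + 1) : ℤ) + x.2 = -(x.1 + x.2) - 2 * tLevel (m + 1) by
        ring, show (levelCap i .a21 : ℤ) = 2 * tLevel (m + 1) - 1 by
          rcases hi with rfl | rfl <;> assumption,
        show (levelCap j .a21 : ℤ) = 2 * tLevel (m + 1) - 1 by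
          rcases hj with rfl | rfl <;> assumption,
        show (levelCap i .a2 : ℤ) = tLevel (m + 1) - 1 by rcases hi with rfl | rfl <;> assumption,
        show (levelCap j .a2 : ℤ) = tLevel (m + 1) - 1 by rcases hj with rfl | rfl <;> assumption,
        this]
      push_cast
      rw [sub_sub]
  · have hk0 : k = 0 := hk.trans (reflElevation_of_a21 hr z x a)
    subst hk0
    rw [hr] at hg
    simp only [PosRoot.pairing] at hg
    have hyo := (inHull_tRefl_a21_iff (by omega) hr).1 hy
    simp only at hyo
    refine ⟨⟨zero_mem_elevationSet (tRefl_apply (by omega) x) (isSwappable_tRefl_iff.2 ⟨he, ?_⟩),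
      fun _ _ => Nat.zero_le _⟩, by simpa using ha, fun _ => rfl, ?_, ?_⟩
    · rw [hr]; exact not_false
    · rw [add_zero, sub_nsmul_fw2]; exact hx
    · obtain ⟨c1, c2, c3, c4, c5, c6⟩ := levelCap_of_tRoot_a21 hr
      intro i j hi hj
      rw [tRefl_of_a21 (by omega) hr]
      simp only [add_zero]
      rw [show x.1 + (-x.1 - x.2 - (tLevel (m + 1) : ℤ)) = -x.2 - tLevel (m + 1) by ring,
        show -x.1 - x.2 - (tLevel (m + 1) : ℤ) = -(x.1 + x.2) - tLevel (m + 1) by ring,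
        show levelCap i .a12 = levelCap m .a12 by rcases hi with rfl | rfl <;> simp [c3],
        show levelCap j .a12 = levelCap m .a12 by rcases hj with rfl | rfl <;> simp [c3],
        show levelCap i .a2 = levelCap m .a2 by rcases hi with rfl | rfl <;> simp [c4],
        show levelCap j .a2 = levelCap m .a2 by rcases hj with rfl | rfl <;> simp [c4]]
      exact defect_a21 hJ (by omega) hxo hyo
        (by rcases hi with rfl | rfl <;> simp [c1, c2]) (by rcases hj with rfl | rfl <;> simp [c1, c2])
        (by omega) (by omega)

/-- The statistic does not change at the weights fixed by the reflection. -/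
theorem atomStat_succ_of_fixed {m : ℕ} {z x : Weight} {a : ℕ} (hz : 0 ≤ z.1) (ha : (a : ℤ) ≤ z.2)
    (hx : InHull (z - a • fw2) x) (hg : tLevel (m + 1) + (tRoot (m + 1)).pairing x = 0) :
    atomStat m x z a = atomStat (m + 1) x z a := by
  have hd : Dominant (z - a • fw2) := by rw [sub_nsmul_fw2]; exact ⟨hz, by simp only; omega⟩
  rw [atomStat_eq hd hx, atomStat_eq hd hx]
  rw [sub_nsmul_fw2, inHull_iff_orthHull] at hx
  simp only at hx
  have hlong : ∀ {e o J : ℤ}, OrthHull z.1 (z.2 - a) e o → J + e = 0 → ∀ J', J' ≤ J →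
      fullExcess z.1 (z.2 - a) e o J' = 0 ∧ stairLength z.1 (z.2 - a) e o J' = 0 := by
    intro e o J h hJ J' hJ'
    have := neg_two_mul_le_doubleThreshold (L := z.1) (n := z.2 - a) (e := e) (o := o)
    exact ⟨by rw [fullExcess_eq_excess (by omega), h.excess_eq_zero_of_lt (by omega)],
      stairLength_eq_zero (by omega)⟩
  -- A weight on the wall has argument `0` or `-1` in the moving term, and `foldLength` vanishes at
  -- both.
  have hf : ∀ k : ℤ, k = 0 → foldLength k = 0 ∧ foldLength (k - 1) = 0 := by
    rintro k rfl; simp [foldLength]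
  cases hr : tRoot (m + 1)
  · exact absurd hr (tRoot_ne_a1 _)
  · rw [hr] at hg
    simp only [PosRoot.pairing] at hg
    obtain ⟨c1, c2, c3, c4, c5, c6⟩ := levelCap_of_tRoot_a2 hr
    obtain ⟨f1, f2⟩ := hf (x.2 + tLevel (m + 1)) (by omega)
    obtain ⟨p1, p2⟩ := hlong hx.swap hg _ le_rfl
    obtain ⟨q1, q2⟩ := hlong hx.swap hg (tLevel (m + 1) - 1) (by omega)
    simp only [twistedLength, defect, c1, c2, c3, c4, c5, c6, p1, p2, q1, q2, ← add_sub_assoc,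
      f1, f2]
  · rw [hr] at hg
    simp only [PosRoot.pairing] at hg
    obtain ⟨c1, c2, c3, c4, c5, c6⟩ := levelCap_of_tRoot_a12 hr
    obtain ⟨f1, f2⟩ := hf (x.1 + x.2 + tLevel (m + 1)) (by omega)
    obtain ⟨p1, p2⟩ := hlong hx hg _ le_rfl
    obtain ⟨q1, q2⟩ := hlong hx hg (tLevel (m + 1) - 1) (by omega)
    simp only [twistedLength, defect, c1, c2, c3, c4, c5, c6, p1, p2, q1, q2, ← add_sub_assoc,
      f1, f2]
  · rw [hr] at hg
    simp only [PosRoot.pairing] at hg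
    obtain ⟨c1, c2, c3, c4, c5, c6⟩ := levelCap_of_tRoot_a21 hr
    obtain ⟨f1, f2⟩ := hf (x.1 + 2 * x.2 + tLevel (m + 1)) (by omega)
    have he : excess21 z.1 (z.2 - a) (x.1 + x.2) x.2 (tLevel (m + 1)) =
        excess21 z.1 (z.2 - a) (x.1 + x.2) x.2 (tLevel (m + 1) - 1) := by
      obtain ⟨d0, d1, d2, d3, d4, d5, d6, d7, d8⟩ := hx
      clear f1 f2 hlong hf c1 c2 c3 c4 c5 c6 hd
      unfold excess21
      omega
    simp only [twistedLength, defect, c1, c2, c3, c4, he, ← add_sub_assoc, f1, f2]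

/-- At a lower end of a reflection the statistic changes only if the weight comes from an edge moved
by its elevation. -/
theorem atomStat_succ_or_exists {m : ℕ} {z x : Weight} {a : ℕ} (hz : 0 ≤ z.1) (ha : (a : ℤ) ≤ z.2)
    (hx : InHull (z - a • fw2) x) (hg : 1 ≤ tLevel (m + 1) + (tRoot (m + 1)).pairing x) :
    atomStat m x z a = atomStat (m + 1) x z a ∨
      ∃ b : ℕ, (z.1 = 0 → b = a) ∧ InHull (z - b • fw2) (tRefl (m + 1) x) ∧
        b + reflElevation m z x b = a := by
  have hd : Dominant (z - a • fw2) := by rw [sub_nsmul_fw2]; exact ⟨hz, by simp only; omega⟩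
  have hJ : (1 : ℤ) ≤ tLevel (m + 1) := by exact_mod_cast one_le_tLevel (k := m + 1) (by omega)
  rw [atomStat_eq hd hx, atomStat_eq hd hx, (twistedLength_tRefl hg).2.1]
  have hxo := hx
  rw [sub_nsmul_fw2, inHull_iff_orthHull] at hxo
  simp only at hxo
  cases hr : tRoot (m + 1)
  · exact absurd hr (tRoot_ne_a1 _)
  · rw [hr] at hg
    simp only [PosRoot.pairing] at hg
    obtain ⟨c1, c2, c3, c4, c5, c6⟩ := levelCap_of_tRoot_a2 hr
    rcases exists_elevation_or hz hJ hg (Int.natCast_nonneg a) hxo.swap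
      (D := stairLength z.1 (z.2 - a) (x.1 + x.2) x.2 (tLevel (m + 1)))
      (fun h => stairLength_eq_zero_of_le h) with h | ⟨j, h1, h2, h3, h4, h5⟩
    · left
      simp only [defect, c1, c2, c3, c4, c5, c6]
      rw [max_comm (stairLength z.1 (z.2 - a) x.2 (x.1 + x.2) _),
        max_comm (stairLength z.1 (z.2 - a) x.2 (x.1 + x.2) _)] at h
      omega
    · right
      lift j to ℕ using h1
      have hb : ((a - j : ℕ) : ℤ) = a - j := by omega
      refine ⟨a - j, fun h => by have := h5 h; omega, ?_, ?_⟩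
      · rw [sub_nsmul_fw2, inHull_tRefl_a2_iff (by omega) hr, hb]
        simp only
        rwa [← sub_add]
      · have := reflElevation_of_a2 hr z x (a - j)
        rw [hb, ← sub_add, h4] at this
        omega
  · rw [hr] at hg
    simp only [PosRoot.pairing] at hg
    obtain ⟨c1, c2, c3, c4, c5, c6⟩ := levelCap_of_tRoot_a12 hr
    rcases exists_elevation_or hz hJ hg (Int.natCast_nonneg a) hxo
      (D := stairLength z.1 (z.2 - a) x.2 (x.1 + x.2) (tLevel (m + 1) - 1))
      (fun h => stairLength_eq_zero_of_le h) with h | ⟨j, h1, h2, h3, h4, h5⟩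
    · left
      simp only [defect, c1, c2, c3, c4, c5, c6]
      omega
    · right
      lift j to ℕ using h1
      have hb : ((a - j : ℕ) : ℤ) = a - j := by omega
      refine ⟨a - j, fun h => by have := h5 h; omega, ?_, ?_⟩
      · rw [sub_nsmul_fw2, inHull_tRefl_a12_iff (by omega) hr, hb]
        simp only
        rwa [← sub_add]
      · have := reflElevation_of_a12 hr z x (a - j)
        rw [hb, ← sub_add, h4] at this
        omega
  · rw [hr] at hg
    simp only [PosRoot.pairing] at hg
    obtain ⟨c1, c2, c3, c4, c5, c6⟩ := levelCap_of_tRoot_a21 hr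
    by_cases hy : InHull (z - a • fw2) (tRefl (m + 1) x)
    · exact Or.inr ⟨a, fun _ => rfl, hy, by rw [reflElevation_of_a21 hr]; rfl⟩
    · left
      rw [sub_nsmul_fw2, inHull_tRefl_a21_iff (by omega) hr] at hy
      simp only at hy
      have he : excess21 z.1 (z.2 - a) (x.1 + x.2) x.2 (tLevel (m + 1)) =
          excess21 z.1 (z.2 - a) (x.1 + x.2) x.2 (tLevel (m + 1) - 1) + 1 := by
        clear c1 c2 c3 c4 c5 c6 hd hr
        generalize (tLevel (m + 1) : ℤ) = J at *
        have hc : z.1 + (z.2 - a) < x.1 + x.2 + J ∨ z.1 + (z.2 - a) < x.2 + J ∨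
            z.1 + 2 * (z.2 - a) < x.1 + x.2 + x.2 + 2 * J := by
          by_contra hc
          obtain ⟨d0, d1, d2, d3, d4, d5, d6, d7, d8⟩ := hxo
          exact hy (by constructor <;> omega)
        clear hy hx hxo
        unfold excess21
        omega
      simp only [defect, c1, c2, c3, c4, he]
      ring

/-! ### The swapping functions -/

theorem sigmaStat_eq_of_mem_atomIn {lam : Weight} {p a : ℕ} {T : AString} (m : ℕ)
    (h : T ∈ atomIn lam p a) :
    sigmaStat m lam T = atomStat m (wt lam T) (lam - (2 * p) • fw1) a + 2 * p := by
  obtain ⟨h1, h2⟩ := patNum_eq_and_atNum_eq h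
  rw [sigmaStat, atomWt, preatomWt, h1, h2]
  rfl

theorem preatomWt_eq (lam : Weight) (T : AString) :
    preatomWt lam T = (lam.1 - 2 * patNum lam T, lam.2) := by
  rw [preatomWt, sub_nsmul_fw1]; push_cast; rfl

theorem inHull_atomWt {lam : Weight} (hlam : Dominant lam) {T : AString} (h : T ∈ crystal lam) :
    InHull (atomWt lam T) (wt lam T) := by
  rw [atomWt, preatomWt_eq, sub_nsmul_fw2]
  exact inHull_of_mem_atomIn (mem_atomIn_patNum_atNum hlam h)

theorem preatomWt_nonneg {lam : Weight} (hlam : Dominant lam) {T : AString}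
    (h : T ∈ crystal lam) : 0 ≤ (preatomWt lam T).1 ∧ (atNum lam T : ℤ) ≤ (preatomWt lam T).2 := by
  obtain ⟨h1, h2, -⟩ := mem_atomIn_iff.1 (mem_atomIn_patNum_atNum hlam h)
  rw [preatomWt_eq]
  exact ⟨by simp only; omega, h2⟩

/-- The elevation of the edge attached to an element of the crystal at the upper end. -/
noncomputable def stringElevation (m : ℕ) (lam : Weight) (T : AString) : ℕ :=
  reflElevation m (lam - (2 * patNum lam T) • fw1) (tRefl (m + 1) (wt lam T)) (atNum lam T)

section

variable {m : ℕ} {lam : Weight} {T : AString}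

theorem stringElevation_spec (hlam : Dominant lam) (hT : T ∈ upperPart lam (tRefl (m + 1))) :
    IsLeast (elevationSet (atomWt lam T) (tRefl (m + 1) (wt lam T)) (wt lam T))
      (stringElevation m lam T) ∧
    ∃! T', T' ∈ atomIn lam (patNum lam T) (atNum lam T + stringElevation m lam T) ∧
      wt lam T' = tRefl (m + 1) (wt lam T) := by
  obtain ⟨hc, hlt⟩ := hT
  have hlt' := hlt
  rw [← tRefl_tRefl (by omega : 1 ≤ m + 1) (wt lam T),
    tRefl_tRefl (by omega : 1 ≤ m + 1) (tRefl (m + 1) (wt lam T)),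
    bruhatLT_tRefl_iff (by omega)] at hlt'
  obtain ⟨hz, ha⟩ := preatomWt_nonneg hlam hc
  obtain ⟨s1, s2, s3, s4, -⟩ := reflElevation_spec hz ha hlt'
    (by rw [tRefl_tRefl (by omega)]; exact inHull_atomWt hlam hc)
  rw [tRefl_tRefl (by omega)] at s1
  refine ⟨s1, ?_⟩
  obtain ⟨h1, h2, h3, -⟩ := mem_atomIn_iff.1 (mem_atomIn_patNum_atNum hlam hc)
  rw [preatomWt_eq] at s2 s3 s4
  refine existsUnique_mem_atomIn h1 (by rw [stringElevation, ← preatomWt, preatomWt_eq]; exact s2)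
    ?_ ?_
  · refine (Nat.dvd_add_iff_right h3).1 ?_
    -- The new index must be a multiple of `atomStep`. When the step is `2` the elevation is zero;
    -- otherwise the step is `1`.
    by_cases h0 : lam.1 - 2 * patNum lam T = 0
    · rw [stringElevation, ← preatomWt, preatomWt_eq, s3 h0]; exact dvd_zero _
    · rw [atomStep, if_neg h0]; exact one_dvd _
  · rw [stringElevation, ← preatomWt, preatomWt_eq]
    rw [sub_nsmul_fw2] at s4
    exact s4

theorem edgeElevation_eq (hlam : Dominant lam) (hT : T ∈ upperPart lam (tRefl (m + 1))) :
    edgeElevation m lam T = stringElevation m lam T :=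
  (stringElevation_spec hlam hT).1.csInf_eq

theorem psiMap_spec (hlam : Dominant lam) (hT : T ∈ upperPart lam (tRefl (m + 1))) :
    psiMap m lam T ∈ atomIn lam (patNum lam T) (atNum lam T + stringElevation m lam T) ∧
    wt lam (psiMap m lam T) = tRefl (m + 1) (wt lam T) := by
  have h : IsPsiValue m lam T (psiMap m lam T) := by
    obtain ⟨T', hT', -⟩ := (stringElevation_spec hlam hT).2
    refine Classical.epsilon_spec (p := IsPsiValue m lam T) ⟨T', ?_⟩
    rwa [IsPsiValue, edgeElevation_eq hlam hT]
  rwa [IsPsiValue, edgeElevation_eq hlam hT] at h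

theorem sigmaStat_psiMap (hlam : Dominant lam) (hT : T ∈ upperPart lam (tRefl (m + 1))) :
    sigmaStat (m + 1) lam T = sigmaStat (m + 1) lam (psiMap m lam T) - 1 ∧
    sigmaStat m lam T = sigmaStat (m + 1) lam (psiMap m lam T) ∧
    sigmaStat m lam (psiMap m lam T) = sigmaStat (m + 1) lam T := by
  obtain ⟨hp, hw⟩ := psiMap_spec hlam hT
  obtain ⟨hc, hlt⟩ := hT
  have h0 := mem_atomIn_patNum_atNum hlam hc
  rw [← tRefl_tRefl (by omega : 1 ≤ m + 1) (wt lam T),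
    tRefl_tRefl (by omega : 1 ≤ m + 1) (tRefl (m + 1) (wt lam T)),
    bruhatLT_tRefl_iff (by omega)] at hlt
  obtain ⟨hz, ha⟩ := preatomWt_nonneg hlam hc
  obtain ⟨-, -, -, -, s1, s2, s3⟩ := reflElevation_spec hz ha hlt
    (by rw [tRefl_tRefl (by omega)]; exact inHull_atomWt hlam hc)
  rw [tRefl_tRefl (by omega)] at s1 s2 s3
  rw [preatomWt] at s1 s2 s3
  rw [sigmaStat_eq_of_mem_atomIn _ h0, sigmaStat_eq_of_mem_atomIn _ h0,
    sigmaStat_eq_of_mem_atomIn _ hp, sigmaStat_eq_of_mem_atomIn _ hp, hw, stringElevation,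
    s1, s2, s3]
  exact ⟨by ring, rfl, by rw [s1]⟩

/-- The image remembers its preatom and the index `a + Ω`, hence `a` by strict monotonicity; an atom
contains only one element of the given weight. -/
theorem psiMap_inj (hlam : Dominant lam) {U : AString} (hT : T ∈ upperPart lam (tRefl (m + 1)))
    (hU : U ∈ upperPart lam (tRefl (m + 1))) (hw : wt lam T = wt lam U)
    (h : psiMap m lam T = psiMap m lam U) : T = U := by
  have h1 := (psiMap_spec hlam hT).1
  have h2 := (psiMap_spec hlam hU).1
  rw [h] at h1
  obtain ⟨e1, e2⟩ := atomIn_index_unique h1 h2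
  rw [stringElevation, stringElevation, hw, e1] at e2
  have e3 := (add_reflElevation_strictMono m _ _).injective e2
  have hT' := mem_atomIn_patNum_atNum hlam hT.1
  have hU' := mem_atomIn_patNum_atNum hlam hU.1
  rw [e1, e3] at hT'
  obtain ⟨g1, g2, g3, -⟩ := mem_atomIn_iff.1 hU'
  exact (existsUnique_mem_atomIn g1 g2 g3 (inHull_of_mem_atomIn hU')).unique ⟨hT', hw⟩ ⟨hU', rfl⟩

/-- At a lower end a change of the statistic would force the weight to come from an edge moved by
its elevation; the element of the upper atom at the other end would then be mapped to `U`. -/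
theorem sigmaStat_succ_eq (hlam : Dominant lam) {U : AString} (hU : U ∈ crystal lam)
    (h1 : U ∉ upperPart lam (tRefl (m + 1))) (h2 : U ∉ psiMap m lam '' upperPart lam (tRefl (m + 1))) :
    sigmaStat m lam U = sigmaStat (m + 1) lam U := by
  have h0 := mem_atomIn_patNum_atNum hlam hU
  obtain ⟨hz, ha⟩ := preatomWt_nonneg hlam hU
  have hx := inHull_atomWt hlam hU
  rw [sigmaStat_eq_of_mem_atomIn _ h0, sigmaStat_eq_of_mem_atomIn _ h0, add_left_inj]
  have hg : ¬ (tLevel (m + 1) + (tRoot (m + 1)).pairing (wt lam U) < 0) := fun hg =>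
    h1 ⟨hU, (tRefl_bruhatLT_iff (by omega) _).2 hg⟩
  rcases eq_or_lt_of_le (not_lt.1 hg) with hg | hg
  · exact atomStat_succ_of_fixed hz ha hx hg.symm
  · refine (atomStat_succ_or_exists hz ha hx hg).resolve_right ?_
    rintro ⟨b, hb, hy, hba⟩
    obtain ⟨g1, g2, g3, -⟩ := mem_atomIn_iff.1 h0
    rw [preatomWt_eq] at hb hy
    have hb' : atomStep (lam.1 - 2 * patNum lam U, lam.2) ∣ b := by
      by_cases hL : lam.1 - 2 * patNum lam U = 0
      · rw [hb hL]; exact g3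
      · rw [atomStep, if_neg hL]; exact one_dvd _
    rw [sub_nsmul_fw2] at hy
    obtain ⟨T, ⟨hT, hTw⟩, -⟩ := existsUnique_mem_atomIn g1 (by omega) hb' hy
    obtain ⟨i1, i2⟩ := patNum_eq_and_atNum_eq hT
    have hTu : T ∈ upperPart lam (tRefl (m + 1)) := by
      refine ⟨atomIn_subset hT, ?_⟩
      rw [show wt lam T = _ from hTw, tRefl_tRefl (by omega)]
      exact (bruhatLT_tRefl_iff (by omega) _).2 hg
    refine h2 ⟨T, hTu, ?_⟩
    obtain ⟨p1, p2⟩ := psiMap_spec hlam hTu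
    rw [stringElevation, i1, i2, show wt lam T = _ from hTw, tRefl_tRefl (by omega)] at p1
    rw [show wt lam T = _ from hTw, tRefl_tRefl (by omega)] at p2
    rw [preatomWt] at hba
    rw [hba] at p1
    exact (existsUnique_mem_atomIn g1 g2 g3 (inHull_of_mem_atomIn h0)).unique ⟨p1, p2⟩ ⟨h0, rfl⟩

theorem isSwappingFunction_psiMap (hlam : Dominant lam) (m : ℕ) :
    IsSwappingFunction lam (tRefl (m + 1)) (rStat (m + 1) lam) (psiMap m lam) := by
  refine ⟨fun T hT => ?_, fun T hT U hU => psiMap_inj hlam hT hU⟩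
  obtain ⟨h1, h2⟩ := psiMap_spec hlam hT
  refine ⟨atomIn_subset h1, h2, ?_⟩
  rw [rStat, rStat, (sigmaStat_psiMap hlam hT).1]
  push_cast
  ring

theorem isSwapOf_psiMap (hlam : Dominant lam) (m : ℕ) :
    IsSwapOf lam (tRefl (m + 1)) (psiMap m lam) (rStat (m + 1) lam) (rStat m lam) := by
  refine ⟨fun T hT => ?_, fun T hT => ?_, fun U hU h1 h2 => ?_⟩
  · rw [rStat, rStat, (sigmaStat_psiMap hlam hT).2.1]
  · rw [rStat, rStat, (sigmaStat_psiMap hlam hT).2.2]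
  · rw [rStat, rStat, sigmaStat_succ_eq hlam hU h1 h2]

end

/-! ### Crossing a wall in the Hecke algebra -/

theorem letter_letter (k : ℕ) (x : Weight) : letter k (letter k x) = x := by
  unfold letter simple0 simple1 simple2
  split_ifs <;> exact affRefl_affRefl _ _ _

/-- Pulled back along `y_m`, the affine function defining the wall of `t_{m+1}` is, up to sign, that
of the next letter. The sign depends on whether `M` is negative (the letter `s₀`), exactly as the
orientation of the Bruhat order does. -/
theorem letter_bruhatLT_iff (m : ℕ) (z : Weight) :
    (BruhatLT (letter (m + 1) z) z ↔ BruhatLT (tRefl (m + 1) (yElt m z)) (yElt m z)) ∧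
    (BruhatLT z (letter (m + 1) z) ↔ BruhatLT (yElt m z) (tRefl (m + 1) (yElt m z))) := by
  rw [tRefl_bruhatLT_iff (by omega), bruhatLT_tRefl_iff (by omega)]
  have key : ∀ β M, letter (m + 1) = affRefl β M →
      (0 ≤ M ∧ tLevel (m + 1) + (tRoot (m + 1)).pairing (yElt m z) = M - β.pairing z ∨
        M < 0 ∧ tLevel (m + 1) + (tRoot (m + 1)).pairing (yElt m z) = β.pairing z - M) →
      (BruhatLT (letter (m + 1) z) z ↔
        tLevel (m + 1) + (tRoot (m + 1)).pairing (yElt m z) < 0) ∧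
      (BruhatLT z (letter (m + 1) z) ↔
        1 ≤ tLevel (m + 1) + (tRoot (m + 1)).pairing (yElt m z)) := by
    intro β M h1 h2
    have h3 := bruhatLT_affRefl_iff β M z
    have h4 := bruhatLT_affRefl_iff β M (affRefl β M z)
    rw [affRefl_affRefl, pairing_affRefl] at h4
    rw [h1, h3, h4]
    constructor <;> omega
  obtain ⟨q, i, hi, rfl⟩ : ∃ q i, i < 4 ∧ m = 4 * q + i := ⟨m / 4, m % 4, by omega, by omega⟩
  obtain ⟨u, v⟩ := z
  rw [yElt_four_mul_add] at key ⊢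
  interval_cases i
  · have hr : tRoot (4 * q + 0 + 1) = .a21 := by rw [tRoot, if_pos (by omega)]
    have hl : tLevel (4 * q + 0 + 1) = 2 * q + 1 := by rw [tLevel, if_pos (by omega)]; omega
    refine key .a21 (-1) (by rw [letter, if_pos (by omega)]; rfl) ?_
    rw [hr, hl]
    simp [yElt, PosRoot.pairing, PosRoot.root]
    ring
  · have hr : tRoot (4 * q + 1 + 1) = .a12 := by
      rw [tRoot, if_neg (by omega), if_pos (by omega)]
    have hl : tLevel (4 * q + 1 + 1) = q + 1 := by
      rw [tLevel, if_neg (by omega), if_pos (by omega)]; omega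
    refine key .a2 0 (by rw [letter, if_neg (by omega), if_neg (by omega)]; rfl) ?_
    rw [hr, hl]
    simp [yElt, letter, simple0, affRefl_apply, PosRoot.pairing, PosRoot.root]
    ring
  · have hr : tRoot (4 * q + 2 + 1) = .a21 := by rw [tRoot, if_pos (by omega)]
    have hl : tLevel (4 * q + 2 + 1) = 2 * q + 2 := by rw [tLevel, if_pos (by omega)]; omega
    refine key .a1 0 (by rw [letter, if_neg (by omega), if_pos (by omega)]; rfl) ?_
    rw [hr, hl]
    simp [yElt, letter, simple0, simple2, affRefl_apply, PosRoot.pairing, PosRoot.root]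
    ring
  · have hr : tRoot (4 * q + 3 + 1) = .a2 := by
      rw [tRoot, if_neg (by omega), if_neg (by omega)]
    have hl : tLevel (4 * q + 3 + 1) = q + 1 := by
      rw [tLevel, if_neg (by omega), if_neg (by omega)]; omega
    refine key .a2 0 (by rw [letter, if_neg (by omega), if_neg (by omega)]; rfl) ?_
    rw [hr, hl]
    simp [yElt, letter, simple0, simple1, simple2, affRefl_apply, PosRoot.pairing, PosRoot.root]
    ring

/-- Since `y_{m+1}⁻¹ μ = s (y_m⁻¹ μ)`, the operator is evaluated at a reflected point. The case of
`heckeOp` that multiplies by `q` therefore occurs when `t μ < μ`. -/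
theorem etaKL_succ (m : ℕ) (μ lam : Weight) : etaKL (m + 1) μ lam =
    if BruhatLT (tRefl (m + 1) μ) μ then qpow 1 * etaKL m μ lam
    else if BruhatLT μ (tRefl (m + 1) μ) then
      etaKL m μ lam + (1 - qpow 1) * etaKL m (tRefl (m + 1) μ) lam
    else etaKL m μ lam := by
  obtain ⟨z, rfl⟩ := (yElt m).surjective μ
  obtain ⟨h1, h2⟩ := letter_bruhatLT_iff m z
  have e : (yElt (m + 1))⁻¹ (yElt m z) = letter (m + 1) z := by
    rw [Equiv.Perm.inv_eq_iff_eq, yElt, Equiv.Perm.mul_apply, letter_letter]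
  have e' : ∀ w, (yElt m)⁻¹ (yElt m w) = w := fun w => (yElt m).symm_apply_apply w
  simp only [etaKL, e, twistedKL, heckeOp, letter_letter, h1, h2]
  simp only [tRefl_succ, e']
  rw [← tRefl_succ]
  split_ifs with g1 g2
  · rfl
  · rfl
  · have hs : letter (m + 1) z = z := by
      have h5 : tRefl (m + 1) (yElt m z) = yElt m z := by
        rw [tRefl_bruhatLT_iff (by omega)] at g1
        rw [bruhatLT_tRefl_iff (by omega)] at g2
        rw [tRefl_eq_self_iff (by omega)]
        omega
      rw [tRefl_succ] at h5
      exact (yElt m).injective h5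
    rw [hs]

/-- The support never grows: the only other value entering the recursion is at some `t μ > μ`, which
is not below `lam` either. -/
theorem etaKL_eq_zero {lam : Weight} (m : ℕ) : ∀ μ, ¬ BruhatLE μ lam → etaKL m μ lam = 0 := by
  induction m with
  | zero =>
    intro μ h
    simp only [etaKL, yElt, twistedKL, inv_one, Equiv.Perm.one_apply, klChamberPoly, if_neg h]
  | succ m ih =>
    intro μ h
    rw [etaKL_succ, ih μ h]
    split_ifs with h1 h2
    · rw [mul_zero]
    · rw [ih _ fun h3 => h (h2.1.trans h3), mul_zero, add_zero]
    · rfl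

/-! ### Recharges -/

theorem finite_crystal (lam : Weight) : (crystal lam).Finite := by
  refine ((Set.finite_Icc ((0, 0, 0, 0) : ℤ × ℤ × ℤ × ℤ) (3 * lam.1 + 3 * lam.2 + 3 * lam.1 + 3 * lam.2,
    3 * lam.1 + 3 * lam.2, 3 * lam.1 + 3 * lam.2, lam.1)).image
    fun x => (⟨x.1, x.2.1, x.2.2.1, x.2.2.2⟩ : AString)).subset ?_
  rintro ⟨a, b, c, d⟩ ⟨h1, h2, h3, h4, h5, h6, h7, h8⟩
  refine ⟨(a, b, c, d), ⟨⟨?_, ?_, ?_, ?_⟩, ⟨?_, ?_, ?_, ?_⟩⟩, rfl⟩ <;> simp only at * <;>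
    omega

theorem qpow_one_mul_cancel {x y : QRing} (h : qpow 1 * x = qpow 1 * y) : x = y := by
  have e : qpow (-1) * qpow 1 = 1 := by
    rw [qpow, qpow, AddMonoidAlgebra.single_mul_single]; norm_num; rfl
  rw [← one_mul x, ← e, mul_assoc, h, ← mul_assoc, e, one_mul]

theorem qpow_add_one (x : ℚ) : qpow (x + 1) = qpow 1 * qpow x := by
  rw [qpow, qpow, qpow, AddMonoidAlgebra.single_mul_single, one_mul, add_comm]

/-- The generating function of a statistic on a weight space of the crystal. -/
noncomputable def weightSum (lam : Weight) (r : AString → ℚ) (μ : Weight) : QRing :=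
  ∑ T ∈ (finite_crystal lam).toFinset with wt lam T = μ, qpow (r T)

theorem weightSum_eq_finsum (lam : Weight) (r : AString → ℚ) (μ : Weight) :
    ∑ᶠ T ∈ {T : AString | T ∈ crystal lam ∧ wt lam T = μ}, qpow (r T) = weightSum lam r μ := by
  rw [weightSum, ← finsum_mem_coe_finset]
  congr! 4
  ext T
  simp

theorem isRecharge_iff {m : ℕ} {lam : Weight} {r : AString → ℚ} : IsRecharge m lam r ↔
    ∀ μ, BruhatLE μ lam → etaKL m μ lam = weightSum lam r μ := by
  simp only [IsRecharge, weightSum_eq_finsum]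

section

variable {lam : Weight} {t : Equiv.Perm Weight} {r r' : AString → ℚ} {ψ : AString → AString}
  {μ : Weight}

theorem weightSum_of_upper (h : IsSwappingFunction lam t r ψ) (h' : IsSwapOf lam t ψ r r')
    (hμ : BruhatLT (t μ) μ) : weightSum lam r μ = qpow 1 * weightSum lam r' μ := by
  rw [weightSum, weightSum, Finset.mul_sum]
  refine Finset.sum_congr rfl fun T hT => ?_
  rw [Finset.mem_filter, Set.Finite.mem_toFinset] at hT
  have hu : T ∈ upperPart lam t := ⟨hT.1, by rwa [hT.2]⟩
  rw [← qpow_add_one, h'.1 T hu, (h.1 T hu).2.2, sub_add_cancel]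

/-- Elements of weight `μ` outside the image of `ψ` contribute equally to both sums. On the image,
`r` contributes the sum of `r'` over weight `t μ`, whereas `r'` contributes `q` times that sum. -/
theorem weightSum_of_lower (ht : ∀ x, t (t x) = x) (h : IsSwappingFunction lam t r ψ)
    (h' : IsSwapOf lam t ψ r r') (hμ : BruhatLT μ (t μ)) :
    weightSum lam r μ = weightSum lam r' μ + (1 - qpow 1) * weightSum lam r' (t μ) := by
  set B := (finite_crystal lam).toFinset.filter fun T => wt lam T = μ with hB
  set C := (finite_crystal lam).toFinset.filter fun T => wt lam T = t μ with hC
  have hCu : ∀ T ∈ C, T ∈ upperPart lam t := by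
    intro T hT
    rw [hC, Finset.mem_filter, Set.Finite.mem_toFinset] at hT
    exact ⟨hT.1, by rwa [hT.2, ht]⟩
  have hCw : ∀ T ∈ C, wt lam T = t μ := fun T hT => (Finset.mem_filter.1 hT).2
  have hinj : Set.InjOn ψ C := fun T hT U hU e =>
    h.2 T (hCu T hT) U (hCu U hU) (by rw [hCw T hT, hCw U hU]) e
  have hsub : C.image ψ ⊆ B := by
    intro U hU
    obtain ⟨T, hT, rfl⟩ := Finset.mem_image.1 hU
    obtain ⟨h1, h2, -⟩ := h.1 T (hCu T hT)
    rw [hB, Finset.mem_filter, Set.Finite.mem_toFinset]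
    exact ⟨h1, by rw [h2, hCw T hT, ht]⟩
  have hrest : ∑ T ∈ B \ C.image ψ, qpow (r T) = ∑ T ∈ B \ C.image ψ, qpow (r' T) := by
    refine Finset.sum_congr rfl fun U hU => ?_
    rw [Finset.mem_sdiff, hB, Finset.mem_filter, Set.Finite.mem_toFinset] at hU
    obtain ⟨⟨hU1, hU2⟩, hU3⟩ := hU
    rw [h'.2.2 U hU1]
    · rintro ⟨-, hlt⟩
      rw [hU2] at hlt
      exact absurd hlt.weightLength_lt hμ.weightLength_lt.not_gt
    · rintro ⟨T, hT, rfl⟩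
      refine hU3 (Finset.mem_image_of_mem _ ?_)
      rw [hC, Finset.mem_filter, Set.Finite.mem_toFinset]
      exact ⟨hT.1, by rw [← hU2, (h.1 T hT).2.1, ht]⟩
  have e1 : ∑ T ∈ C.image ψ, qpow (r T) = weightSum lam r' (t μ) := by
    rw [Finset.sum_image hinj, weightSum]
    exact Finset.sum_congr rfl fun T hT => by rw [h'.1 T (hCu T hT)]
  have e2 : ∑ T ∈ C.image ψ, qpow (r' T) = qpow 1 * weightSum lam r' (t μ) := by
    rw [Finset.sum_image hinj, weightSum, Finset.mul_sum]
    refine Finset.sum_congr rfl fun T hT => ?_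
    rw [← qpow_add_one, h'.2.1 T (hCu T hT), h'.1 T (hCu T hT), (h.1 T (hCu T hT)).2.2,
      sub_add_cancel]
  rw [weightSum, weightSum, ← hB, ← Finset.sum_sdiff hsub, ← Finset.sum_sdiff hsub, hrest, e1, e2]
  ring

theorem weightSum_of_fixed (h : IsSwappingFunction lam t r ψ) (h' : IsSwapOf lam t ψ r r')
    (ht : ∀ x, t (t x) = x) (hμ : t μ = μ) : weightSum lam r μ = weightSum lam r' μ := by
  refine Finset.sum_congr rfl fun U hU => ?_
  rw [Finset.mem_filter, Set.Finite.mem_toFinset] at hU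
  rw [h'.2.2 U hU.1]
  · rintro ⟨-, hlt⟩
    rw [hU.2, hμ] at hlt
    exact hlt.2 rfl
  · rintro ⟨T, hT, rfl⟩
    have e : wt lam T = μ := by rw [← ht (wt lam T), ← (h.1 T hT).2.1, hU.2, hμ]
    have := hT.2.2
    rw [e, hμ] at this
    exact this rfl

theorem weightSum_eq_zero (hlam : Dominant lam) (hμ : ¬ BruhatLE μ lam) :
    weightSum lam r μ = 0 := by
  refine Finset.sum_eq_zero fun T hT => ?_
  rw [Finset.mem_filter, Set.Finite.mem_toFinset] at hT
  exact absurd (hT.2 ▸ (bruhatLE_iff_inHull hlam).2 (inHull_wt hT.1)) hμ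

end

/-- Generating functions and polynomials obey the same wall-crossing relation. It is solved first at
weights with `t μ < μ`, cancelling `q`, and then at their mirror images; when `t μ` is not below
`lam`, both terms at `t μ` vanish. -/
theorem IsRecharge.swap {m : ℕ} {lam : Weight} (hlam : Dominant lam) {r r' : AString → ℚ}
    {ψ : AString → AString} (h : IsSwappingFunction lam (tRefl (m + 1)) r ψ)
    (h' : IsSwapOf lam (tRefl (m + 1)) ψ r r') (hr : IsRecharge (m + 1) lam r) :
    IsRecharge m lam r' := by
  rw [isRecharge_iff] at hr ⊢
  have ht : ∀ x, tRefl (m + 1) (tRefl (m + 1) x) = x := tRefl_tRefl (by omega)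
  have upper : ∀ μ, BruhatLE μ lam → BruhatLT (tRefl (m + 1) μ) μ →
      etaKL m μ lam = weightSum lam r' μ := by
    intro μ hμ hlt
    have h1 := hr μ hμ
    rw [etaKL_succ, if_pos hlt, weightSum_of_upper h h' hlt] at h1
    exact qpow_one_mul_cancel h1
  intro μ hμ
  have h1 := hr μ hμ
  have h3 := tRefl_bruhatLT_iff (by omega : 1 ≤ m + 1) μ
  have h4 := bruhatLT_tRefl_iff (by omega : 1 ≤ m + 1) μ
  rcases lt_trichotomy (tLevel (m + 1) + (tRoot (m + 1)).pairing μ) 0 with hg | hg | hg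
  · exact upper μ hμ (h3.2 hg)
  · rw [etaKL_succ, if_neg (h3.not.2 (by omega)), if_neg (h4.not.2 (by omega)),
      weightSum_of_fixed h h' ht ((tRefl_eq_self_iff (by omega) μ).2 hg)] at h1
    exact h1
  · have hlt := h4.2 hg
    have h5 : etaKL m (tRefl (m + 1) μ) lam = weightSum lam r' (tRefl (m + 1) μ) := by
      by_cases hle : BruhatLE (tRefl (m + 1) μ) lam
      · exact upper _ hle (by rwa [ht])
      · rw [etaKL_eq_zero m _ hle, weightSum_eq_zero hlam hle]
    rw [etaKL_succ, if_neg (h3.not.2 (by omega)), if_pos hlt, h5,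
      weightSum_of_lower ht h h' hlt] at h1
    exact add_right_cancel h1

theorem mainTheorem9 (lam : Weight) (hlam : Dominant lam) (m : ℕ) :
    (∀ (T : AString) (μ : Weight), T ∈ crystal lam →
      wt lam T = tRefl (m + 1) μ → BruhatLT μ (tRefl (m + 1) μ) →
        T ∈ atomIn lam (patNum lam T) (atNum lam T) ∧
        IsEdge (atomWt lam T) μ (tRefl (m + 1) μ) ∧
        (elevationSet (atomWt lam T) μ (tRefl (m + 1) μ)).Nonempty ∧
        (∃! T' : AString,
          T' ∈ atomIn lam (patNum lam T)
            (atNum lam T + elevation (atomWt lam T) μ (tRefl (m + 1) μ)) ∧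
          wt lam T' = μ) ∧
        psiMap m lam T ∈ atomIn lam (patNum lam T)
          (atNum lam T + elevation (atomWt lam T) μ (tRefl (m + 1) μ)) ∧
        wt lam (psiMap m lam T) = μ ∧
        sigmaStat (m + 1) lam T = sigmaStat (m + 1) lam (psiMap m lam T) - 1) ∧
    IsSwappingFunction lam (tRefl (m + 1)) (rStat (m + 1) lam) (psiMap m lam) ∧
    IsSwapOf lam (tRefl (m + 1)) (psiMap m lam) (rStat (m + 1) lam) (rStat m lam) ∧
    (IsRecharge (m + 1) lam (rStat (m + 1) lam) → IsRecharge m lam (rStat m lam)) := by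
  refine ⟨fun T μ hT hw hlt => ?_, isSwappingFunction_psiMap hlam m, isSwapOf_psiMap hlam m,
    IsRecharge.swap hlam (isSwappingFunction_psiMap hlam m) (isSwapOf_psiMap hlam m)⟩
  have hμ : μ = tRefl (m + 1) (wt lam T) := by rw [hw, tRefl_tRefl (by omega)]
  have hTu : T ∈ upperPart lam (tRefl (m + 1)) := ⟨hT, by rw [← hμ, hw]; exact hlt⟩
  obtain ⟨s1, s2⟩ := stringElevation_spec hlam hTu
  obtain ⟨p1, p2⟩ := psiMap_spec hlam hTu
  obtain ⟨hz, ha⟩ := preatomWt_nonneg hlam hT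
  rw [← hμ] at s1 s2 p2
  rw [← hw]
  have he : elevation (atomWt lam T) μ (wt lam T) = stringElevation m lam T := s1.csInf_eq
  rw [he]
  refine ⟨mem_atomIn_patNum_atNum hlam hT, ?_, ⟨_, s1.1⟩, s2, p1, p2, (sigmaStat_psiMap hlam hTu).1⟩
  have hd : Dominant (atomWt lam T) := by
    rw [atomWt, sub_nsmul_fw2]; exact ⟨hz, by simp only; omega⟩
  rw [hw, isEdge_tRefl_iff (by omega) hd, ← hw]
  exact ⟨(bruhatLT_tRefl_iff (by omega) μ).1 hlt, inHull_atomWt hlam hT⟩
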